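/- Let $m\ge 0$, let $n_1>\dots>n_m$ be integers, $s_1,\dots,s_m\in\mathbb N$, $r=\sum_i s_i$, and $\mathcal E=\bigoplus_{i=1}^m\mathcal O_{\mathbb P^1_{\mathbb C}}(n_i)^{\oplus s_i}$. For $d\in\mathbb Z$ let $\mathbb C[X_0,X_1]_d$ be the space of homogeneous polynomials of degree $d$ (zero if $d<0$), and put $$V=\bigoplus_{i=1}^m\big(\mathbb C[X_0,X_1]_{-2-n_i}^*\big)^{\oplus s_i},$$ $$G=\big\{(A_{ij})_{1\le i,j\le m}\ \big|\ A_{ij}\in M_{s_i s_j}(\mathbb C[X_0,X_1]_{n_i-n_j}),\ A_{ii}\in \mathrm{GL}(s_i,\mathbb C)\big\}.$$ For a holomorphic affine bundle $A$ on $\mathbb P^1_{\mathbb C}$ let $L(A)$ be its linearisation (the holomorphic vector bundle of translations of the fibres), and let $h_A\in H^1(\mathbb P^1_{\mathbb C},L(A))$ be its invariant, i.e. the class of the cocycle of differences of local holomorphic sections of $A$. The moduli space of affine bundles with linearisation type $[\mathcal E]$ is the topological quotient $H^1(\mathbb P^1_{\mathbb C},\mathcal E)/\mathrm{Aut}(\mathcal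 E)$. Then: 1. $G$ is an affine algebraic group under matrix multiplication: it is the principal Zariski open set $\prod_i\det A_{ii}\neq0$ in a finite-dimensional algebra of block matrices, and $A\mapsto A^{-1}$ is regular. There is a group isomorphism $\psi:G\to\mathrm{Aut}(\mathcal E)$ for which $\psi(A)$ is multiplication by the matrix $A$, sections of $\mathcal O(n)$ being regarded as homogeneous functions of degree $n$ in $X_0,X_1$. 2. There is a linear isomorphism $S: H^1(\mathbb P^1_{\mathbb C},\mathcal E)\to V$, given by Serre duality: the class defined by a section $f=(f_{i,a})$ of $\mathcal E$ over $\{X_0X_1\ne0\}$ (as a cocycle for the standard cover) is mapped to the family of linear forms $$P\mapsto\frac1{2\pi i}\oint_{|z|=1}f_{i,a}(1,z)\,P(1,z)\,dz .$$ Through $\psi$ and $S$ the action of $\mathrm{Aut}(\mathcal E)$ on $H^1(\mathbb P^1_{\mathbb C},\mathcal E)$ becomes the action of $G$ on $V$ $$A\bullet\Phi=\Big(\sum_{j=1}^m{}^{t}m_{A_{ij}}(\Phi_j)\Big)_{1\le i\le m},$$ where $m_{A_{ij}}:\mathbb C[X_0,X_1]_{-2-n_i}^{\oplus s_i}\to\mathbb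 C[X_0,X_1]_{-2-n_j}^{\oplus s_j}$ is multiplication by the matrix $A_{ij}$ (acting on row vectors), and ${}^tm_{A_{ij}}$ is its transpose. 3. The map sending an affine bundle $A$ with an isomorphism $f:\mathcal E\simeq L(A)$ to the orbit of $H^1(f)^{-1}(h_A)$ induces a well-defined bijection from the set of isomorphism classes of holomorphic affine bundles $A$ of rank $r$ on $\mathbb P^1_{\mathbb C}$ with $L(A)\simeq\mathcal E$ onto $H^1(\mathbb P^1_{\mathbb C},\mathcal E)/\mathrm{Aut}(\mathcal E)$, and $S$ induces a homeomorphism $$H^1(\mathbb P^1_{\mathbb C},\mathcal E)/\mathrm{Aut}(\mathcal E)\ \simeq\ V/G .$$ -/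

import Mathlib

open scoped Manifold ContDiff LinearAlgebra.Projectivization Topology
open Bundle MvPolynomial

noncomputable section
namespace AffP1

/-- The complex projective line. -/
abbrev P1 : Type := ℙ ℂ (Fin 2 → ℂ)

instance : TopologicalSpace P1 :=
  inferInstanceAs (TopologicalSpace (Quotient (projectivizationSetoid ℂ (Fin 2 → ℂ))))

theorem isQuotientMap_mk : Topology.IsQuotientMap (Projectivization.mk' ℂ (V := Fin 2 → ℂ)) :=
  isQuotientMap_quot_mk

/-- The open set `X_k ≠ 0`. -/
def coordOpen (k : Fin 2) : Set P1 := {p | p.rep k ≠ 0}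

theorem mk_mem_coordOpen (k : Fin 2) (v : Fin 2 → ℂ) (hv : v ≠ 0) :
    Projectivization.mk ℂ v hv ∈ coordOpen k ↔ v k ≠ 0 := by
  obtain ⟨a, ha⟩ := Projectivization.exists_smul_eq_mk_rep ℂ v hv
  have : (Projectivization.mk ℂ v hv).rep k = (a : ℂ) * v k := by rw [← ha]; rfl
  simp [coordOpen, this]

theorem isOpen_coordOpen (k : Fin 2) : IsOpen (coordOpen k) := by
  rw [← isQuotientMap_mk.isOpen_preimage]
  have : Projectivization.mk' ℂ ⁻¹' coordOpen k
      = {v : {v : Fin 2 → ℂ // v ≠ 0} | v.1 k ≠ 0} := by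
    ext v; exact mk_mem_coordOpen k v.1 v.2
  rw [this]
  exact isOpen_ne_fun ((continuous_apply k).comp continuous_subtype_val) continuous_const

/-- The ratio `X_i / X_k` of homogeneous coordinates. -/
def ratio (i k : Fin 2) (p : P1) : ℂ := p.rep i / p.rep k

theorem ratio_mk (i k : Fin 2) (v : Fin 2 → ℂ) (hv : v ≠ 0) :
    ratio i k (Projectivization.mk ℂ v hv) = v i / v k := by
  obtain ⟨a, ha⟩ := Projectivization.exists_smul_eq_mk_rep ℂ v hv
  have (j : Fin 2) : (Projectivization.mk ℂ v hv).rep j = (a : ℂ) * v j := by rw [← ha]; rfl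
  simp only [ratio, this]
  exact mul_div_mul_left _ _ a.ne_zero

theorem continuousOn_ratio (i k : Fin 2) : ContinuousOn (ratio i k) (coordOpen k) := by
  rw [isQuotientMap_mk.continuousOn_isOpen_iff (isOpen_coordOpen k)]
  have : (ratio i k ∘ Projectivization.mk' ℂ)
      = fun v : {v : Fin 2 → ℂ // v ≠ 0} => v.1 i / v.1 k := by
    ext v; exact ratio_mk i k v.1 v.2
  rw [this]
  refine ContinuousOn.div ((continuous_apply i).comp continuous_subtype_val).continuousOn
    ((continuous_apply k).comp continuous_subtype_val).continuousOn ?_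
  intro v hv
  exact (mk_mem_coordOpen k v.1 v.2).1 hv

/-- The vector with `k`-th coordinate `1` and other coordinate `z`. -/
def affVec (k : Fin 2) (z : ℂ) : Fin 2 → ℂ := Function.update (fun _ => z) k 1

theorem affVec_same (k : Fin 2) (z : ℂ) : affVec k z k = 1 := by simp [affVec]

theorem affVec_other (k : Fin 2) (z : ℂ) : affVec k z (1 - k) = z := by
  fin_cases k <;> simp [affVec]

theorem affVec_ne_zero (k : Fin 2) (z : ℂ) : affVec k z ≠ 0 := fun h => by
  simpa [affVec_same] using congrFun h k

/-- The affine chart `X_k ≠ 0` of the projective line, with coordinate `X_{1-k} / X_k`. -/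
def affChart (k : Fin 2) : OpenPartialHomeomorph P1 ℂ where
  toFun := ratio (1 - k) k
  invFun z := Projectivization.mk ℂ (affVec k z) (affVec_ne_zero k z)
  source := coordOpen k
  target := Set.univ
  map_source' _ _ := Set.mem_univ _
  map_target' z _ := by rw [mk_mem_coordOpen, affVec_same]; exact one_ne_zero
  left_inv' p hp := by
    induction p using Projectivization.ind with
    | h v hv =>
      rw [mk_mem_coordOpen] at hp
      rw [ratio_mk, Projectivization.mk_eq_mk_iff']
      refine ⟨(v k)⁻¹, ?_⟩
      ext j
      fin_cases k <;> fin_cases j <;> simp_all [affVec, div_eq_inv_mul]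
  right_inv' z _ := by rw [ratio_mk, affVec_same, affVec_other, div_one]
  open_source := isOpen_coordOpen k
  open_target := isOpen_univ
  continuousOn_toFun := continuousOn_ratio _ _
  continuousOn_invFun := by
    have h : Continuous fun z : ℂ =>
        (⟨affVec k z, affVec_ne_zero k z⟩ : {v : Fin 2 → ℂ // v ≠ 0}) := by
      refine Continuous.subtype_mk ?_ _
      unfold affVec
      fun_prop
    exact (isQuotientMap_mk.continuous.comp h).continuousOn

/-- The index of an affine chart around `p`: `0` if `X_0(p) ≠ 0` and `1` otherwise. -/
def chartIndex (p : P1) : Fin 2 := open Classical in if p ∈ coordOpen 0 then 0 else 1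

theorem mem_coordOpen_chartIndex (p : P1) : p ∈ coordOpen (chartIndex p) := by
  unfold chartIndex
  split_ifs with h
  · exact h
  · intro h1
    refine p.rep_nonzero (funext fun j => ?_)
    fin_cases j
    · simpa [coordOpen] using h
    · exact h1

instance : ChartedSpace ℂ P1 where
  atlas := Set.range affChart
  chartAt p := affChart (chartIndex p)
  mem_chart_source p := mem_coordOpen_chartIndex p
  chart_mem_atlas _ := Set.mem_range_self _

theorem ratio_mul_ratio (i j k : Fin 2) (p : P1) (hp : p ∈ coordOpen j) :
    ratio i j p * ratio j k p = ratio i k p := by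
  unfold ratio
  exact div_mul_div_cancel₀ hp

instance : IsManifold 𝓘(ℂ) ω P1 := by
  refine isManifold_of_contDiffOn _ _ _ ?_
  rintro _ _ ⟨k, rfl⟩ ⟨l, rfl⟩
  simp only [modelWithCornersSelf_coe, modelWithCornersSelf_coe_symm, Function.comp_id,
    Function.id_comp, Set.preimage_id, Set.range_id, Set.inter_univ]
  by_cases hkl : k = l
  · subst hkl
    refine contDiffOn_id.congr fun z hz => ?_
    exact (affChart k).right_inv hz.1
  · obtain rfl : l = 1 - k := by revert hkl; fin_cases k <;> fin_cases l <;> simp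
    have key : ∀ z, (affChart (1 - k)) ((affChart k).symm z) = z⁻¹ := fun z => by
      change ratio (1 - (1 - k)) (1 - k) (Projectivization.mk ℂ (affVec k z) _) = _
      rw [ratio_mk, affVec_other, sub_sub_cancel, affVec_same, one_div]
    refine ContDiffOn.congr (f := fun z : ℂ => z⁻¹) ?_ fun z _ => key z
    intro z hz
    have hz' : z ≠ 0 := by
      have := hz.2
      change Projectivization.mk ℂ (affVec k z) _ ∈ coordOpen (1 - k) at this
      rwa [mk_mem_coordOpen, affVec_other] at this
    exact (contDiffAt_inv ℂ hz').contDiffWithinAt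

theorem contMDiffOn_ratio (i k : Fin 2) :
    ContMDiffOn 𝓘(ℂ) 𝓘(ℂ) ω (ratio i k) (coordOpen k) := by
  by_cases h : i = k
  · subst h
    refine (contMDiffOn_const (c := (1 : ℂ))).congr fun p hp => div_self hp
  · obtain rfl : i = 1 - k := by revert h; fin_cases k <;> fin_cases i <;> simp
    have h : affChart k ∈ atlas ℂ P1 := Set.mem_range_self k
    exact contMDiffOn_of_mem_maximalAtlas (IsManifold.subset_maximalAtlas h)


variable {m : ℕ}

/-- The diagonal map with entries `c i`. -/
def diagCLM {ι : Type} [Fintype ι] (c : ι → ℂ) : (ι → ℂ) →L[ℂ] (ι → ℂ) :=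
  ContinuousLinearMap.pi fun i => c i • ContinuousLinearMap.proj i

theorem contDiff_diagCLM {ι : Type} [Fintype ι] : ContDiff ℂ ω (diagCLM (ι := ι)) := by
  let L : (ι → ℂ) →ₗ[ℂ] ((ι → ℂ) →L[ℂ] (ι → ℂ)) :=
    { toFun := diagCLM
      map_add' := fun c d => by ext v i; simp [diagCLM, add_mul]
      map_smul' := fun a c => by ext v i; simp [diagCLM, mul_assoc] }
  exact (LinearMap.toContinuousLinearMap L).contDiff

theorem contMDiffOn_diag (n : Fin m → ℤ) (s : Fin m → ℕ) (i j : Fin 2) :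
    ContMDiffOn 𝓘(ℂ) 𝓘(ℂ, ((Σ i, Fin (s i)) → ℂ) →L[ℂ] ((Σ i, Fin (s i)) → ℂ)) ω
      (fun p => diagCLM fun a : Σ i, Fin (s i) => ratio i j p ^ n a.1)
      (coordOpen i ∩ coordOpen j) := by
  refine (contDiff_diagCLM (ι := Σ i, Fin (s i))).contMDiff.comp_contMDiffOn ?_
  rw [contMDiffOn_pi_space]
  intro a p hp
  have h1 : ContMDiffWithinAt 𝓘(ℂ) 𝓘(ℂ) ω (ratio i j) (coordOpen i ∩ coordOpen j) p :=
    (contMDiffOn_ratio i j p hp.2).mono Set.inter_subset_right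
  have hne : ratio i j p ≠ 0 := div_ne_zero hp.1 hp.2
  have h2 : ContDiffAt ℂ ω (fun z : ℂ => z ^ n a.1) (ratio i j p) := by
    exact (analyticAt_id.zpow hne).contDiffAt
  exact h2.contMDiffAt.comp_contMDiffWithinAt p h1

/-- The holomorphic vector bundle `⊕ O(n_i)^{s_i}`: over `U_k = {X_k ≠ 0}` a homogeneous function `f` of
degree `n_i` has coordinate `f / X_k ^ n_i`, so that the transition from `U_i` to `U_j` is
multiplication by `(X_i / X_j) ^ n`. -/
def splitCore (n : Fin m → ℤ) (s : Fin m → ℕ) :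
    VectorBundleCore ℂ P1 ((Σ i, Fin (s i)) → ℂ) (Fin 2) where
  baseSet := coordOpen
  isOpen_baseSet := isOpen_coordOpen
  indexAt := chartIndex
  mem_baseSet_at := mem_coordOpen_chartIndex
  coordChange i j p := diagCLM fun a => ratio i j p ^ n a.1
  coordChange_self i p hp v := by
    ext a
    have : ratio i i p = 1 := div_self hp
    simp [diagCLM, this]
  continuousOn_coordChange i j := (contMDiffOn_diag n s i j).continuousOn
  coordChange_comp i j k p hp v := by
    ext a
    simp only [diagCLM, ContinuousLinearMap.coe_pi', smul_apply,
      ContinuousLinearMap.proj_apply, smul_eq_mul, ← mul_assoc, ← mul_zpow]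
    rw [mul_comm (ratio j k p), ratio_mul_ratio _ _ _ _ hp.1.2]

instance (n : Fin m → ℤ) (s : Fin m → ℕ) : (splitCore n s).IsContMDiff 𝓘(ℂ) ω :=
  ⟨contMDiffOn_diag n s⟩

/-- The fibres of `⊕ O(n_i)^{s_i}`. -/
abbrev SplitBundle (n : Fin m → ℤ) (s : Fin m → ℕ) : P1 → Type := (splitCore n s).Fiber


section Cohomology

variable {X : Type} [TopologicalSpace X] [ChartedSpace ℂ X]
variable (F : Type) [NormedAddCommGroup F] [NormedSpace ℂ F]
  (E : X → Type) [TopologicalSpace (TotalSpace F E)] [∀ x, AddCommGroup (E x)]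
  [∀ x, Module ℂ (E x)] [∀ x, TopologicalSpace (E x)] [FiberBundle F E]
variable {F' : Type} [NormedAddCommGroup F'] [NormedSpace ℂ F']
  {E' : X → Type} [TopologicalSpace (TotalSpace F' E')] [∀ x, AddCommGroup (E' x)]
  [∀ x, Module ℂ (E' x)] [∀ x, TopologicalSpace (E' x)] [FiberBundle F' E']

variable {E} in
/-- `s` is a holomorphic section of `E` over `U`. -/
def IsHolSection (s : ∀ x, E x) (U : Set X) : Prop :=
  ContMDiffOn 𝓘(ℂ) (𝓘(ℂ).prod 𝓘(ℂ, F)) ω (fun x => TotalSpace.mk' F x (s x)) U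

/-- `U` assigns to every point an open neighbourhood. -/
def IsNhdCover {X : Type} [TopologicalSpace X] (U : X → Set X) : Prop := ∀ x, IsOpen (U x) ∧ x ∈ U x

theorem IsNhdCover.inter {X : Type} [TopologicalSpace X] {U V : X → Set X} (hU : IsNhdCover U) (hV : IsNhdCover V) :
    IsNhdCover fun x => U x ∩ V x :=
  fun x => ⟨(hU x).1.inter (hV x).1, (hU x).2, (hV x).2⟩

variable [VectorBundle ℂ F E]

/-- Čech 1-cocycles of the sheaf of holomorphic sections of `E`, for covers indexed by the points of
`X` (these are cofinal among all open covers). `c x y` is a total function, of which only the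
restriction to `U x ∩ U y` matters: see `H1`. -/
def cocycles : Submodule ℂ (X → X → ∀ x, E x) where
  carrier := {c | ∃ U : X → Set X, IsNhdCover U ∧
    (∀ x y, IsHolSection F (c x y) (U x ∩ U y)) ∧
    ∀ x y z, ∀ p ∈ U x ∩ U y ∩ U z, c x z p = c x y p + c y z p}
  add_mem' := by
    rintro c d ⟨U, hU, hc, hc'⟩ ⟨V, hV, hd, hd'⟩
    refine ⟨_, hU.inter hV, fun x y => ?_, fun x y z p hp => ?_⟩
    · exact ContMDiffOn.add_section ((hc x y).mono fun p hp => ⟨hp.1.1, hp.2.1⟩)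
        ((hd x y).mono fun p hp => ⟨hp.1.2, hp.2.2⟩)
    · simp only [Pi.add_apply]
      rw [hc' x y z p ⟨⟨hp.1.1.1, hp.1.2.1⟩, hp.2.1⟩, hd' x y z p ⟨⟨hp.1.1.2, hp.1.2.2⟩, hp.2.2⟩]
      abel
  zero_mem' := ⟨fun _ => Set.univ, fun _ => ⟨isOpen_univ, trivial⟩,
    fun _ _ => (contMDiff_zeroSection ℂ E).contMDiffOn, fun _ _ _ _ _ => (add_zero _).symm⟩
  smul_mem' := by
    rintro a c ⟨U, hU, hc, hc'⟩
    refine ⟨U, hU, fun x y => ContMDiffOn.const_smul_section (hc x y), fun x y z p hp => ?_⟩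
    simp only [Pi.smul_apply, hc' x y z p hp, smul_add]

/-- Cochains that become Čech coboundaries after a refinement of the cover. -/
def coboundaries : Submodule ℂ (X → X → ∀ x, E x) where
  carrier := {c | ∃ (U : X → Set X) (b : X → ∀ x, E x), IsNhdCover U ∧
    (∀ x, IsHolSection F (b x) (U x)) ∧
    ∀ x y, ∀ p ∈ U x ∩ U y, c x y p = b y p - b x p}
  add_mem' := by
    rintro c d ⟨U, b, hU, hb, hc⟩ ⟨V, b', hV, hb', hd⟩
    refine ⟨_, b + b', hU.inter hV, fun x => ?_, fun x y p hp => ?_⟩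
    · exact ContMDiffOn.add_section ((hb x).mono fun p hp => hp.1)
        ((hb' x).mono fun p hp => hp.2)
    · simp only [Pi.add_apply]
      rw [hc x y p ⟨hp.1.1, hp.2.1⟩, hd x y p ⟨hp.1.2, hp.2.2⟩]
      abel
  zero_mem' := ⟨fun _ => Set.univ, 0, fun _ => ⟨isOpen_univ, trivial⟩,
    fun _ => (contMDiff_zeroSection ℂ E).contMDiffOn, fun _ _ _ _ => (sub_zero _).symm⟩
  smul_mem' := by
    rintro a c ⟨U, b, hU, hb, hc⟩
    refine ⟨U, a • b, hU, fun x => ContMDiffOn.const_smul_section (hb x), fun x y p hp => ?_⟩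
    simp only [Pi.smul_apply, hc x y p hp, smul_sub]

/-- The first Čech cohomology `H¹(X, E)` of the sheaf of holomorphic sections of `E`: the direct limit
over all open covers. -/
def H1 : Type := cocycles F E ⧸ (coboundaries F E).submoduleOf (cocycles F E)

instance : AddCommGroup (H1 F E) :=
  inferInstanceAs (AddCommGroup (cocycles F E ⧸ (coboundaries F E).submoduleOf (cocycles F E)))

instance : Module ℂ (H1 F E) :=
  inferInstanceAs (Module ℂ (cocycles F E ⧸ (coboundaries F E).submoduleOf (cocycles F E)))

/-- The topology of a finite dimensional complex vector space, if `H¹(X, E)` is one. -/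
instance : TopologicalSpace (H1 F E) := moduleTopology ℂ (H1 F E)

variable {E} in
/-- The class of a cocycle. -/
def H1.mk (c : X → X → ∀ x, E x) (hc : c ∈ cocycles F E) : H1 F E :=
  Submodule.Quotient.mk (⟨c, hc⟩ : cocycles F E)

end Cohomology

section Iso

variable {X : Type} [TopologicalSpace X] [ChartedSpace ℂ X]
variable (F₁ : Type) [NormedAddCommGroup F₁] [NormedSpace ℂ F₁]
  (E₁ : X → Type) [TopologicalSpace (TotalSpace F₁ E₁)] [∀ x, AddCommGroup (E₁ x)]
  [∀ x, Module ℂ (E₁ x)] [∀ x, TopologicalSpace (E₁ x)] [FiberBundle F₁ E₁]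
  (F₂ : Type) [NormedAddCommGroup F₂] [NormedSpace ℂ F₂]
  (E₂ : X → Type) [TopologicalSpace (TotalSpace F₂ E₂)] [∀ x, AddCommGroup (E₂ x)]
  [∀ x, Module ℂ (E₂ x)] [∀ x, TopologicalSpace (E₂ x)] [FiberBundle F₂ E₂]
  (F₃ : Type) [NormedAddCommGroup F₃] [NormedSpace ℂ F₃]
  (E₃ : X → Type) [TopologicalSpace (TotalSpace F₃ E₃)] [∀ x, AddCommGroup (E₃ x)]
  [∀ x, Module ℂ (E₃ x)] [∀ x, TopologicalSpace (E₃ x)] [FiberBundle F₃ E₃]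

/-- Isomorphisms of holomorphic vector bundles. -/
@[ext]
structure HolIso where
  equiv : ∀ x, E₁ x ≃ₗ[ℂ] E₂ x
  hol : ContMDiff (𝓘(ℂ).prod 𝓘(ℂ, F₁)) (𝓘(ℂ).prod 𝓘(ℂ, F₂)) ω
    fun v : TotalSpace F₁ E₁ => TotalSpace.mk' F₂ v.proj (equiv v.proj v.snd)
  hol_symm : ContMDiff (𝓘(ℂ).prod 𝓘(ℂ, F₂)) (𝓘(ℂ).prod 𝓘(ℂ, F₁)) ω
    fun v : TotalSpace F₂ E₂ => TotalSpace.mk' F₁ v.proj ((equiv v.proj).symm v.snd)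

variable {F₁ E₁ F₂ E₂ F₃ E₃}

def HolIso.refl : HolIso F₁ E₁ F₁ E₁ := ⟨fun _ => .refl ℂ _, contMDiff_id, contMDiff_id⟩

def HolIso.symm (f : HolIso F₁ E₁ F₂ E₂) : HolIso F₂ E₂ F₁ E₁ :=
  ⟨fun x => (f.equiv x).symm, f.hol_symm, f.hol⟩

def HolIso.trans (f : HolIso F₁ E₁ F₂ E₂) (g : HolIso F₂ E₂ F₃ E₃) : HolIso F₁ E₁ F₃ E₃ :=
  ⟨fun x => (f.equiv x).trans (g.equiv x), g.hol.comp f.hol, f.hol_symm.comp g.hol_symm⟩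

theorem HolIso.isHolSection (f : HolIso F₁ E₁ F₂ E₂) {s : ∀ x, E₁ x} {U : Set X}
    (hs : IsHolSection F₁ s U) : IsHolSection F₂ (fun x => f.equiv x (s x)) U :=
  f.hol.comp_contMDiffOn hs

variable (F₁ E₁) in
/-- The group `Aut(E)`; multiplication is composition. -/
abbrev BundleAut : Type := HolIso F₁ E₁ F₁ E₁

instance : Group (BundleAut F₁ E₁) where
  mul f g := g.trans f
  one := .refl
  inv := .symm
  mul_assoc _ _ _ := rfl
  one_mul _ := rfl
  mul_one _ := rfl
  inv_mul_cancel f := by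
    ext x v
    exact (f.equiv x).symm_apply_apply v

variable [VectorBundle ℂ F₁ E₁] [VectorBundle ℂ F₂ E₂]

/-- The map on cochains. -/
def HolIso.cochainMap (f : HolIso F₁ E₁ F₂ E₂) :
    (X → X → ∀ x, E₁ x) →ₗ[ℂ] (X → X → ∀ x, E₂ x) where
  toFun c x y p := f.equiv p (c x y p)
  map_add' c d := by ext x y p; simp
  map_smul' a c := by ext x y p; simp

theorem HolIso.map_cocycles (f : HolIso F₁ E₁ F₂ E₂) :
    ∀ c ∈ cocycles F₁ E₁, f.cochainMap c ∈ cocycles F₂ E₂ := by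
  rintro c ⟨U, hU, hc, hc'⟩
  refine ⟨U, hU, fun x y => f.isHolSection (hc x y), fun x y z p hp => ?_⟩
  simp only [cochainMap, LinearMap.coe_mk, AddHom.coe_mk, hc' x y z p hp, map_add]

theorem HolIso.map_coboundaries (f : HolIso F₁ E₁ F₂ E₂) :
    ∀ c ∈ coboundaries F₁ E₁, f.cochainMap c ∈ coboundaries F₂ E₂ := by
  rintro c ⟨U, b, hU, hb, hc⟩
  refine ⟨U, fun x p => f.equiv p (b x p), hU, fun x => f.isHolSection (hb x), fun x y p hp => ?_⟩
  simp only [cochainMap, LinearMap.coe_mk, AddHom.coe_mk, hc x y p hp, map_sub]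

/-- The map `H¹(f) : H¹(X, E₁) → H¹(X, E₂)`. -/
def HolIso.H1map (f : HolIso F₁ E₁ F₂ E₂) : H1 F₁ E₁ →ₗ[ℂ] H1 F₂ E₂ :=
  Submodule.mapQ _ _ (f.cochainMap.restrict f.map_cocycles)
    fun c hc => f.map_coboundaries c.1 hc

/-- `Aut(E)` acts on `H¹(X, E)` by functoriality. -/
instance : MulAction (BundleAut F₁ E₁) (H1 F₁ E₁) where
  smul f h := f.H1map h
  one_smul h := by
    induction h using Submodule.Quotient.induction_on with
    | H c => rfl
  mul_smul f g h := by
    induction h using Submodule.Quotient.induction_on with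
    | H c => rfl

end Iso

section Affine

variable {X : Type} [TopologicalSpace X] [ChartedSpace ℂ X]

section
variable {r : ℕ} {Z : Type} [TopologicalSpace Z] [ChartedSpace (ℂ × (Fin r → ℂ)) Z] {q : Z → X}

/-- The local trivialisation `q⁻¹(U) → U × ℂ^r` is biholomorphic. -/
def IsHolTriv (e : Trivialization (Fin r → ℂ) q) : Prop :=
  ContMDiffOn 𝓘(ℂ, ℂ × (Fin r → ℂ)) (𝓘(ℂ).prod 𝓘(ℂ, Fin r → ℂ)) ω e e.source ∧
  ContMDiffOn (𝓘(ℂ).prod 𝓘(ℂ, Fin r → ℂ)) 𝓘(ℂ, ℂ × (Fin r → ℂ)) ω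
    e.toOpenPartialHomeomorph.symm e.target

/-- The map `e'_x ∘ e_x⁻¹` from `ℂ^r` to `ℂ^r`. -/
def transition (e e' : Trivialization (Fin r → ℂ) q) (x : X) (v : Fin r → ℂ) : Fin r → ℂ :=
  (e' (e.toOpenPartialHomeomorph.symm (x, v))).2

/-- Compatibility of local trivialisations: `e'_x ∘ e_x⁻¹` is an affine transformation. -/
def AffCompatible (e e' : Trivialization (Fin r → ℂ) q) : Prop :=
  ∀ x ∈ e.baseSet ∩ e'.baseSet, ∃ f : (Fin r → ℂ) ≃ᵃ[ℂ] (Fin r → ℂ), transition e e' x = f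

/-- Bundle atlases with structure group `Aff(r, ℂ)`. -/
structure IsAffAtlas (T : Set (Trivialization (Fin r → ℂ) q)) : Prop where
  hol : ∀ e ∈ T, IsHolTriv e
  cover : ∀ x, ∃ e ∈ T, x ∈ e.baseSet
  compatible : ∀ e ∈ T, ∀ e' ∈ T, AffCompatible e e'
end

variable (X) in
/-- Holomorphic affine bundles of rank `r` on `X`: a holomorphic map with a maximal bundle atlas with
structure group `Aff(r, ℂ)`. -/
structure AffBundle (r : ℕ) where
  Total : Type
  [top : TopologicalSpace Total]
  [charted : ChartedSpace (ℂ × (Fin r → ℂ)) Total]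
  [manifold : IsManifold 𝓘(ℂ, ℂ × (Fin r → ℂ)) ω Total]
  proj : Total → X
  proj_hol : ContMDiff 𝓘(ℂ, ℂ × (Fin r → ℂ)) 𝓘(ℂ) ω proj
  atlas : Set (Trivialization (Fin r → ℂ) proj)
  maximal : Maximal IsAffAtlas atlas

attribute [instance] AffBundle.top AffBundle.charted AffBundle.manifold

namespace AffBundle

variable {r : ℕ} (A : AffBundle X r)

theorem transition_self {e : Trivialization (Fin r → ℂ) A.proj} {x : X} (hx : x ∈ e.baseSet)
    (v : Fin r → ℂ) : transition e e x v = v := by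
  have : (x, v) ∈ e.target := by rw [e.target_eq]; exact ⟨hx, trivial⟩
  unfold transition
  exact congrArg Prod.snd (e.toOpenPartialHomeomorph.right_inv this)

theorem proj_symm {e : Trivialization (Fin r → ℂ) A.proj} {x : X} (hx : x ∈ e.baseSet)
    (v : Fin r → ℂ) : A.proj (e.toOpenPartialHomeomorph.symm (x, v)) = x :=
  e.proj_symm_apply (by rw [e.target_eq]; exact ⟨hx, trivial⟩)

theorem symm_triv {e : Trivialization (Fin r → ℂ) A.proj} {x : X} (hx : x ∈ e.baseSet)
    {a : A.Total} (ha : A.proj a = x) : e.toOpenPartialHomeomorph.symm (x, (e a).2) = a := by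
  subst ha
  have : a ∈ e.source := e.mem_source.2 hx
  have h2 : (A.proj a, (e a).2) = e a := Prod.ext (e.coe_fst this).symm rfl
  rw [h2]
  exact e.toOpenPartialHomeomorph.left_inv this

theorem transition_apply {e e' : Trivialization (Fin r → ℂ) A.proj} {x : X}
    (hx : x ∈ e.baseSet) {a : A.Total} (ha : A.proj a = x) :
    transition e e' x (e a).2 = (e' a).2 := by
  rw [transition, A.symm_triv hx ha]

theorem transition_comp {e e' e'' : Trivialization (Fin r → ℂ) A.proj} {x : X}
    (hx : x ∈ e.baseSet) (hx' : x ∈ e'.baseSet) (v : Fin r → ℂ) :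
    transition e' e'' x (transition e e' x v) = transition e e'' x v :=
  A.transition_apply hx' (A.proj_symm hx v)

theorem contMDiffOn_transition (e e' : A.atlas) (v : Fin r → ℂ) :
    ContMDiffOn 𝓘(ℂ) 𝓘(ℂ, Fin r → ℂ) ω (fun x => transition e.1 e'.1 x v)
      (e.1.baseSet ∩ e'.1.baseSet) := by
  have h1 := (A.maximal.prop.hol e.1 e.2).2
  have h2 := (A.maximal.prop.hol e'.1 e'.2).1
  have h3 : ContMDiffOn 𝓘(ℂ) (𝓘(ℂ).prod 𝓘(ℂ, Fin r → ℂ)) ω (fun x : X => (x, v))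
      (e.1.baseSet ∩ e'.1.baseSet) := contMDiffOn_id.prodMk contMDiffOn_const
  refine contMDiff_snd.comp_contMDiffOn (h2.comp (h1.comp h3 ?_) ?_)
  · intro x hx
    rw [Set.mem_preimage, e.1.target_eq]; exact ⟨hx.1, trivial⟩
  · intro x hx
    exact e'.1.mem_source.2 (by
      change A.proj (e.1.toOpenPartialHomeomorph.symm (x, v)) ∈ _
      rw [A.proj_symm hx.1]; exact hx.2)

/-- The linear part of the transition map. -/
def linPart (e e' : A.atlas) (x : X) : (Fin r → ℂ) →L[ℂ] (Fin r → ℂ) :=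
  open Classical in
  if hx : x ∈ e.1.baseSet ∩ e'.1.baseSet then
    LinearMap.toContinuousLinearMap
      (A.maximal.prop.compatible e.1 e.2 e'.1 e'.2 x hx).choose.linear.toLinearMap
  else 0

theorem linPart_apply (e e' : A.atlas) {x : X} (hx : x ∈ e.1.baseSet ∩ e'.1.baseSet)
    (v w : Fin r → ℂ) :
    A.linPart e e' x (v - w) = transition e.1 e'.1 x v - transition e.1 e'.1 x w := by
  have h := (A.maximal.prop.compatible e.1 e.2 e'.1 e'.2 x hx).choose_spec
  have h' (u) := congrFun h u
  rw [linPart, dif_pos hx, h' v, h' w]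
  simpa using ((A.maximal.prop.compatible e.1 e.2 e'.1 e'.2 x hx).choose.toAffineMap.linearMap_vsub
    v w)

theorem contMDiffOn_linPart (e e' : A.atlas) :
    ContMDiffOn 𝓘(ℂ) 𝓘(ℂ, (Fin r → ℂ) →L[ℂ] (Fin r → ℂ)) ω (A.linPart e e')
      (e.1.baseSet ∩ e'.1.baseSet) := by
  let L : (Fin r → (Fin r → ℂ)) →ₗ[ℂ] ((Fin r → ℂ) →L[ℂ] (Fin r → ℂ)) :=
    (LinearMap.toContinuousLinearMap.toLinearMap).comp
      ((Pi.basisFun ℂ (Fin r)).constr ℂ).toLinearMap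
  have key : Set.EqOn (A.linPart e e') (fun x => LinearMap.toContinuousLinearMap L
      fun i => transition e.1 e'.1 x (Pi.single i 1) - transition e.1 e'.1 x 0)
      (e.1.baseSet ∩ e'.1.baseSet) := by
    intro x hx
    refine ContinuousLinearMap.coe_injective ((Pi.basisFun ℂ (Fin r)).ext fun i => ?_)
    have := A.linPart_apply e e' hx (Pi.single i 1) 0
    rw [sub_zero] at this
    simp only [L, ContinuousLinearMap.coe_coe, LinearMap.coe_toContinuousLinearMap',
      LinearMap.comp_apply, LinearEquiv.coe_coe]
    rw [Module.Basis.constr_basis, Pi.basisFun_apply, this]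
  refine ContMDiffOn.congr ?_ key
  refine (LinearMap.toContinuousLinearMap L).contDiff.contMDiff.comp_contMDiffOn ?_
  rw [contMDiffOn_pi_space]
  exact fun i => (A.contMDiffOn_transition e e' _).sub (A.contMDiffOn_transition e e' _)

theorem exists_triv (x : X) : ∃ e : A.atlas, x ∈ e.1.baseSet :=
  let ⟨e, he, hx⟩ := A.maximal.prop.cover x
  ⟨⟨e, he⟩, hx⟩

/-- A trivialisation in the atlas chosen around `x`. -/
def trivAt (x : X) : A.atlas := (A.exists_triv x).choose

theorem mem_trivAt (x : X) : x ∈ (A.trivAt x).1.baseSet := (A.exists_triv x).choose_spec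

/-- The linearisation of `A`, as the vector bundle with fibre `ℂ^r` associated with the linear parts
of the transition maps. Its fibre at `x` is the space of translations of `A_x`, a translation being
described by the vector by which it moves in the trivialisation `trivAt x`. -/
def linCore : VectorBundleCore ℂ X (Fin r → ℂ) A.atlas where
  baseSet e := e.1.baseSet
  isOpen_baseSet e := e.1.open_baseSet
  indexAt := A.trivAt
  mem_baseSet_at := A.mem_trivAt
  coordChange := A.linPart
  coordChange_self e x hx v := by
    have := A.linPart_apply e e ⟨hx, hx⟩ v 0
    rwa [sub_zero, A.transition_self hx, A.transition_self hx, sub_zero] at this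
  continuousOn_coordChange e e' := (A.contMDiffOn_linPart e e').continuousOn
  coordChange_comp e e' e'' x hx v := by
    have h1 := A.linPart_apply e e' hx.1 v 0
    have h2 := A.linPart_apply e e'' ⟨hx.1.1, hx.2⟩ v 0
    rw [sub_zero] at h1 h2
    rw [h1, h2, A.linPart_apply e' e'' ⟨hx.1.2, hx.2⟩, A.transition_comp hx.1.1 hx.1.2,
      A.transition_comp hx.1.1 hx.1.2]

instance : A.linCore.IsContMDiff 𝓘(ℂ) ω := ⟨A.contMDiffOn_linPart⟩

/-- The linearisation `L(A)`, a holomorphic vector bundle. -/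
abbrev Lin : X → Type := A.linCore.Fiber

/-- The translation of the fibre `A_x` that maps `a` to `b`. -/
def diff (x : X) (b a : A.Total) : A.Lin x :=
  ((A.trivAt x).1 b).2 - ((A.trivAt x).1 a).2

/-- A holomorphic section of `A` near `x`. -/
def localSection (x : X) (p : X) : A.Total :=
  (A.trivAt x).1.toOpenPartialHomeomorph.symm (p, 0)

/-- The cocycle of differences of local sections of `A`. -/
def diffCocycle (x y : X) (p : X) : A.Lin p := A.diff p (A.localSection y p) (A.localSection x p)

theorem diffCocycle_mem : A.diffCocycle ∈ cocycles (Fin r → ℂ) A.Lin := by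
  refine ⟨fun x => (A.trivAt x).1.baseSet,
    fun x => ⟨(A.trivAt x).1.open_baseSet, A.mem_trivAt x⟩, fun x y => ?_, fun x y z p _ => ?_⟩
  · intro p hp
    rw [contMDiffWithinAt_section]
    have h1 : ContMDiffWithinAt 𝓘(ℂ) 𝓘(ℂ, Fin r → ℂ) ω
        (fun z => transition (A.trivAt y).1 (A.trivAt p).1 z 0
          - transition (A.trivAt x).1 (A.trivAt p).1 z 0)
        ((A.trivAt x).1.baseSet ∩ (A.trivAt y).1.baseSet) p := by
      have h2 (w : X) (hw : p ∈ (A.trivAt w).1.baseSet) : ContMDiffAt 𝓘(ℂ) 𝓘(ℂ, Fin r → ℂ) ω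
          (fun z => transition (A.trivAt w).1 (A.trivAt p).1 z 0) p :=
        (A.contMDiffOn_transition (A.trivAt w) (A.trivAt p) 0).contMDiffAt
          (((A.trivAt w).1.open_baseSet.inter (A.trivAt p).1.open_baseSet).mem_nhds
            ⟨hw, A.mem_trivAt p⟩)
      exact ((h2 y hp.2).sub (h2 x hp.1)).contMDiffWithinAt
    have key : ∀ z ∈ ((A.trivAt x).1.baseSet ∩ (A.trivAt y).1.baseSet) ∩ (A.trivAt p).1.baseSet,
        (trivializationAt (Fin r → ℂ) A.Lin p ⟨z, A.diffCocycle x y z⟩).2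
          = transition (A.trivAt y).1 (A.trivAt p).1 z 0
            - transition (A.trivAt x).1 (A.trivAt p).1 z 0 := by
      intro z hz
      change A.linPart (A.trivAt z) (A.trivAt p) z (_ - _) = _
      rw [A.linPart_apply _ _ ⟨A.mem_trivAt z, hz.2⟩]
      have h3 (w : X) (hw : z ∈ (A.trivAt w).1.baseSet) := A.transition_apply
        (e' := (A.trivAt p).1) (a := A.localSection w z) (A.mem_trivAt z) (A.proj_symm hw 0)
      rw [h3 y hz.1.2, h3 x hz.1.1]
      rfl
    refine h1.congr_of_eventuallyEq ?_ (key p ⟨hp, A.mem_trivAt p⟩)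
    filter_upwards [inter_mem_nhdsWithin _
      ((A.trivAt p).1.open_baseSet.mem_nhds (A.mem_trivAt p))] with z hz using key z hz
  · simp only [diffCocycle, diff]
    exact (sub_add_sub_cancel' _ _ _).symm

/-- The invariant `h_A ∈ H¹(X, L(A))`. It is `δ(1)` for the extension `0 → L(A) → L̃(A) → O → 0`: the
local sections of `A` are the local lifts of `1` to `L̃(A)`, and `δ(1)` is the class of their
differences (it does not depend on the local sections chosen). -/
def hClass : H1 (Fin r → ℂ) A.Lin := H1.mk _ A.diffCocycle A.diffCocycle_mem

end AffBundle

end Affine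

section Moduli

variable {X : Type} [TopologicalSpace X] [ChartedSpace ℂ X] {r : ℕ}

/-- Isomorphism of affine bundles: a biholomorphism over `X` that is affine on the fibres. -/
def AffIsomorphic (A B : AffBundle X r) : Prop :=
  ∃ γ : Diffeomorph 𝓘(ℂ, ℂ × (Fin r → ℂ)) 𝓘(ℂ, ℂ × (Fin r → ℂ)) A.Total B.Total ω,
    (∀ a, B.proj (γ a) = A.proj a) ∧
    ∀ e ∈ A.atlas, ∀ e' ∈ B.atlas, ∀ x ∈ e.baseSet ∩ e'.baseSet,
      ∃ f : (Fin r → ℂ) ≃ᵃ[ℂ] (Fin r → ℂ),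
        ∀ v, (e' (γ (e.toOpenPartialHomeomorph.symm (x, v)))).2 = f v

theorem AffIsomorphic.refl (A : AffBundle X r) : AffIsomorphic A A :=
  ⟨Diffeomorph.refl _ _ _, fun _ => rfl, fun e he e' he' x hx =>
    (A.maximal.prop.compatible e he e' he' x hx).imp fun _ h v => congrFun h v⟩

theorem AffIsomorphic.symm {A B : AffBundle X r} (h : AffIsomorphic A B) : AffIsomorphic B A := by
  obtain ⟨γ, hγ, h⟩ := h
  have hγ' (b : B.Total) : A.proj (γ.symm b) = B.proj b := by
    rw [← hγ, Diffeomorph.apply_symm_apply]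
  refine ⟨γ.symm, hγ', fun e he e' he' x hx => ?_⟩
  obtain ⟨f, hf⟩ := h e' he' e he x hx.symm
  refine ⟨f.symm, fun v => ?_⟩
  have h1 : B.proj (e.toOpenPartialHomeomorph.symm (x, v)) = x := B.proj_symm hx.1 v
  rw [AffineEquiv.eq_symm_apply, ← hf, A.symm_triv hx.2 ((hγ' _).trans h1),
    Diffeomorph.apply_symm_apply]
  exact B.transition_self hx.1 v

theorem AffIsomorphic.trans {A B C : AffBundle X r} (h : AffIsomorphic A B)
    (h' : AffIsomorphic B C) : AffIsomorphic A C := by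
  obtain ⟨γ, hγ, h⟩ := h
  obtain ⟨δ, hδ, h'⟩ := h'
  refine ⟨γ.trans δ, fun a => (hδ _).trans (hγ a), fun e he e'' he'' x hx => ?_⟩
  obtain ⟨e', he', hx'⟩ := B.maximal.prop.cover x
  obtain ⟨f, hf⟩ := h e he e' he' x ⟨hx.1, hx'⟩
  obtain ⟨g, hg⟩ := h' e' he' e'' he'' x ⟨hx', hx.2⟩
  refine ⟨f.trans g, fun v => ?_⟩
  have h1 : B.proj (γ (e.toOpenPartialHomeomorph.symm (x, v))) = x :=
    (hγ _).trans (A.proj_symm hx.1 v)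
  rw [AffineEquiv.trans_apply, ← hf, ← hg, B.symm_triv hx' h1]
  rfl

variable (F : Type) [NormedAddCommGroup F] [NormedSpace ℂ F]
  (E : X → Type) [TopologicalSpace (TotalSpace F E)] [∀ x, AddCommGroup (E x)]
  [∀ x, Module ℂ (E x)] [∀ x, TopologicalSpace (E x)] [FiberBundle F E]

/-- Affine bundles of rank `r` with linearisation isomorphic to `E`. -/
abbrev AffBundleWithLin (r : ℕ) : Type 1 :=
  {A : AffBundle X r // Nonempty (HolIso F E (Fin r → ℂ) A.Lin)}

instance affSetoid (r : ℕ) : Setoid (AffBundleWithLin F E r) where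
  r A B := AffIsomorphic A.1 B.1
  iseqv := ⟨fun A => .refl A.1, .symm, .trans⟩

/-- The set of isomorphism classes of affine bundles `A` of rank `r` with `L(A) ≃ E`. -/
def AffClasses (r : ℕ) : Type 1 := Quotient (affSetoid F E r)

end Moduli


/-- `ℂ[X₀,X₁]_d` for an integer `d`: the polynomials all of whose monomials have degree `d`, so only
`0` if `d < 0`. -/
def binForm (d : ℤ) : Submodule ℂ (MvPolynomial (Fin 2) ℂ) :=
  weightedHomogeneousSubmodule ℂ (fun _ => (1 : ℤ)) d

theorem weight_one (e : Fin 2 →₀ ℕ) :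
    Finsupp.weight (fun _ : Fin 2 => (1 : ℤ)) e = (e.degree : ℤ) := by
  simp [Finsupp.weight_apply, Finsupp.degree_apply, Finsupp.sum]

theorem mem_binForm {d : ℤ} {p : MvPolynomial (Fin 2) ℂ} :
    p ∈ binForm d ↔ ∀ e, coeff e p ≠ 0 → (e.degree : ℤ) = d := by
  simp only [binForm, mem_weightedHomogeneousSubmodule, IsWeightedHomogeneous, weight_one]

theorem binForm_natCast (d : ℕ) : binForm d = homogeneousSubmodule (Fin 2) ℂ d := by
  ext p
  rw [mem_binForm, mem_homogeneousSubmodule]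
  simp only [IsHomogeneous, IsWeightedHomogeneous, Nat.cast_inj, Finsupp.degree_eq_weight_one]
  rfl

theorem binForm_neg {d : ℤ} (hd : d < 0) : binForm d = ⊥ := by
  rw [eq_bot_iff]
  intro p hp
  rw [Submodule.mem_bot]
  by_contra h
  obtain ⟨e, he⟩ := ne_zero_iff.1 h
  have := mem_binForm.1 hp e he
  omega

theorem mul_mem_binForm {d e f : ℤ} {p q : MvPolynomial (Fin 2) ℂ} (hp : p ∈ binForm d)
    (hq : q ∈ binForm e) (h : d + e = f) : p * q ∈ binForm f :=
  h ▸ IsWeightedHomogeneous.mul hp hq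

instance (d : ℤ) : Module.Finite ℂ (binForm d) := by
  rcases lt_or_ge d 0 with h | h
  · rw [binForm_neg h]; infer_instance
  · lift d to ℕ using h
    rw [binForm_natCast]
    exact Module.Finite.iff_fg.2 (homogeneousSubmodule_fg _ _ _)

theorem mem_binForm_zero {p : MvPolynomial (Fin 2) ℂ} (hp : p ∈ binForm 0) : p = C (coeff 0 p) := by
  ext e
  rw [coeff_C]
  split_ifs with h
  · rw [h]
  · by_contra h'
    have := mem_binForm.1 hp e h'
    exact h ((Finsupp.degree_eq_zero_iff e).1 (by exact_mod_cast this)).symm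

section Forms

variable {m : ℕ} (n : Fin m → ℤ) (s : Fin m → ℕ)

/-- The algebra of block matrices `A = (A_ij)` with `A_ij ∈ M_{s_i s_j}(ℂ[X₀,X₁]_{n_i - n_j})`. -/
def gradedEnd : Subalgebra ℂ
    (Matrix (Σ i, Fin (s i)) (Σ i, Fin (s i)) (MvPolynomial (Fin 2) ℂ)) where
  carrier := {A | ∀ a b, A a b ∈ binForm (n a.1 - n b.1)}
  mul_mem' {A B} hA hB a b := by
    rw [Matrix.mul_apply]
    exact Submodule.sum_mem _ fun c _ => mul_mem_binForm (hA a c) (hB c b) (by ring)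
  add_mem' {A B} hA hB a b := Submodule.add_mem (binForm (n a.1 - n b.1)) (hA a b) (hB a b)
  algebraMap_mem' z a b := by
    rw [Matrix.algebraMap_matrix_apply]
    split_ifs with h
    · subst h
      rw [sub_self]
      exact mem_binForm.2 fun e he => by
        rw [MvPolynomial.algebraMap_eq, coeff_C] at he
        by_cases h0 : 0 = e
        · subst h0; simp
        · simp [h0] at he
    · exact Submodule.zero_mem _

variable {n s}

/-- The diagonal block `A_ii`, whose entries are constants. -/
def diagBlock (A : gradedEnd n s) (i : Fin m) : Matrix (Fin (s i)) (Fin (s i)) ℂ :=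
  fun a b => coeff 0 (A.1 ⟨i, a⟩ ⟨i, b⟩)

theorem diagBlock_one (i : Fin m) : diagBlock (1 : gradedEnd n s) i = 1 := by
  ext a b
  by_cases h : a = b
  · subst h; simp [diagBlock]
  · simp [diagBlock, h]

theorem apply_eq_zero (hn : StrictAnti n) (A : gradedEnd n s) {a b : Σ i, Fin (s i)}
    (h : b.1 < a.1) : A.1 a b = 0 := by
  have h1 := A.2 a b
  rwa [binForm_neg (sub_neg.2 (hn h)), Submodule.mem_bot] at h1

theorem diagBlock_mul (hn : StrictAnti n) (A B : gradedEnd n s) (i : Fin m) :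
    diagBlock (A * B) i = diagBlock A i * diagBlock B i := by
  ext a b
  simp only [diagBlock, MulMemClass.coe_mul, Matrix.mul_apply, coeff_sum]
  rw [Fintype.sum_sigma, Finset.sum_eq_single i]
  · refine Finset.sum_congr rfl fun c _ => ?_
    exact map_mul (constantCoeff (σ := Fin 2) (R := ℂ)) _ _
  · intro j _ hj
    refine Finset.sum_eq_zero fun c _ => ?_
    rcases lt_or_gt_of_ne hj with h | h
    · rw [apply_eq_zero hn A (show (⟨j, c⟩ : Σ i, Fin (s i)).1 < i from h), zero_mul, coeff_zero]
    · rw [apply_eq_zero hn B (show i < (⟨j, c⟩ : Σ i, Fin (s i)).1 from h), mul_zero, coeff_zero]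
  · simp

variable (n s) in
/-- The group `G`: block matrices `A` whose diagonal blocks `A_ii` lie in `GL(s_i, ℂ)`, under matrix
multiplication. -/
def structGroup (_hn : StrictAnti n) : Type :=
  {A : gradedEnd n s // ∀ i, IsUnit (diagBlock A i)}

instance : Module.Finite ℂ (gradedEnd n s) := by
  let L : gradedEnd n s →ₗ[ℂ] (∀ a b : Σ i, Fin (s i), binForm (n a.1 - n b.1)) :=
    { toFun := fun A a b => ⟨A.1 a b, A.2 a b⟩
      map_add' := fun _ _ => rfl
      map_smul' := fun _ _ => rfl }
  refine Module.Finite.of_injective L fun A B h => ?_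
  ext1
  ext1 a b
  exact congrArg Subtype.val (congrFun (congrFun h a) b)

theorem exists_inverse (hn : StrictAnti n) (A : gradedEnd n s)
    (hA : ∀ i, IsUnit (diagBlock A i)) : ∃ B : gradedEnd n s, A * B = 1 ∧ B * A = 1 := by
  have htri : A.1.BlockTriangular Sigma.fst := fun a b h => apply_eq_zero hn A h
  have hdet : IsUnit A.1.det := by
    rw [htri.det_fintype]
    refine IsUnit.prod_univ_iff.2 fun i => ?_
    let φ : Fin (s i) ≃ {a : Σ i, Fin (s i) // a.1 = i} :=
      { toFun := fun c => ⟨⟨i, c⟩, rfl⟩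
        invFun := fun a => a.2 ▸ a.1.2
        left_inv := fun _ => rfl
        right_inv := by rintro ⟨⟨j, c⟩, rfl⟩; rfl }
    have h1 : (A.1.toSquareBlock Sigma.fst i).submatrix φ φ
        = (diagBlock A i).map (C : ℂ →+* MvPolynomial (Fin 2) ℂ) := by
      ext1 a b
      have := A.2 ⟨i, a⟩ ⟨i, b⟩
      rw [sub_self] at this
      exact mem_binForm_zero this
    rw [← Matrix.det_submatrix_equiv_self φ, h1, ← RingHom.mapMatrix_apply, ← RingHom.map_det]
    exact ((Matrix.isUnit_iff_isUnit_det _).1 (hA i)).map _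
  have hinj : Function.Injective (LinearMap.mulLeft ℂ A) := by
    intro B D h
    have h2 : A.1 * B.1 = A.1 * D.1 := congrArg Subtype.val h
    exact Subtype.ext (((Matrix.isUnit_iff_isUnit_det _).2 hdet).mul_left_cancel h2)
  obtain ⟨B, hB⟩ := LinearMap.injective_iff_surjective.1 hinj 1
  refine ⟨B, hB, Subtype.ext ?_⟩
  exact mul_eq_one_comm.1 (congrArg Subtype.val hB)

instance (hn : StrictAnti n) : Group (structGroup n s hn) where
  mul A B := ⟨A.1 * B.1, fun i => by rw [diagBlock_mul hn]; exact (A.2 i).mul (B.2 i)⟩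
  one := ⟨1, fun i => by rw [diagBlock_one]; exact isUnit_one⟩
  inv A := ⟨(exists_inverse hn A.1 A.2).choose, fun i => by
    have h := congrArg (diagBlock · i) (exists_inverse hn A.1 A.2).choose_spec.1
    simp only [diagBlock_mul hn, diagBlock_one] at h
    exact IsUnit.of_mul_eq_one_right _ h⟩
  mul_assoc A B D := Subtype.ext (mul_assoc A.1 B.1 D.1)
  one_mul A := Subtype.ext (one_mul A.1)
  mul_one A := Subtype.ext (mul_one A.1)
  inv_mul_cancel A := Subtype.ext (exists_inverse hn A.1 A.2).choose_spec.2

variable (n s)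

/-- The vector space `⊕ (ℂ[X₀,X₁]_{-2-n_i}^*)^{s_i}` with its topology of a finite dimensional complex
vector space. -/
def DualForms : Type := ∀ i, Fin (s i) → Module.Dual ℂ (binForm (-2 - n i))

instance : AddCommGroup (DualForms n s) :=
  inferInstanceAs (AddCommGroup (∀ i, Fin (s i) → Module.Dual ℂ (binForm (-2 - n i))))

instance : Module ℂ (DualForms n s) :=
  inferInstanceAs (Module ℂ (∀ i, Fin (s i) → Module.Dual ℂ (binForm (-2 - n i))))

instance : TopologicalSpace (DualForms n s) := moduleTopology ℂ (DualForms n s)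

variable {n s}

/-- The multiplication map `m_Q : ℂ[X₀,X₁]_{-2-n_i} → ℂ[X₀,X₁]_{-2-n_j}` by an entry `Q` of the
block `A_ij`. -/
def mulEntry (A : gradedEnd n s) (x y : Σ i, Fin (s i)) :
    binForm (-2 - n x.1) →ₗ[ℂ] binForm (-2 - n y.1) :=
  (LinearMap.mulLeft ℂ (A.1 x y)).restrict fun _ hP => mul_mem_binForm (A.2 x y) hP (by ring)

/-- The transpose of the multiplication map `m_{A_ij} : (P_a)_a ↦ (∑_a A_ij[a,b] P_a)_b`, from
`(ℂ[X₀,X₁]_{-2-n_i})^{s_i}` to `(ℂ[X₀,X₁]_{-2-n_j})^{s_j}`. -/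
def transposeMul (A : gradedEnd n s) (i j : Fin m)
    (Φ : Fin (s j) → Module.Dual ℂ (binForm (-2 - n j))) :
    Fin (s i) → Module.Dual ℂ (binForm (-2 - n i)) :=
  fun a => ∑ b, (mulEntry A ⟨i, a⟩ ⟨j, b⟩).dualMap (Φ b)

theorem transposeMul_apply (A : gradedEnd n s) (i j : Fin m)
    (Φ : Fin (s j) → Module.Dual ℂ (binForm (-2 - n j))) (a : Fin (s i))
    (P : binForm (-2 - n i)) :
    transposeMul A i j Φ a P = ∑ b, Φ b (mulEntry A ⟨i, a⟩ ⟨j, b⟩ P) := by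
  simp [transposeMul, LinearMap.sum_apply]

/-- The action `(A • Φ)_i = ∑_j ᵗm_{A_ij}(Φ_j)`. -/
instance (hn : StrictAnti n) : MulAction (structGroup n s hn) (DualForms n s) where
  smul A Φ := fun i => ∑ j, transposeMul A.1 i j (Φ j)
  one_smul Φ := by
    funext i a
    ext1 P
    change (∑ j, transposeMul (1 : gradedEnd n s) i j (Φ j)) a P = Φ i a P
    rw [Finset.sum_apply, LinearMap.sum_apply]
    simp only [transposeMul_apply]
    rw [Finset.sum_eq_single i, Finset.sum_eq_single a]
    · congr 1
      ext1
      change (1 : Matrix _ _ (MvPolynomial (Fin 2) ℂ)) _ _ * P.1 = P.1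
      rw [Matrix.one_apply_eq, one_mul]
    · intro b _ hb
      have : mulEntry (1 : gradedEnd n s) ⟨i, a⟩ ⟨i, b⟩ P = 0 := by
        ext1
        change (1 : Matrix _ _ (MvPolynomial (Fin 2) ℂ)) _ _ * P.1 = 0
        rw [Matrix.one_apply_ne (by simpa using hb.symm), zero_mul]
      rw [this, map_zero]
    · simp
    · intro j _ hj
      refine Finset.sum_eq_zero fun b _ => ?_
      have : mulEntry (1 : gradedEnd n s) ⟨i, a⟩ ⟨j, b⟩ P = 0 := by
        ext1
        change (1 : Matrix _ _ (MvPolynomial (Fin 2) ℂ)) _ _ * P.1 = 0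
        rw [Matrix.one_apply_ne (fun h => hj (congrArg Sigma.fst h).symm), zero_mul]
      rw [this, map_zero]
    · simp
  mul_smul A B Φ := by
    funext i a
    ext1 P
    change (∑ j, transposeMul (A.1 * B.1) i j (Φ j)) a P
      = (∑ j, transposeMul A.1 i j (∑ k, transposeMul B.1 j k (Φ k))) a P
    simp only [Finset.sum_apply, LinearMap.sum_apply, transposeMul_apply]
    have h (k : Fin m) (b : Fin (s k)) : mulEntry (A.1 * B.1) ⟨i, a⟩ ⟨k, b⟩ P
        = ∑ x : Σ j, Fin (s j), mulEntry B.1 x ⟨k, b⟩ (mulEntry A.1 ⟨i, a⟩ x P) := by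
      ext1
      rw [AddSubmonoidClass.coe_finsetSum]
      change (A.1.1 * B.1.1) _ _ * P.1 = ∑ x, B.1.1 x _ * (A.1.1 _ x * P.1)
      rw [Matrix.mul_apply, Finset.sum_mul]
      exact Finset.sum_congr rfl fun x _ => by ring
    simp only [h, map_sum, Fintype.sum_sigma]
    rw [Finset.sum_congr rfl fun k _ => Finset.sum_comm, Finset.sum_comm]
    refine Finset.sum_congr rfl fun j _ => ?_
    rw [Finset.sum_congr rfl fun k _ => Finset.sum_comm, Finset.sum_comm]

variable (n s) in
/-- The algebra of polynomial functions on the finite dimensional vector space of block matrices -/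
def polyFunctions : Subalgebra ℂ (gradedEnd n s → ℂ) :=
  Algebra.adjoin ℂ (Set.range fun (φ : Module.Dual ℂ (gradedEnd n s)) A => φ A)

/-- The function `A ↦ ∏ det A_ii`. -/
def diagDet (A : gradedEnd n s) : ℂ := ∏ i, (diagBlock A i).det

variable (n s) in
/-- The group of invertible block matrices is an affine algebraic group: it is the principal Zariski
open subset `∏ det A_ii ≠ 0` of the finite dimensional algebra `gradedEnd n s`, whose product is
bilinear, and the coordinates of `A⁻¹` are regular functions of `A`. -/
structure IsAffineAlgebraicGroup (hn : StrictAnti n) : Prop where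
  diagDet_mem : diagDet ∈ polyFunctions n s
  principal_open : ∀ A : gradedEnd n s, (∃ g : structGroup n s hn, g.1 = A) ↔ diagDet A ≠ 0
  inv_regular : ∀ φ : Module.Dual ℂ (gradedEnd n s), ∃ (k : ℕ) (p : gradedEnd n s → ℂ),
    p ∈ polyFunctions n s ∧ ∀ g : structGroup n s hn, diagDet g.1 ^ k * φ (g⁻¹).1 = p g.1

end Forms

section Comparison

variable {m : ℕ} (n : Fin m → ℤ) (s : Fin m → ℕ)

/-- The value at `X` of the homogeneous function on the line `p` (of degree `n_i` in the
components with index `⟨i, a⟩`) that corresponds to a vector `v` in the fibre at `p` of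
`⊕ O(n_i)^{s_i}`; here `X ≠ 0` is a vector on the line `p`. In the frame over `X_k ≠ 0` the function
`f` has coordinate `f / X_k ^ n_i`. -/
def homogVal {p : P1} (v : SplitBundle n s p) (X : Fin 2 → ℂ) : (Σ i, Fin (s i)) → ℂ :=
  let w : (Σ i, Fin (s i)) → ℂ := v
  fun a => X (chartIndex p) ^ n a.1 * w a

/-- The 1-cochain which is `f` on `U_0 ∩ U_1`, `-f` on `U_1 ∩ U_0` and zero on `U_i ∩ U_i`, for the
standard cover `U_k = {X_k ≠ 0}`; the point `x` is sent to the member `U_{chartIndex x}`. -/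
def standardCocycle (f : ∀ p, SplitBundle n s p) (x y p : P1) : SplitBundle n s p :=
  if chartIndex x = 0 ∧ chartIndex y = 1 then f p
  else if chartIndex x = 1 ∧ chartIndex y = 0 then -f p
  else 0

theorem standardCocycle_mem {f : ∀ p, SplitBundle n s p}
    (hf : IsHolSection ((Σ i, Fin (s i)) → ℂ) f (coordOpen 0 ∩ coordOpen 1)) :
    standardCocycle n s f ∈ cocycles ((Σ i, Fin (s i)) → ℂ) (SplitBundle n s) := by
  refine ⟨fun x => coordOpen (chartIndex x),
    fun x => ⟨isOpen_coordOpen _, mem_coordOpen_chartIndex x⟩, fun x y => ?_,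
    fun x y z p _ => ?_⟩
  · change ContMDiffOn _ _ _ _ (coordOpen (chartIndex x) ∩ coordOpen (chartIndex y))
    by_cases h1 : chartIndex x = 0 ∧ chartIndex y = 1
    · have : standardCocycle n s f x y = f := by funext p; simp [standardCocycle, h1]
      rw [this, h1.1, h1.2]
      exact hf
    · by_cases h2 : chartIndex x = 1 ∧ chartIndex y = 0
      · have : standardCocycle n s f x y = -f := by funext p; simp [standardCocycle, h2]
        rw [this, h2.1, h2.2, Set.inter_comm]
        exact ContMDiffOn.neg_section hf
      · have : standardCocycle n s f x y = 0 := by funext p; simp [standardCocycle, h1, h2]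
        rw [this]
        exact (contMDiff_zeroSection ℂ (SplitBundle n s)).contMDiffOn
  · generalize hx : chartIndex x = i
    generalize hy : chartIndex y = j
    generalize hz : chartIndex z = k
    fin_cases i <;> fin_cases j <;> fin_cases k <;> simp [standardCocycle, hx, hy, hz]

/-- The class in `H¹` that a holomorphic section of `⊕ O(n_i)^{s_i}` over `U_0 ∩ U_1` defines by the
standard cover `{U_0, U_1}`. -/
def standardClass {f : ∀ p, SplitBundle n s p}
    (hf : IsHolSection ((Σ i, Fin (s i)) → ℂ) f (coordOpen 0 ∩ coordOpen 1)) :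
    H1 ((Σ i, Fin (s i)) → ℂ) (SplitBundle n s) :=
  H1.mk _ (standardCocycle n s f) (standardCocycle_mem n s hf)

/-- The Serre duality pairing of the class of `f` with a form `P` in the component `⟨i, a⟩`: the
residue `(2πi)⁻¹ ∮ f_{i,a}(1, z) P(1, z) dz` over the unit circle. Here `f_{i,a} P` is homogeneous of
degree `-2`, so that `f_{i,a} P (X₀ dX₁ - X₁ dX₀)` is a 1-form on `U_0 ∩ U_1`. -/
def serreResidue (f : ∀ p, SplitBundle n s p) (x : Σ i, Fin (s i)) (P : binForm (-2 - n x.1)) : ℂ :=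
  (2 * Real.pi * Complex.I)⁻¹ *
    ∮ z in C(0, 1), homogVal n s (f (Projectivization.mk ℂ (affVec 0 z) (affVec_ne_zero 0 z)))
      (affVec 0 z) x * eval (affVec 0 z) P.1

end Comparison
end AffP1

end

open AffP1

open scoped Manifold ContDiff LinearAlgebra.Projectivization Topology
open Bundle MvPolynomial

/-! Over `X_k ≠ 0` the bundle has a frame in which a section is a tuple of functions of one complex
variable, and the two frames are related by z ↦ 1/z and multiplication of a component of degree n by
z^(-n). Statements 1 and 2 thus become function theory on ℂ.

Automorphisms. In the frame over X₀ ≠ 0 the (a,b) entry of the matrix of an automorphism is entire,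
and the frame at infinity bounds its growth by degree n_a - n_b. By Liouville it is a polynomial
(`exists_eq_sum_pow_of_entire`), so it comes from a form of that degree. As n is strictly
decreasing, elements of G are block triangular with constant diagonal blocks. Their characteristic
polynomial therefore has complex coefficients, polynomial in A, and Cayley–Hamilton
(`aeval_blockCharpoly`) exhibits the inverse as a regular function.

Cohomology. `H1` is a limit over all covers, so cocycles first have to be split on discs: a
partition of unity splits them smoothly, and convolution with the Cauchy kernel corrects the ∂̄
error (`exists_dbar_eq`, `exists_split_of_cocycle`). The splittings over |z| < 2 and |1/z| < 2
differ on the annulus by a holomorphic function. Of its Laurent series, the exponents ≥ 0 are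
absorbed by the first disc and the exponents ≤ n by the second; only the exponents strictly between
n and 0 survive (`exists_laurentSection`). By residues these are dual to the monomials of degree
-2-n, and residues kill coboundaries because a section of O(-2) has no residue at infinity
(`serreResidue_eq_zero`). Hence sending a family of functionals to the Laurent polynomial with these
residues is an isomorphism onto `H1`, and S is its inverse. Moving a matrix from f to P under the
integral transposes the action.

Affine bundles. An isomorphism has a linear part and carries local sections to local sections, hence
the invariant to the invariant. Conversely, if θ carries h_A to h_B, a cochain b bounding the
difference of the cocycles makes the maps a ↦ σ_B + b + θ(a - σ_A) agree on overlaps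
(`affIsomorphic_of_H1map_eq`). Every class occurs, by gluing two trivial bundles with a translation
by f (`gluedBundle`). The identification of the linearisation with the given bundle is only
determined up to automorphisms, whence orbits. Finally S is linear and equivariant, so it is a
homeomorphism on orbit spaces. -/

noncomputable section
namespace AffP1

/-! ### The ∂̄ operator and the Cauchy–Pompeiu formula -/

section DBar
open MeasureTheory Complex

/-- Twice the Wirtinger derivative `∂f/∂z̄`. -/
def dbar (f : ℂ → ℂ) (z : ℂ) : ℂ := fderiv ℝ f z 1 + I * fderiv ℝ f z I

theorem differentiableAt_iff_dbar {f : ℂ → ℂ} {z : ℂ} :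
    DifferentiableAt ℂ f z ↔ DifferentiableAt ℝ f z ∧ dbar f z = 0 := by
  rw [differentiableAt_complex_iff_differentiableAt_real, dbar, smul_eq_mul]
  refine and_congr_right fun _ => ⟨fun h => ?_, fun h => ?_⟩
  · rw [h, ← mul_assoc, I_mul_I]; ring
  · linear_combination (-I) * h + fderiv ℝ f z I * I_mul_I

theorem dbar_add {f g : ℂ → ℂ} {z : ℂ} (hf : DifferentiableAt ℝ f z) (hg : DifferentiableAt ℝ g z) :
    dbar (fun w => f w + g w) z = dbar f z + dbar g z := by
  simp only [dbar, fderiv_fun_add hf hg, add_apply]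
  ring

theorem dbar_sub {f g : ℂ → ℂ} {z : ℂ} (hf : DifferentiableAt ℝ f z) (hg : DifferentiableAt ℝ g z) :
    dbar (fun w => f w - g w) z = dbar f z - dbar g z := by
  simp only [dbar, fderiv_fun_sub hf hg, sub_apply]
  ring

theorem dbar_mul {f g : ℂ → ℂ} {z : ℂ} (hf : DifferentiableAt ℝ f z) (hg : DifferentiableAt ℝ g z) :
    dbar (fun w => f w * g w) z = f z * dbar g z + g z * dbar f z := by
  simp only [dbar, fderiv_fun_mul hf hg, add_apply, smul_apply, smul_eq_mul]
  ring

theorem dbar_congr {f g : ℂ → ℂ} {z : ℂ} (h : f =ᶠ[𝓝 z] g) : dbar f z = dbar g z := by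
  simp only [dbar, h.fderiv_eq]

/-- This is ∂̄ in polar directions: turning the frame `1, I` by the angle t multiplies `dbar` by
e^(-it), by real linearity of the derivative. -/
theorem exp_neg_mul_dbar (h : ℂ → ℂ) (z : ℂ) (t : ℝ) :
    exp (-(t * I)) * dbar h z
      = fderiv ℝ h z (exp (t * I)) + I * fderiv ℝ h z (I * exp (t * I)) := by
  set L := fderiv ℝ h z
  have hL (a b : ℝ) : L (a + b * I) = a * L 1 + b * L I := by
    have : ((a : ℂ) + b * I) = a • (1 : ℂ) + b • I := by simp
    rw [this, map_add, map_smul, map_smul]; simp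
  have e1 : exp (t * I) = (Real.cos t : ℝ) + (Real.sin t : ℝ) * I := by
    rw [exp_mul_I]; simp
  have e2 : I * exp (t * I) = ((-Real.sin t : ℝ) : ℂ) + (Real.cos t : ℝ) * I := by
    rw [e1]; push_cast; linear_combination (Complex.sin t) * I_mul_I
  have e3 : exp (-(t * I)) = (Real.cos t : ℝ) - (Real.sin t : ℝ) * I := by
    rw [← neg_mul, exp_mul_I]; simp; ring
  rw [e2, hL, e1, hL, e3, dbar]
  push_cast
  linear_combination (-(Complex.sin t * L I)) * I_mul_I

/-- Cauchy–Pompeiu at the origin. The area element r dr dt cancels the modulus of `w⁻¹`, and the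
integrand becomes ∂_r h + (i/r) ∂_t h. The first term integrates to -h(0) along every ray, the
second to 0 around every circle. The constant is 2π rather than π because `dbar` is twice the
Wirtinger derivative. -/
theorem integral_inv_mul_dbar {h : ℂ → ℂ} (hh : ContDiff ℝ 1 h) (hc : HasCompactSupport h) :
    ∫ w, w⁻¹ * dbar h w = -(2 * Real.pi) * h 0 := by
  obtain ⟨R, hR0, hR⟩ : ∃ R > 0, ∀ z, R ≤ ‖z‖ → fderiv ℝ h z = 0 ∧ h z = 0 := by
    obtain ⟨R, hR⟩ := hc.isCompact.isBounded.subset_ball 0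
    refine ⟨max R 1, by positivity, fun z hz => ?_⟩
    have hz' : z ∉ tsupport h := fun h' => by
      have := hR h'
      rw [mem_ball_zero_iff] at this
      exact absurd (this.trans_le ((le_max_left _ _).trans hz)) (lt_irrefl _)
    exact ⟨by
      by_contra h0
      exact hz' (support_fderiv_subset ℝ h0), image_eq_zero_of_notMem_tsupport hz'⟩
  let P : ℝ → ℝ → ℂ := fun r t => r * exp (t * I)
  -- `a` is the radial derivative of `h ∘ P`, and `b` is i/r times its angular derivative.
  let a : ℝ × ℝ → ℂ := fun p => fderiv ℝ h (P p.1 p.2) (exp (p.2 * I))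
  let b : ℝ × ℝ → ℂ := fun p => I * fderiv ℝ h (P p.1 p.2) (I * exp (p.2 * I))
  have hfd : Continuous (fderiv ℝ h) := hh.continuous_fderiv one_ne_zero
  have ha : Continuous a := by
    refine (hfd.comp ?_).clm_apply ?_ <;> fun_prop
  have hb : Continuous b := by
    refine continuous_const.mul ((hfd.comp ?_).clm_apply ?_) <;> fun_prop
  have hPn (r t : ℝ) (hr : R ≤ r) : R ≤ ‖P r t‖ := by
    simp only [P, norm_mul, norm_exp_ofReal_mul_I, mul_one, norm_real, Real.norm_eq_abs]
    exact hr.trans (le_abs_self r)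
  have hint (f : ℝ × ℝ → ℂ) (hf : Continuous f) (hf0 : ∀ r t, R ≤ r → f (r, t) = 0) :
      IntegrableOn f (Set.Ioi 0 ×ˢ Set.Ioo (-Real.pi) Real.pi) := by
    have h1 : IntegrableOn f (Set.Icc 0 R ×ˢ Set.Icc (-Real.pi) Real.pi) :=
      hf.continuousOn.integrableOn_compact (isCompact_Icc.prod isCompact_Icc)
    refine h1.of_forall_sdiff_eq_zero (measurableSet_Ioi.prod measurableSet_Ioo) ?_
    rintro ⟨r, t⟩ ⟨⟨h2, h3⟩, h4⟩
    refine hf0 r t (le_of_not_ge fun h5 => h4 ⟨⟨le_of_lt h2, h5⟩, Set.Ioo_subset_Icc_self h3⟩)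
  have hia := hint a ha fun r t hr => by simp [a, (hR _ (hPn r t hr)).1]
  have hib := hint b hb fun r t hr => by simp [b, (hR _ (hPn r t hr)).1]
  have hPr (t r : ℝ) : HasDerivAt (fun r : ℝ => h (P r t)) (a (r, t)) r := by
    have h1 : HasDerivAt (fun r : ℝ => P r t) (exp (t * I)) r := by
      simpa [P] using (ofRealCLM.hasDerivAt (x := r)).mul_const (exp (t * I))
    exact ((hh.differentiable one_ne_zero _).hasFDerivAt).comp_hasDerivAt r h1
  have hPt (r t : ℝ) : HasDerivAt (fun t : ℝ => h (P r t)) (-I * r * b (r, t)) t := by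
    have h1 : HasDerivAt (fun t : ℝ => P r t) (r * (I * exp (t * I))) t := by
      have h2 : HasDerivAt (fun t : ℝ => exp (t * I)) (exp (t * I) * (1 * I)) t :=
        ((ofRealCLM.hasDerivAt (x := t)).mul_const I).cexp
      exact (h2.const_mul (r : ℂ)).congr_deriv (by ring)
    have h3 := ((hh.differentiable one_ne_zero (P r t)).hasFDerivAt).comp_hasDerivAt t h1
    refine h3.congr_deriv ?_
    have h4 : (r : ℂ) * (I * exp (t * I)) = r • (I * exp (t * I)) := by simp
    rw [h4, map_smul]
    simp only [b, real_smul]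
    linear_combination (r * fderiv ℝ h (P r t) (I * exp (t * I))) * I_mul_I
  rw [← Complex.integral_comp_polarCoord_symm]
  change ∫ p in Set.Ioi (0 : ℝ) ×ˢ Set.Ioo (-Real.pi) Real.pi, _ = _
  have hcongr : ∫ p in Set.Ioi (0 : ℝ) ×ˢ Set.Ioo (-Real.pi) Real.pi,
      p.1 • ((Complex.polarCoord.symm p)⁻¹ * dbar h (Complex.polarCoord.symm p))
      = ∫ p in Set.Ioi (0 : ℝ) ×ˢ Set.Ioo (-Real.pi) Real.pi, (a p + b p) := by
    refine setIntegral_congr_fun (measurableSet_Ioi.prod measurableSet_Ioo) ?_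
    rintro ⟨r, t⟩ ⟨hr, -⟩
    have hr' : (r : ℂ) ≠ 0 := ofReal_ne_zero.2 (ne_of_gt hr)
    have hp : Complex.polarCoord.symm (r, t) = P r t := by
      rw [Complex.polarCoord_symm_apply]; simp only [P]; rw [exp_mul_I]
      simp
    simp only [hp, a, b]
    rw [← exp_neg_mul_dbar, exp_neg]
    simp only [P, real_smul]
    field_simp
  rw [hcongr, integral_add hia hib]
  have hA : ∫ p in Set.Ioi (0 : ℝ) ×ˢ Set.Ioo (-Real.pi) Real.pi, a p = -(2 * Real.pi) * h 0 := by
    rw [Measure.volume_eq_prod, ← Measure.prod_restrict] at *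
    rw [integral_prod_symm _ (by simpa only [IntegrableOn, Measure.volume_eq_prod,
      ← Measure.prod_restrict] using hia)]
    have h1 (t : ℝ) : ∫ r in Set.Ioi (0 : ℝ), a (r, t) = 0 - h 0 := by
      have h2 := integral_Ioi_of_hasDerivAt_of_tendsto (a := 0) (f := fun r : ℝ => h (P r t))
        (f' := fun r => a (r, t)) (m := 0) (hPr t 0).continuousAt.continuousWithinAt
        (fun r _ => hPr t r) ?_ ?_
      · simpa [P] using h2
      · have h1 : IntegrableOn (fun r => a (r, t)) (Set.Icc 0 R) :=
          (ha.comp (by fun_prop)).continuousOn.integrableOn_compact isCompact_Icc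
        refine h1.of_forall_sdiff_eq_zero measurableSet_Ioi ?_
        rintro r ⟨h2, h4⟩
        have : R ≤ r := le_of_not_ge fun h5 => h4 ⟨le_of_lt h2, h5⟩
        simp [a, (hR _ (hPn r t this)).1]
      · refine tendsto_const_nhds.congr' ?_
        filter_upwards [Filter.eventually_ge_atTop R] with r hr
        exact (hR _ (hPn r t hr)).2.symm
    simp only [h1]
    simp only [zero_sub, integral_const, MeasurableSet.univ, measureReal_restrict_apply,
      Set.univ_inter, Real.volume_real_Ioo, smul_neg, real_smul]
    rw [max_eq_left (by linarith [Real.pi_pos])]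
    push_cast; ring
  have hB : ∫ p in Set.Ioi (0 : ℝ) ×ˢ Set.Ioo (-Real.pi) Real.pi, b p = 0 := by
    rw [Measure.volume_eq_prod, ← Measure.prod_restrict] at *
    rw [integral_prod _ (by simpa only [IntegrableOn, Measure.volume_eq_prod,
      ← Measure.prod_restrict] using hib)]
    have h1 : ∀ r ∈ Set.Ioi (0 : ℝ), ∫ t in Set.Ioo (-Real.pi) Real.pi, b (r, t) = 0 := by
      intro r hr
      have h2 := intervalIntegral.integral_eq_sub_of_hasDerivAt (a := -Real.pi) (b := Real.pi)
        (f := fun t : ℝ => h (P r t)) (fun t _ => hPt r t)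
        ((continuous_const.mul (hb.comp (by fun_prop))).intervalIntegrable _ _)
      rw [intervalIntegral.integral_const_mul, intervalIntegral.integral_of_le
        (by linarith [Real.pi_pos]), integral_Ioc_eq_integral_Ioo] at h2
      have h3 : P r Real.pi = P r (-Real.pi) := by
        simp only [P, ofReal_neg, neg_mul, exp_neg, exp_pi_mul_I]; norm_num
      rw [h3, sub_self] at h2
      have hr' : (r : ℂ) ≠ 0 := ofReal_ne_zero.2 (ne_of_gt hr)
      exact (mul_eq_zero.1 h2).resolve_left (mul_ne_zero (neg_ne_zero.2 I_ne_zero) hr')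
    rw [setIntegral_congr_fun measurableSet_Ioi h1]
    simp
  rw [hA, hB, add_zero]

end DBar

/-! ### Solving the ∂̄ equation; splitting cocycles, Laurent and Taylor splittings -/

section DBar
open MeasureTheory Complex

/-- The solution is the convolution of φ with the locally integrable kernel 1/(2πw). Derivatives
fall on φ, and `integral_inv_mul_dbar` for w ↦ φ(z - w) returns φ(z). At distance at least 1 from
the support of φ the kernel is bounded; the resulting bound at infinity is what later makes a
singularity removable. -/
theorem exists_dbar_eq {φ : ℂ → ℂ} (hφ : ContDiff ℝ 1 φ) (hc : HasCompactSupport φ) :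
    ∃ u : ℂ → ℂ, Differentiable ℝ u ∧ (∀ z, dbar u z = φ z) ∧
      ∃ C R : ℝ, ∀ z, R ≤ ‖z‖ → ‖u z‖ ≤ C := by
  let k : ℂ → ℂ := fun w => (2 * (Real.pi : ℂ))⁻¹ * w⁻¹
  have hk : LocallyIntegrable k := by
    refine locallyIntegrable_of_norm_le_rpow (C := ‖(2 * Real.pi : ℂ)⁻¹‖) (α := 1) (by simp)
      (by simp)
      (Filter.Eventually.of_forall fun z => ?_) (by fun_prop)
    rw [norm_mul, norm_inv z, Real.rpow_neg_one]
  let u := convolution k φ (ContinuousLinearMap.mul ℝ ℂ) volume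
  have hu (z : ℂ) := hc.hasFDerivAt_convolution_right (ContinuousLinearMap.mul ℝ ℂ) hk hφ z
  refine ⟨u, fun z => (hu z).differentiableAt, fun z => ?_, ?_⟩
  · have hfd : Continuous (fderiv ℝ φ) := hφ.continuous_fderiv one_ne_zero
    have hcv (v : ℂ) : HasCompactSupport fun a => fderiv ℝ φ a v := hc.fderiv_apply (𝕜 := ℝ) v
    have hi (v : ℂ) : Integrable fun t => k t * fderiv ℝ φ (z - t) v :=
      (hcv v).convolutionExists_right (L := ContinuousLinearMap.mul ℝ ℂ) hk
        (hfd.clm_apply continuous_const) z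
    have key := integral_inv_mul_dbar (h := fun w => φ (z - w))
      (hφ.comp (contDiff_const.sub contDiff_id))
      (hc.comp_homeomorph (Homeomorph.subLeft z))
    have hd (w : ℂ) : dbar (fun w => φ (z - w)) w = -dbar φ (z - w) := by
      have h1 : HasFDerivAt (fun w => φ (z - w))
          ((fderiv ℝ φ (z - w)).comp (-ContinuousLinearMap.id ℝ ℂ)) w :=
        (hφ.differentiable one_ne_zero (z - w)).hasFDerivAt.comp w
          ((hasFDerivAt_id w).const_sub z)
      simp only [dbar, h1.fderiv, ContinuousLinearMap.comp_apply, neg_apply,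
        ContinuousLinearMap.id_apply, map_neg]
      ring
    simp only [hd, sub_zero] at key
    rw [dbar, (hu z).fderiv, convolution_precompR_apply _ hk (hc.fderiv (𝕜 := ℝ)) hfd,
      convolution_precompR_apply _ hk (hc.fderiv (𝕜 := ℝ)) hfd]
    simp only [convolution_def, ContinuousLinearMap.mul_apply']
    rw [← integral_const_mul, ← integral_add (hi 1) ((hi I).const_mul I)]
    have h2 : ∀ t, k t * fderiv ℝ φ (z - t) 1 + I * (k t * fderiv ℝ φ (z - t) I)
        = -(2 * (Real.pi : ℂ))⁻¹ * (t⁻¹ * -dbar φ (z - t)) := fun t => by simp only [k, dbar]; ring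
    simp only [h2]
    rw [integral_const_mul, key]
    have : (Real.pi : ℂ) ≠ 0 := ofReal_ne_zero.2 Real.pi_ne_zero
    field_simp
  · obtain ⟨R, hR⟩ := hc.isCompact.isBounded.subset_ball 0
    refine ⟨∫ w, ‖(2 * Real.pi : ℂ)⁻¹‖ * ‖φ w‖, R + 1, fun z hz => ?_⟩
    simp only [u, convolution_eq_swap, ContinuousLinearMap.mul_apply']
    refine norm_integral_le_of_norm_le
      ((hφ.continuous.integrable_of_hasCompactSupport hc).norm.const_mul _)
      (Filter.Eventually.of_forall fun w => ?_)
    by_cases hw : w ∈ tsupport φ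
    · have h1 := hR hw
      rw [mem_ball_zero_iff] at h1
      have h2 : 1 ≤ ‖z - w‖ := by linarith [norm_sub_norm_le z w]
      rw [norm_mul, norm_mul, norm_inv (z - w)]
      gcongr
      exact mul_le_of_le_one_right (norm_nonneg _) (inv_le_one_of_one_le₀ h2)
    · simp [image_eq_zero_of_notMem_tsupport hw]

theorem contDiffAt_dbar {f : ℂ → ℂ} {z : ℂ} (hf : ContDiffAt ℝ ∞ f z) :
    ContDiffAt ℝ ∞ (dbar f) z := by
  have h1 : ContDiffAt ℝ ∞ (fderiv ℝ f) z := hf.fderiv_right (by simp)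
  exact (h1.clm_apply contDiffAt_const).add
    (contDiffAt_const.mul (h1.clm_apply contDiffAt_const))

theorem contDiffAt_real_of_differentiableOn {f : ℂ → ℂ} {U : Set ℂ} (hU : IsOpen U)
    (hf : DifferentiableOn ℂ f U) {z : ℂ} (hz : z ∈ U) : ContDiffAt ℝ ∞ f z :=
  ((hf.analyticAt (hU.mem_nhds hz)).contDiffAt (n := ∞)).restrict_scalars ℝ

/-- Averaging the cocycle with a partition of unity gives a smooth splitting β. Its ∂̄ derivatives
agree on overlaps, and subtracting a common solution u of the ∂̄ equation makes every β i
holomorphic without changing differences. -/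
theorem exists_split_of_cocycle {ι : Type} (W : ι → Set ℂ) (hW : ∀ i, IsOpen (W i))
    (hcov : ∀ z, ∃ i, z ∈ W i) (g : ι → ι → ℂ → ℂ)
    (hg : ∀ i j, DifferentiableOn ℂ (g i j) (W i ∩ W j))
    (hc : ∀ i j k, ∀ z ∈ W i ∩ W j ∩ W k, g i k z = g i j z + g j k z) {R : ℝ} (hR : 0 < R) :
    ∃ b : ι → ℂ → ℂ, (∀ i, DifferentiableOn ℂ (b i) (W i ∩ Metric.ball 0 R)) ∧
      ∀ i j, ∀ z ∈ W i ∩ W j, g i j z = b j z - b i z := by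
  obtain ⟨χ, hχ⟩ := SmoothPartitionOfUnity.exists_isSubordinate 𝓘(ℝ, ℂ)
    (isClosed_univ (X := ℂ)) W hW
    fun z _ => Set.mem_iUnion.2 (hcov z)
  let β : ι → ℂ → ℂ := fun j z => ∑ᶠ i, χ i z • g i j z
  have hβ (j : ι) (z : ℂ) (hz : z ∈ W j) : ContDiffAt ℝ ∞ (β j) z := by
    refine contMDiffAt_iff_contDiffAt.1 (χ.contMDiffAt_finsum fun i hi => ?_)
    exact (contDiffAt_real_of_differentiableOn ((hW i).inter (hW j)) (hg i j)
      ⟨hχ i hi, hz⟩).contMDiffAt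
  have hβg (i j : ι) (z : ℂ) (hz : z ∈ W i ∩ W j) : g i j z = β j z - β i z := by
    have hfin (j : ι) : (Function.support fun i => χ i z • g i j z).Finite :=
      (χ.locallyFinite.point_finite z).subset fun i hi h0 => hi (by
        simp only [show χ i z = 0 from h0, zero_smul])
    simp only [β]
    rw [← finsum_sub_distrib (hfin j) (hfin i)]
    have h1 (l : ι) : χ l z • g l j z - χ l z • g l i z = χ l z • g i j z := by
      by_cases hl : χ l z = 0
      · simp [hl]
      · have hzl : z ∈ W l := hχ l (subset_tsupport _ hl)
        rw [hc l i j z ⟨⟨hzl, hz.1⟩, hz.2⟩, smul_add, add_sub_cancel_left]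
    simp only [h1]
    rw [← finsum_smul, χ.sum_eq_one (Set.mem_univ z), one_smul]
  choose ix hix using hcov
  -- Since β i and β j differ by a holomorphic function, this does not depend on the choice of index
  -- and is smooth.
  let η : ℂ → ℂ := fun z => dbar (β (ix z)) z
  have hη (i : ι) (z : ℂ) (hz : z ∈ W i) : η z = dbar (β i) z := by
    have h1 : β (ix z) =ᶠ[𝓝 z] fun w => β i w + g i (ix z) w := by
      filter_upwards [((hW i).inter (hW (ix z))).mem_nhds ⟨hz, hix z⟩] with w hw
      rw [hβg i (ix z) w hw]; ring
    have h2 := differentiableAt_iff_dbar.1 ((hg i (ix z)).differentiableAt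
      (((hW i).inter (hW (ix z))).mem_nhds ⟨hz, hix z⟩))
    simp only [η]
    rw [dbar_congr h1, dbar_add ((hβ i z hz).differentiableAt (by simp)) h2.1, h2.2, add_zero]
  have hηs : ContDiff ℝ ∞ η := contDiff_iff_contDiffAt.2 fun z => by
    refine (contDiffAt_dbar (hβ (ix z) z (hix z))).congr_of_eventuallyEq ?_
    filter_upwards [(hW (ix z)).mem_nhds (hix z)] with w hw using hη _ _ hw
  -- η need not have compact support. After the cutoff the equation `dbar u = η` is guaranteed only
  -- on the ball of radius R, which is why holomorphy is claimed only there.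
  let ψ : ContDiffBump (0 : ℂ) := ⟨R, R + 1, hR, by linarith⟩
  obtain ⟨u, hu, hud, -⟩ := exists_dbar_eq (φ := fun z => (ψ z : ℂ) * η z)
    (((ofRealCLM.contDiff.comp ψ.contDiff).mul hηs).of_le (by simp))
    ((ψ.hasCompactSupport.comp_left (g := ofReal) ofReal_zero).mul_right)
  refine ⟨fun i z => β i z - u z, fun i z hz => ?_, fun i j z hz => by rw [hβg i j z hz]; ring⟩
  have h1 := (hβ i z hz.1).differentiableAt (by simp)
  refine (differentiableAt_iff_dbar.2 ⟨h1.sub (hu z), ?_⟩).differentiableWithinAt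
  change dbar (fun w => β i w - u w) z = 0
  rw [dbar_sub h1 (hu z), hud, ← hη i z hz.1,
    ψ.one_of_mem_closedBall (Metric.ball_subset_closedBall hz.2)]
  simp

/-- Laurent decomposition on an annulus. -/
theorem exists_laurent_split {F : ℂ → ℂ} (hF : DifferentiableOn ℂ F {z | 1 / 2 < ‖z‖ ∧ ‖z‖ < 2}) :
    ∃ F₀ F₁ : ℂ → ℂ, DifferentiableOn ℂ F₀ (Metric.ball 0 2) ∧
      DifferentiableOn ℂ F₁ (Metric.ball 0 2) ∧
      ∀ z, 1 / 2 < ‖z‖ → ‖z‖ < 2 → F z = F₀ z + F₁ z⁻¹ := by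
  set D : Set ℂ := {z | 1 / 2 < ‖z‖ ∧ ‖z‖ < 2}
  have hD : IsOpen D := (isOpen_lt continuous_const continuous_norm).inter
    (isOpen_lt continuous_norm continuous_const)
  let ψ : ContDiffBump (0 : ℂ) := ⟨3 / 4, 3 / 2, by norm_num, by norm_num⟩
  let χ : ℂ → ℂ := fun z => (ψ z : ℂ)
  have hχ : ContDiff ℝ ∞ χ := ofRealCLM.contDiff.comp ψ.contDiff
  have hχd (z) : DifferentiableAt ℝ χ z := hχ.contDiffAt.differentiableAt (by simp)
  have hχ1 (z : ℂ) (hz : ‖z‖ < 3 / 4) : χ =ᶠ[𝓝 z] fun _ => 1 := by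
    filter_upwards [Metric.isOpen_ball.mem_nhds (mem_ball_zero_iff.2 hz)] with w hw
    have := ψ.one_of_mem_closedBall (Metric.ball_subset_closedBall hw)
    simp [χ, this]
  have hχ0 (z : ℂ) (hz : 3 / 2 < ‖z‖) : χ =ᶠ[𝓝 z] fun _ => 0 := by
    filter_upwards [(isOpen_lt continuous_const continuous_norm).mem_nhds hz] with w hw
    have : ψ w = 0 := ψ.zero_of_le_dist (by simpa using le_of_lt hw)
    simp [χ, this]
  have hdc (c z : ℂ) : dbar (fun _ => c) z = 0 := by simp [dbar]
  have hFd (z) (hz : z ∈ D) := differentiableAt_iff_dbar.1 (hF.differentiableAt (hD.mem_nhds hz))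
  -- This is `dbar (χ F)` on the annulus, extended by zero: `dbar χ` vanishes off the ring 3/4 ≤ |z|
  -- ≤ 3/2, which lies inside the annulus.
  let φ : ℂ → ℂ := fun z => F z * dbar χ z
  have hφ0 (z : ℂ) (hz : ‖z‖ < 3 / 4 ∨ 3 / 2 < ‖z‖) : φ z = 0 := by
    rcases hz with hz | hz
    · simp only [φ]; rw [dbar_congr (hχ1 z hz), hdc, mul_zero]
    · simp only [φ]; rw [dbar_congr (hχ0 z hz), hdc, mul_zero]
  have hφs : ContDiff ℝ ∞ φ := contDiff_iff_contDiffAt.2 fun z => by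
    by_cases hz : z ∈ D
    · exact (contDiffAt_real_of_differentiableOn hD hF hz).mul (contDiffAt_dbar hχ.contDiffAt)
    · refine (contDiffAt_const (c := (0 : ℂ))).congr_of_eventuallyEq ?_
      have h1 : z ∈ {z : ℂ | ‖z‖ < 3 / 4} ∪ {z | 3 / 2 < ‖z‖} := by
        by_contra h
        simp only [Set.mem_union, Set.mem_ofPred_eq, not_or, not_lt] at h
        exact hz ⟨by linarith [h.1], by linarith [h.2]⟩
      filter_upwards [((isOpen_lt continuous_norm continuous_const).union
        (isOpen_lt continuous_const continuous_norm)).mem_nhds h1] with w hw using hφ0 w hw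
  have hφc : HasCompactSupport φ := by
    refine HasCompactSupport.intro (isCompact_closedBall (0 : ℂ) (3 / 2)) fun z hz => hφ0 z ?_
    right; simpa using hz
  obtain ⟨u, hu, hud, C, R, hCR⟩ := exists_dbar_eq (hφs.of_le (by simp)) hφc
  -- F is the sum of χF - u and (1 - χ)F + u. The first is holomorphic for |z| > 1/2 and bounded at
  -- infinity, where it equals -u, so its composite H with inversion extends over 0. The second is
  -- holomorphic for |z| < 2, being equal to u near the inner hole.
  let G : ℂ → ℂ := fun z => χ z * F z - u z
  have hG (z : ℂ) (hz : 1 / 2 < ‖z‖) : DifferentiableAt ℂ G z := by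
    by_cases hz2 : ‖z‖ < 2
    · have h1 := hFd z ⟨hz, hz2⟩
      have h3 : DifferentiableAt ℝ (fun w => χ w * F w) z := (hχd z).mul h1.1
      refine differentiableAt_iff_dbar.2 ⟨h3.sub (hu z), ?_⟩
      simp only [G]
      rw [dbar_sub h3 (hu z), dbar_mul (hχd z) h1.1, h1.2, hud]
      simp [φ]
    · have hz3 : 3 / 2 < ‖z‖ := by linarith
      have h1 : G =ᶠ[𝓝 z] fun w => 0 - u w := by
        filter_upwards [hχ0 z hz3] with w hw
        simp [G, hw]
      refine DifferentiableAt.congr_of_eventuallyEq ?_ h1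
      refine differentiableAt_iff_dbar.2 ⟨(differentiableAt_const _).sub (hu z), ?_⟩
      rw [dbar_sub (differentiableAt_const _) (hu z), hud, hdc, hφ0 z (Or.inr hz3), sub_zero]
  let H : ℂ → ℂ := fun ζ => G ζ⁻¹
  have hH : DifferentiableOn ℂ H (Metric.ball 0 2 \ {0}) := fun ζ hζ => by
    have h0 : ζ ≠ 0 := hζ.2
    refine DifferentiableAt.differentiableWithinAt ?_
    refine DifferentiableAt.comp ζ (hG _ ?_) (differentiableAt_inv h0)
    rw [norm_inv, one_div]
    exact inv_strictAnti₀ (norm_pos_iff.2 h0) (mem_ball_zero_iff.1 hζ.1)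
  set R' := max R 2
  have hR' : 0 < R' := lt_of_lt_of_le two_pos (le_max_right _ _)
  have hH0 : DifferentiableOn ℂ H (Metric.ball 0 R'⁻¹ \ {0}) :=
    hH.mono fun ζ hζ => ⟨Metric.ball_subset_ball (by
      refine (inv_anti₀ two_pos (le_max_right R 2)).trans (by norm_num)) hζ.1, hζ.2⟩
  have hbd : BddAbove (norm ∘ H '' (Metric.ball 0 R'⁻¹ \ {0})) := by
    refine ⟨C, ?_⟩
    rintro _ ⟨ζ, ⟨hζ, hζ0⟩, rfl⟩
    have hζ0 : ζ ≠ 0 := hζ0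
    have h2 : R' < ‖ζ⁻¹‖ := by
      rw [norm_inv]
      exact (lt_inv_comm₀ hR' (norm_pos_iff.2 hζ0)).2 (mem_ball_zero_iff.1 hζ)
    have h3 : χ ζ⁻¹ = 0 :=
      (hχ0 ζ⁻¹ (by linarith [le_max_right R 2])).self_of_nhds
    have h4 := hCR ζ⁻¹ ((le_max_left R 2).trans h2.le)
    simpa [H, G, h3] using h4
  have hrem := differentiableOn_update_limUnder_of_bddAbove
    (Metric.ball_mem_nhds 0 (inv_pos.2 hR')) hH0 hbd
  refine ⟨fun z => (1 - χ z) * F z + u z, Function.update H 0 ((𝓝[≠] (0 : ℂ)).limUnder H),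
    ?_, ?_, ?_⟩
  · intro z hz
    have hz2 := mem_ball_zero_iff.1 hz
    refine DifferentiableAt.differentiableWithinAt ?_
    by_cases hz1 : 1 / 2 < ‖z‖
    · have h1 := hFd z ⟨hz1, hz2⟩
      have h2 : DifferentiableAt ℝ (fun w => 1 - χ w) z := (differentiableAt_const _).sub (hχd z)
      have h3 : DifferentiableAt ℝ (fun w => (1 - χ w) * F w) z := h2.mul h1.1
      refine differentiableAt_iff_dbar.2 ⟨h3.add (hu z), ?_⟩
      rw [dbar_add h3 (hu z), dbar_mul h2 h1.1, h1.2, hud,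
        dbar_sub (differentiableAt_const _) (hχd z), hdc]
      simp [φ]
    · have hz3 : ‖z‖ < 3 / 4 := by linarith
      refine DifferentiableAt.congr_of_eventuallyEq (f := u) ?_ ?_
      · exact differentiableAt_iff_dbar.2 ⟨hu z, by rw [hud, hφ0 z (Or.inl hz3)]⟩
      · filter_upwards [hχ1 z hz3] with w hw
        simp [hw]
  · intro ζ hζ
    by_cases h0 : ζ = 0
    · subst h0
      exact (hrem.differentiableAt (Metric.ball_mem_nhds 0 (inv_pos.2 hR'))).differentiableWithinAt
    · refine DifferentiableAt.differentiableWithinAt ?_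
      refine ((hH.differentiableAt ((Metric.isOpen_ball.sdiff isClosed_singleton).mem_nhds
        ⟨hζ, h0⟩)).congr_of_eventuallyEq ?_)
      filter_upwards [isOpen_ne.mem_nhds h0] with w hw
      rw [Function.update_of_ne hw]
  · intro z hz1 hz2
    have h0 : z⁻¹ ≠ 0 := inv_ne_zero (norm_pos_iff.1 (by linarith))
    rw [Function.update_of_ne h0]
    simp only [H, G, inv_inv]
    ring

/-- Each `dslope` at 0 peels off one Taylor coefficient and leaves a remainder holomorphic on all of
U. -/
theorem exists_taylor_split {H : ℂ → ℂ} {U : Set ℂ} (hU : U ∈ 𝓝 (0 : ℂ)) (K : ℕ)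
    (hH : DifferentiableOn ℂ H U) :
    ∃ (h : ℕ → ℂ) (G : ℂ → ℂ), DifferentiableOn ℂ G U ∧
      ∀ z, H z = ∑ k ∈ Finset.range K, h k * z ^ k + z ^ K * G z := by
  induction K with
  | zero => exact ⟨0, H, hH, fun z => by simp⟩
  | succ K ih =>
    obtain ⟨h, G, hG, hGz⟩ := ih
    refine ⟨Function.update h K (G 0), dslope G 0, (Complex.differentiableOn_dslope hU).2 hG,
      fun z => ?_⟩
    rw [Finset.sum_range_succ, Function.update_self, hGz z]
    have h1 : ∑ k ∈ Finset.range K, Function.update h K (G 0) k * z ^ k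
        = ∑ k ∈ Finset.range K, h k * z ^ k := Finset.sum_congr rfl fun k hk => by
      rw [Function.update_of_ne (Finset.mem_range.1 hk).ne]
    have h2 := sub_smul_dslope G 0 z
    rw [sub_zero, smul_eq_mul] at h2
    rw [h1]
    linear_combination (-z ^ K) * h2

/-- The relation with M₁ bounds the growth of M₀ by degree d, so the Taylor remainder G tends to 0
at infinity and vanishes by Liouville. For d < 0 the sum is empty and M₀ is zero. -/
theorem exists_eq_sum_pow_of_entire {M₀ M₁ : ℂ → ℂ} (h₀ : Differentiable ℂ M₀)
    (h₁ : Differentiable ℂ M₁) (d : ℤ) (h : ∀ z ≠ 0, M₁ z⁻¹ = z ^ (-d) * M₀ z) :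
    ∃ c : ℕ → ℂ, ∀ z, M₀ z = ∑ k ∈ Finset.range (d + 1).toNat, c k * z ^ k := by
  set K := (d + 1).toNat
  obtain ⟨c, G, hG, hGz⟩ := exists_taylor_split (U := Set.univ) Filter.univ_mem K
    h₀.differentiableOn
  rw [differentiableOn_univ] at hG
  -- e is 1 for d ≥ 0 and -d for d < 0. Its positivity gives Q(0) = 0, that is, the decay of G(z) =
  -- Q(1/z) at infinity.
  obtain ⟨e, he, he0⟩ : ∃ e : ℕ, (e : ℤ) = K - d ∧ e ≠ 0 := ⟨(K - d).toNat, by omega, by omega⟩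
  let Q : ℂ → ℂ := fun ζ => ζ ^ e * M₁ ζ - ∑ k ∈ Finset.range K, c k * ζ ^ (K - k)
  have hQ0 : Q 0 = 0 := by
    simp only [Q, zero_pow he0, zero_mul, zero_sub, neg_eq_zero]
    refine Finset.sum_eq_zero fun k hk => ?_
    rw [zero_pow (Nat.sub_ne_zero_of_lt (Finset.mem_range.1 hk)), mul_zero]
  have hQc : Continuous Q := by
    have := h₁.continuous
    fun_prop
  have hGQ (z : ℂ) (hz : z ≠ 0) : G z = Q z⁻¹ := by
    have hK : z ^ K ≠ 0 := pow_ne_zero _ hz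
    have h1 : z⁻¹ ^ e * M₁ z⁻¹ = (z ^ K)⁻¹ * M₀ z := by
      rw [h z hz, ← mul_assoc, ← zpow_natCast z⁻¹, he, inv_zpow', ← zpow_add₀ hz,
        ← zpow_natCast z K, ← zpow_neg]
      congr 2; ring
    have h2 : ∑ k ∈ Finset.range K, c k * z⁻¹ ^ (K - k)
        = (z ^ K)⁻¹ * ∑ k ∈ Finset.range K, c k * z ^ k := by
      rw [Finset.mul_sum]
      refine Finset.sum_congr rfl fun k hk => ?_
      rw [inv_pow, pow_sub₀ z hz (Finset.mem_range.1 hk).le]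
      field_simp
    simp only [Q]
    rw [h1, h2, hGz z]
    field_simp
    ring
  have hlim : Filter.Tendsto G (Filter.cocompact ℂ) (𝓝 0) := by
    rw [← Metric.cobounded_eq_cocompact]
    have h1 : Filter.Tendsto (fun z : ℂ => Q z⁻¹) (Bornology.cobounded ℂ) (𝓝 0) := by
      rw [← hQ0]
      exact (hQc.tendsto 0).comp Filter.tendsto_inv₀_cobounded
    refine h1.congr' ?_
    filter_upwards [Bornology.eventually_ne_cobounded (0 : ℂ)] with z hz using (hGQ z hz).symm
  refine ⟨c, fun z => ?_⟩
  rw [hGz z, hG.apply_eq_of_tendsto_cocompact z hlim, mul_zero, add_zero]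

end DBar

/-! ### The two standard frames and holomorphic sections in coordinates -/

section Frames
variable {m : ℕ} {n : Fin m → ℤ} {s : Fin m → ℕ}

/-- The point with affine coordinate `z` in the chart `X_k ≠ 0`. -/
def pt (k : Fin 2) (z : ℂ) : P1 := Projectivization.mk ℂ (affVec k z) (affVec_ne_zero k z)

theorem pt_mem (k : Fin 2) (z : ℂ) : pt k z ∈ coordOpen k := by
  rw [pt, mk_mem_coordOpen, affVec_same]; exact one_ne_zero

theorem affChart_pt (k : Fin 2) (z : ℂ) : affChart k (pt k z) = z :=
  (affChart k).right_inv (Set.mem_univ z)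

theorem pt_affChart {k : Fin 2} {p : P1} (hp : p ∈ coordOpen k) : pt k (affChart k p) = p :=
  (affChart k).left_inv hp

theorem affChart_mem_maximalAtlas (k : Fin 2) :
    affChart k ∈ IsManifold.maximalAtlas 𝓘(ℂ) ω P1 :=
  IsManifold.subset_maximalAtlas (Set.mem_range_self k)

theorem contMDiff_pt (k : Fin 2) : ContMDiff 𝓘(ℂ) 𝓘(ℂ) ω (pt k) :=
  contMDiffOn_univ.1 (contMDiffOn_symm_of_mem_maximalAtlas (affChart_mem_maximalAtlas k))

theorem contMDiffOn_affChart (k : Fin 2) : ContMDiffOn 𝓘(ℂ) 𝓘(ℂ) ω (affChart k) (coordOpen k) :=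
  contMDiffOn_of_mem_maximalAtlas (affChart_mem_maximalAtlas k)

theorem continuous_pt (k : Fin 2) : Continuous (pt k) := (contMDiff_pt k).continuous

theorem ratio_pt (i j k : Fin 2) (z : ℂ) : ratio i j (pt k z) = affVec k z i / affVec k z j :=
  ratio_mk _ _ _ _

theorem affVec_zero_zero (z : ℂ) : affVec 0 z 0 = 1 := affVec_same 0 z
theorem affVec_zero_one (z : ℂ) : affVec 0 z 1 = z := affVec_other 0 z
theorem affVec_one_one (z : ℂ) : affVec 1 z 1 = 1 := affVec_same 1 z
theorem affVec_one_zero (z : ℂ) : affVec 1 z 0 = z := affVec_other 1 z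

theorem pt_inv {z : ℂ} (hz : z ≠ 0) : pt 1 z⁻¹ = pt 0 z := by
  rw [pt, pt, Projectivization.mk_eq_mk_iff']
  refine ⟨z⁻¹, ?_⟩
  ext j
  fin_cases j
  · simp [affVec_zero_zero, affVec_one_zero]
  · simp [affVec_zero_one, affVec_one_one, hz]

theorem pt_mem_other {k : Fin 2} {z : ℂ} : pt k z ∈ coordOpen (1 - k) ↔ z ≠ 0 := by
  rw [pt, mk_mem_coordOpen, affVec_other]

theorem pt_zero_mem_one {z : ℂ} : pt 0 z ∈ coordOpen 1 ↔ z ≠ 0 := pt_mem_other (k := 0)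
theorem pt_one_mem_zero {z : ℂ} : pt 1 z ∈ coordOpen 0 ↔ z ≠ 0 := pt_mem_other (k := 1)

theorem chartIndex_eq_zero {p : P1} : chartIndex p = 0 ↔ p ∈ coordOpen 0 := by
  unfold chartIndex
  split_ifs with h <;> simp [h]

theorem chartIndex_eq_one {p : P1} : chartIndex p = 1 ↔ p ∉ coordOpen 0 := by
  unfold chartIndex
  split_ifs with h <;> simp [h]

theorem mem_coordOpen_one_of_notMem {p : P1} (hp : p ∉ coordOpen 0) : p ∈ coordOpen 1 := by
  have := mem_coordOpen_chartIndex p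
  rwa [chartIndex_eq_one.2 hp] at this

theorem eq_pt_one_zero {p : P1} (hp : p ∉ coordOpen 0) : p = pt 1 0 := by
  have h1 := pt_affChart (mem_coordOpen_one_of_notMem hp)
  by_contra h
  rw [← h1] at hp h
  refine hp (pt_one_mem_zero.2 fun h0 => h (by rw [h0]))

/-- The coordinates of a vector of `⊕ O(n_i)^{s_i}` in the frame over `X_k ≠ 0`. -/
def frameCoord (k : Fin 2) (p : P1) : SplitBundle n s p →ₗ[ℂ] ((Σ i, Fin (s i)) → ℂ) :=
  (diagCLM fun a : Σ i, Fin (s i) => ratio (chartIndex p) k p ^ n a.1).toLinearMap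

/-- The vector of `⊕ O(n_i)^{s_i}` with given coordinates in the frame over `X_k ≠ 0`. -/
def frameVec (k : Fin 2) (p : P1) : ((Σ i, Fin (s i)) → ℂ) →ₗ[ℂ] SplitBundle n s p :=
  (diagCLM fun a : Σ i, Fin (s i) => ratio k (chartIndex p) p ^ n a.1).toLinearMap

theorem frameCoord_apply (k : Fin 2) (p : P1) (v : SplitBundle n s p) (a : Σ i, Fin (s i)) :
    frameCoord k p v a = ratio (chartIndex p) k p ^ n a.1 * (show (Σ i, Fin (s i)) → ℂ from v) a :=
  rfl

theorem frameVec_apply (k : Fin 2) (p : P1) (w : (Σ i, Fin (s i)) → ℂ) (a : Σ i, Fin (s i)) :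
    (show (Σ i, Fin (s i)) → ℂ from (frameVec k p w : SplitBundle n s p)) a
      = ratio k (chartIndex p) p ^ n a.1 * w a :=
  rfl

theorem ratio_mul_ratio_self {i j : Fin 2} {p : P1} (hi : p ∈ coordOpen i) (hj : p ∈ coordOpen j) :
    ratio i j p * ratio j i p = 1 := by
  rw [ratio_mul_ratio _ _ _ _ hj]; exact div_self hi

theorem frameCoord_frameVec {k : Fin 2} {p : P1} (hp : p ∈ coordOpen k)
    (w : (Σ i, Fin (s i)) → ℂ) : frameCoord k p (frameVec k p w : SplitBundle n s p) = w := by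
  ext a
  rw [frameCoord_apply, frameVec_apply, ← mul_assoc, ← mul_zpow,
    ratio_mul_ratio_self (mem_coordOpen_chartIndex p) hp, one_zpow, one_mul]

theorem frameVec_frameCoord {k : Fin 2} {p : P1} (hp : p ∈ coordOpen k) (v : SplitBundle n s p) :
    frameVec k p (frameCoord k p v) = v := by
  funext a
  change (show (Σ i, Fin (s i)) → ℂ from
    (frameVec k p (frameCoord k p v) : SplitBundle n s p)) a = _
  rw [frameVec_apply, frameCoord_apply, ← mul_assoc, ← mul_zpow,
    ratio_mul_ratio_self hp (mem_coordOpen_chartIndex p), one_zpow, one_mul]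

theorem frameCoord_injective {k : Fin 2} {p : P1} (hp : p ∈ coordOpen k) {v w : SplitBundle n s p}
    (h : frameCoord k p v = frameCoord k p w) : v = w := by
  rw [← frameVec_frameCoord hp v, h, frameVec_frameCoord hp]

theorem frameCoord_change {k l : Fin 2} {p : P1} (hk : p ∈ coordOpen k) (v : SplitBundle n s p)
    (a : Σ i, Fin (s i)) : frameCoord l p v a = ratio k l p ^ n a.1 * frameCoord k p v a := by
  rw [frameCoord_apply, frameCoord_apply, ← mul_assoc, ← mul_zpow, mul_comm (ratio k l p),
    ratio_mul_ratio _ _ _ _ hk]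

/-- The change of frames at `z` and `z⁻¹`. -/
theorem frameCoord_one_inv (f : ∀ p, SplitBundle n s p) {z : ℂ} (hz : z ≠ 0)
    (a : Σ i, Fin (s i)) :
    frameCoord 1 (pt 1 z⁻¹) (f (pt 1 z⁻¹)) a
      = z ^ (-n a.1) * frameCoord 0 (pt 0 z) (f (pt 0 z)) a := by
  rw [pt_inv hz, frameCoord_change (pt_mem 0 z), ratio_pt, affVec_zero_zero, affVec_zero_one,
    one_div, inv_zpow']

theorem homogVal_mk (X : Fin 2 → ℂ) (hX : X ≠ 0) (k : Fin 2) (hk : X k ≠ 0)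
    (v : SplitBundle n s (Projectivization.mk ℂ X hX)) (a : Σ i, Fin (s i)) :
    homogVal n s v X a = X k ^ n a.1 * frameCoord k _ v a := by
  rw [frameCoord_apply, ratio_mk, ← mul_assoc, ← mul_zpow, mul_div_cancel₀ _ hk]
  rfl

theorem homogVal_pt (z : ℂ) (v : SplitBundle n s (pt 0 z)) (a : Σ i, Fin (s i)) :
    homogVal n s v (affVec 0 z) a = frameCoord 0 _ v a := by
  have := homogVal_mk (affVec 0 z) (affVec_ne_zero 0 z) 0 (by rw [affVec_same]; exact one_ne_zero)
    v a
  rwa [affVec_same, one_zpow, one_mul] at this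

instance (k : Fin 2) : MemTrivializationAtlas ((splitCore n s).localTriv k) := ⟨⟨k, rfl⟩⟩

theorem contMDiffOn_iff_comp_pt {E : Type*} [NormedAddCommGroup E] [NormedSpace ℂ E] {g : P1 → E}
    {U : Set P1} {k : Fin 2} (hk : U ⊆ coordOpen k) :
    ContMDiffOn 𝓘(ℂ) 𝓘(ℂ, E) ω g U ↔ ContDiffOn ℂ ω (fun z => g (pt k z)) (pt k ⁻¹' U) := by
  rw [← contMDiffOn_iff_contDiffOn]
  refine ⟨fun h => h.comp (contMDiff_pt k).contMDiffOn fun z hz => hz, fun h => ?_⟩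
  refine (h.comp ((contMDiffOn_affChart k).mono hk) fun p hp => ?_).congr fun p hp => ?_
  · rw [Set.mem_preimage, Set.mem_preimage, pt_affChart (hk hp)]; exact hp
  · simp only [Function.comp, pt_affChart (hk hp)]

/-- On an open subset of ℂ complex differentiability already implies analyticity. -/
theorem contDiffOn_omega_pi_iff {ι : Type*} [Fintype ι] {U : Set ℂ} (hU : IsOpen U)
    {g : ℂ → ι → ℂ} : ContDiffOn ℂ ω g U ↔ ∀ a, DifferentiableOn ℂ (fun z => g z a) U := by
  rw [← differentiableOn_pi]
  exact ⟨fun h => h.differentiableOn (by simp),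
    fun h => (h.analyticOnNhd hU).contDiffOn hU.uniqueDiffOn⟩

/-- The passage from holomorphic sections to function theory in one variable: a single frame
suffices, although the fibres are modelled on the frame `chartIndex p`, which jumps with p. -/
theorem isHolSection_iff {U : Set P1} (hU : IsOpen U) {k : Fin 2} (hk : U ⊆ coordOpen k)
    {f : ∀ p, SplitBundle n s p} :
    IsHolSection ((Σ i, Fin (s i)) → ℂ) f U ↔
      ∀ a, DifferentiableOn ℂ (fun z => frameCoord k (pt k z) (f (pt k z)) a) (pt k ⁻¹' U) := by
  rw [← contDiffOn_omega_pi_iff (hU.preimage (continuous_pt k)),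
    ← contMDiffOn_iff_comp_pt (g := fun p => frameCoord k p (f p)) hk]
  exact ((splitCore n s).localTriv k).contMDiffOn_section_iff hU hk

end Frames

/-! ### The affine algebraic group of block matrices -/

section AlgebraicGroup
variable {m : ℕ} {n : Fin m → ℤ} {s : Fin m → ℕ}

theorem linear_mem_polyFunctions (φ : Module.Dual ℂ (gradedEnd n s)) :
    (fun A => φ A) ∈ polyFunctions n s :=
  Algebra.subset_adjoin ⟨φ, rfl⟩

/-- The entries of the diagonal blocks as polynomial functions. -/
def genericBlock (n : Fin m → ℤ) (s : Fin m → ℕ) (i : Fin m) :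
    Matrix (Fin (s i)) (Fin (s i)) (polyFunctions n s) := fun a b =>
  ⟨fun A => diagBlock A i a b, linear_mem_polyFunctions
    { toFun := fun A => diagBlock A i a b
      map_add' := fun A B => by simp [diagBlock]
      map_smul' := fun c A => by simp [diagBlock] }⟩

/-- Evaluation of polynomial functions. -/
def evalPoly (A : gradedEnd n s) : polyFunctions n s →+* ℂ :=
  (Pi.evalRingHom (fun _ => ℂ) A).comp (polyFunctions n s).val.toRingHom

theorem genericBlock_map (A : gradedEnd n s) (i : Fin m) :
    (genericBlock n s i).map (evalPoly A) = diagBlock A i := rfl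

theorem prod_det_genericBlock :
    ((∏ i, (genericBlock n s i).det : polyFunctions n s) : gradedEnd n s → ℂ) = diagDet := by
  funext A
  change evalPoly A _ = _
  rw [map_prod]
  exact Finset.prod_congr rfl fun i _ => RingHom.map_det _ _

/-- Expanding one factor of the power in a basis leaves linear functionals of a lower power, namely
φ composed with left multiplication by basis vectors; hence the induction over all φ at once. -/
theorem pow_mem_polyFunctions (k : ℕ) (φ : Module.Dual ℂ (gradedEnd n s)) :
    (fun A => φ (A ^ k)) ∈ polyFunctions n s := by
  induction k generalizing φ with
  | zero => 
    simp only [pow_zero]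
    exact (polyFunctions n s).algebraMap_mem (φ 1)
  | succ k ih =>
    let b := Module.finBasis ℂ (gradedEnd n s)
    have h : (fun A : gradedEnd n s => φ (A ^ (k + 1)))
        = ∑ j, (fun A => b.coord j A) * fun A => (φ ∘ₗ LinearMap.mulLeft ℂ (b j)) (A ^ k) := by
      funext A
      rw [Finset.sum_apply, pow_succ']
      conv_lhs => rw [← b.sum_repr A, Finset.sum_mul, map_sum]
      refine Finset.sum_congr rfl fun j _ => ?_
      rw [smul_mul_assoc, map_smul, b.sum_repr]
      rfl
    rw [h]
    exact sum_mem fun j _ => mul_mem (linear_mem_polyFunctions _) (ih _)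

/-- The product of the characteristic polynomials of the diagonal blocks. -/
def blockCharpoly (n : Fin m → ℤ) (s : Fin m → ℕ) : Polynomial (polyFunctions n s) :=
  ∏ i, (genericBlock n s i).charpoly

/-- Since A is block triangular with constant diagonal blocks, its characteristic polynomial over
ℂ[X₀,X₁] is the product of those of the blocks and has complex coefficients. Cayley–Hamilton is then
an identity inside the algebra `gradedEnd n s`. -/
theorem aeval_blockCharpoly (hn : StrictAnti n) (A : gradedEnd n s) :
    Polynomial.aeval A ((blockCharpoly n s).map (evalPoly A)) = 0 := by
  have htri : A.1.BlockTriangular Sigma.fst := fun a b h => apply_eq_zero hn A h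
  have h1 : A.1.charpoly = ((blockCharpoly n s).map (evalPoly A)).map
      (algebraMap ℂ (MvPolynomial (Fin 2) ℂ)) := by
    rw [blockCharpoly, Polynomial.map_prod, Polynomial.map_prod, Matrix.charpoly,
      htri.charmatrix.det_fintype]
    refine Finset.prod_congr rfl fun i _ => ?_
    let φ : Fin (s i) ≃ {a : Σ i, Fin (s i) // a.1 = i} :=
      { toFun := fun c => ⟨⟨i, c⟩, rfl⟩
        invFun := fun a => a.2 ▸ a.1.2
        left_inv := fun _ => rfl
        right_inv := by rintro ⟨⟨j, c⟩, rfl⟩; rfl }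
    have h1 : (A.1.toSquareBlock Sigma.fst i).submatrix φ φ
        = (diagBlock A i).map (C : ℂ →+* MvPolynomial (Fin 2) ℂ) := by
      ext1 a b
      have := A.2 ⟨i, a⟩ ⟨i, b⟩
      rw [sub_self] at this
      exact mem_binForm_zero this
    rw [← Matrix.charmatrix_toSquareBlock, ← Matrix.charpoly_map, genericBlock_map,
      MvPolynomial.algebraMap_eq, ← Matrix.charpoly_map,
      ← h1]
    exact (Matrix.charpoly_reindex φ.symm _).symm
  have h2 := Matrix.aeval_self_charpoly A.1
  rw [h1, Polynomial.aeval_map_algebraMap] at h2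
  refine Subtype.ext ?_
  have h3 := Polynomial.aeval_algHom_apply (gradedEnd n s).val A
    ((blockCharpoly n s).map (evalPoly A))
  exact h3.symm.trans h2

/-- With p the product of the block characteristic polynomials, p(A) = 0 reads A · (p.divX)(A) =
-p(0), and p(0) is `diagDet A` up to sign. So a single factor `diagDet` clears the denominator of
the inverse. -/
theorem isAffineAlgebraicGroup (hn : StrictAnti n) : IsAffineAlgebraicGroup n s hn where
  diagDet_mem := by
    rw [← prod_det_genericBlock]
    exact Subtype.property _
  principal_open A := by
    have h : diagDet A ≠ 0 ↔ ∀ i, IsUnit (diagBlock A i) := by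
      simp only [diagDet, Finset.prod_ne_zero_iff, Finset.mem_univ, true_implies,
        Matrix.isUnit_iff_isUnit_det, isUnit_iff_ne_zero]
    rw [h]
    exact ⟨fun ⟨g, hg⟩ => hg ▸ g.2, fun h => ⟨⟨A, h⟩, rfl⟩⟩
  inv_regular φ := by
    -- The determinant of an s × s block is (-1)^s times the constant coefficient of its
    -- characteristic polynomial. Division by the variable takes place over `polyFunctions`, so that
    -- the coefficients of q are polynomial in A.
    let ε : ℂ := ∏ i, (-1) ^ s i
    let q := (blockCharpoly n s).divX
    refine ⟨1, fun A => -ε * ∑ k ∈ Finset.range (q.natDegree + 1), (q.coeff k).1 A * φ (A ^ k),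
      ?_, fun g => ?_⟩
    · have h : (fun A => -ε * ∑ k ∈ Finset.range (q.natDegree + 1), (q.coeff k).1 A * φ (A ^ k))
          = (-ε) • ∑ k ∈ Finset.range (q.natDegree + 1), (q.coeff k).1 * fun A => φ (A ^ k) := by
        funext A
        simp [Finset.sum_apply]
      rw [h]
      exact Subalgebra.smul_mem _ (sum_mem fun k _ =>
        mul_mem (q.coeff k).2 (pow_mem_polyFunctions k φ)) _
    · set p := (blockCharpoly n s).map (evalPoly g.1) with hp
      have h1 : diagDet g.1 = ε * p.coeff 0 := by
        rw [hp, blockCharpoly, Polynomial.map_prod, Polynomial.coeff_zero_prod,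
          ← Finset.prod_mul_distrib]
        refine Finset.prod_congr rfl fun i _ => ?_
        rw [← Matrix.charpoly_map, genericBlock_map, Matrix.det_eq_sign_charpoly_coeff,
          Fintype.card_fin]
      have h2 : Polynomial.aeval g.1 p.divX = -p.coeff 0 • (g⁻¹).1 := by
        have h3 := aeval_blockCharpoly hn g.1
        rw [← hp, ← Polynomial.divX_mul_X_add p, map_add, map_mul, Polynomial.aeval_X,
          Polynomial.aeval_C] at h3
        have h4 : g.1 * (g⁻¹).1 = 1 := congrArg Subtype.val (mul_inv_cancel g)
        have h5 := congrArg (· * (g⁻¹).1) h3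
        simp only [add_mul, mul_assoc, h4, mul_one, zero_mul, Algebra.algebraMap_eq_smul_one,
          smul_mul_assoc, one_mul] at h5
        rw [neg_smul]
        simpa using eq_neg_of_add_eq_zero_left h5
      have h6 : p.divX = q.map (evalPoly g.1) := by
        ext k
        simp [q, p, Polynomial.coeff_divX]
      have h7 : φ (Polynomial.aeval g.1 p.divX)
          = ∑ k ∈ Finset.range (q.natDegree + 1), (q.coeff k).1 g.1 * φ (g.1 ^ k) := by
        rw [h6, Polynomial.aeval_eq_sum_range' (n := q.natDegree + 1)
          (Nat.lt_succ_of_le Polynomial.natDegree_map_le), map_sum]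
        refine Finset.sum_congr rfl fun k _ => ?_
        rw [map_smul, Polynomial.coeff_map]
        rfl
      have h8 : diagDet g.1 ^ 1 * φ (g⁻¹).1 = -ε * φ (Polynomial.aeval g.1 p.divX) := by
        rw [h2, map_smul, h1, smul_eq_mul]
        ring
      exact h8.trans (congrArg (-ε * ·) h7)

end AlgebraicGroup

/-! ### Monomials and evaluation of binary forms -/

section BinaryForms

/-- The exponent of the monomial `X₀^(d-k) X₁^k`. -/
def binExp (d : ℤ) (k : ℕ) : Fin 2 →₀ ℕ := Finsupp.single 0 (d - k).toNat + Finsupp.single 1 k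

/-- The monomial `X₀^(d-k) X₁^k`. -/
def binMono (d : ℤ) (k : ℕ) : MvPolynomial (Fin 2) ℂ := monomial (binExp d k) 1

theorem binExp_one (d : ℤ) (k : ℕ) : binExp d k 1 = k := by simp [binExp]
theorem binExp_zero (d : ℤ) (k : ℕ) : binExp d k 0 = (d - k).toNat := by simp [binExp]

theorem binExp_degree {d : ℤ} {k : ℕ} (h : k < (d + 1).toNat) : ((binExp d k).degree : ℤ) = d := by
  simp only [binExp, map_add, Finsupp.degree_single]
  omega

theorem binMono_mem {d : ℤ} {k : ℕ} (h : k < (d + 1).toNat) : binMono d k ∈ binForm d :=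
  mem_binForm.2 fun e he => by
    rw [binMono, coeff_monomial] at he
    split_ifs at he with h'
    · rw [← h', binExp_degree h]
    · exact absurd rfl he

/-- In a given degree the exponent of X₁ determines the monomial; `he` ensures that `toNat` does not
truncate when k = e 1. -/
theorem binExp_eq_iff {d : ℤ} {k : ℕ} {e : Fin 2 →₀ ℕ} (he : (e.degree : ℤ) = d) :
    binExp d k = e ↔ k = e 1 := by
  refine ⟨fun h => by rw [← h, binExp_one], fun h => ?_⟩
  have h2 : e.degree = e 0 + e 1 := by simp [Finsupp.degree_eq_sum]
  ext j
  fin_cases j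
  · change binExp d k 0 = e 0
    rw [binExp_zero]; omega
  · change binExp d k 1 = e 1
    rw [binExp_one, h]

theorem binForm_eq_sum {d : ℤ} {P : MvPolynomial (Fin 2) ℂ} (hP : P ∈ binForm d) :
    P = ∑ k ∈ Finset.range (d + 1).toNat, coeff (binExp d k) P • binMono d k := by
  ext e
  simp only [coeff_sum, coeff_smul, binMono, coeff_monomial, smul_eq_mul, mul_ite, mul_one,
    mul_zero]
  by_cases he : (e.degree : ℤ) = d
  · simp only [binExp_eq_iff he]
    rw [Finset.sum_ite_eq_of_mem', (binExp_eq_iff he).2 rfl]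
    have h2 : e.degree = e 0 + e 1 := by simp [Finsupp.degree_eq_sum]
    rw [Finset.mem_range]; omega
  · rw [Finset.sum_eq_zero fun k hk => if_neg fun h => he (by
      rw [← h, binExp_degree (Finset.mem_range.1 hk)])]
    by_contra h
    exact he (mem_binForm.1 hP e h)

theorem eval_binMono (d : ℤ) (k : ℕ) (z : ℂ) : eval (affVec 0 z) (binMono d k) = z ^ k := by
  rw [binMono, eval_monomial, one_mul, Finsupp.prod_fintype _ _ (fun _ => pow_zero _),
    Fin.prod_univ_two, affVec_zero_zero, affVec_zero_one, one_pow, one_mul, binExp_one]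

theorem eval_binForm {d : ℤ} {P : MvPolynomial (Fin 2) ℂ} (hP : P ∈ binForm d) (z : ℂ) :
    eval (affVec 0 z) P = ∑ k ∈ Finset.range (d + 1).toNat, coeff (binExp d k) P * z ^ k := by
  conv_lhs => rw [binForm_eq_sum hP, map_sum]
  exact Finset.sum_congr rfl fun k _ => by rw [smul_eval, eval_binMono]

theorem eval_smul_binForm {d : ℤ} {P : MvPolynomial (Fin 2) ℂ} (hP : P ∈ binForm d)
    (c : ℂ) (X : Fin 2 → ℂ) : eval (c • X) P = c ^ d * eval X P := by
  rw [eval_eq', eval_eq', Finset.mul_sum]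
  refine Finset.sum_congr rfl fun e he => ?_
  have h1 := mem_binForm.1 hP e (mem_support_iff.1 he)
  rw [← h1, zpow_natCast, Finsupp.degree_eq_sum, ← Finset.prod_pow_eq_pow_sum]
  simp only [Pi.smul_apply, smul_eq_mul, mul_pow, Finset.prod_mul_distrib]
  ring

/-- Homogeneity spreads the vanishing from the points (1, z) to all points with X₀ ≠ 0. The product
X₀ P vanishes at the others as well, and X₀ can be cancelled in a domain. -/
theorem binForm_eq_zero {d : ℤ} {P : MvPolynomial (Fin 2) ℂ} (hP : P ∈ binForm d)
    (h : ∀ z, eval (affVec 0 z) P = 0) : P = 0 := by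
  have h1 : (X 0 : MvPolynomial (Fin 2) ℂ) * P = 0 := MvPolynomial.funext fun x => by
    rw [map_mul, eval_X, map_zero]
    by_cases hx : x 0 = 0
    · rw [hx, zero_mul]
    · have h2 : x = x 0 • affVec 0 (x 1 / x 0) := by
        ext j
        fin_cases j
        · simp [affVec_zero_zero]
        · simp [affVec_zero_one, mul_div_cancel₀ _ hx]
      rw [h2, eval_smul_binForm hP, h, mul_zero, mul_zero]
  exact (mul_eq_zero.1 h1).resolve_left (X_ne_zero _)

end BinaryForms

/-! ### Holomorphy of fibre maps between vector bundles -/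

section FiberMaps
variable {B : Type} [TopologicalSpace B] [ChartedSpace ℂ B]
  {F F' : Type} [NormedAddCommGroup F] [NormedSpace ℂ F] [NormedAddCommGroup F'] [NormedSpace ℂ F']
  {ι ι' : Type*} (Z : VectorBundleCore ℂ B F ι) (Z' : VectorBundleCore ℂ B F' ι')
  [Z.IsContMDiff 𝓘(ℂ) ω] [Z'.IsContMDiff 𝓘(ℂ) ω]

/-- Holomorphy may be tested near each point in any convenient pair of local trivialisations; G
expresses the fibre map there. Linearity of φ plays no role. -/
theorem contMDiff_fiberMap (φ : ∀ x, Z.Fiber x → Z'.Fiber x)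
    (h : ∀ x, ∃ i j, x ∈ Z.baseSet i ∧ x ∈ Z'.baseSet j ∧ ∃ G : B × F → F',
      (∀ w, ContMDiffAt (𝓘(ℂ).prod 𝓘(ℂ, F)) 𝓘(ℂ, F') ω G (x, w)) ∧
      ∀ᶠ p in 𝓝 x, ∀ v : Z.Fiber p, Z'.coordChange (Z'.indexAt p) j p (φ p v)
        = G (p, Z.coordChange (Z.indexAt p) i p v)) :
    ContMDiff (𝓘(ℂ).prod 𝓘(ℂ, F)) (𝓘(ℂ).prod 𝓘(ℂ, F')) ω
      fun v : TotalSpace F Z.Fiber => TotalSpace.mk' F' v.proj (φ v.proj v.snd) := by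
  intro v
  obtain ⟨i, j, hi, hj, G, hG, hφ⟩ := h v.proj
  have : MemTrivializationAtlas (Z.localTriv i) := ⟨⟨i, rfl⟩⟩
  have : MemTrivializationAtlas (Z'.localTriv j) := ⟨⟨j, rfl⟩⟩
  rw [(Z'.localTriv j).contMDiffAt_iff (by exact (Z'.mem_localTriv_source j _).2 hj)]
  refine ⟨contMDiffAt_proj _, ?_⟩
  have hv : v ∈ (Z.localTriv i).source := (Z.mem_localTriv_source i _).2 hi
  have h1 : ContMDiffAt (𝓘(ℂ).prod 𝓘(ℂ, F)) (𝓘(ℂ).prod 𝓘(ℂ, F)) ω (Z.localTriv i) v :=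
    (Z.localTriv i).contMDiffOn.contMDiffAt ((Z.localTriv i).open_source.mem_nhds hv)
  have h2 : ContMDiffAt (𝓘(ℂ).prod 𝓘(ℂ, F)) 𝓘(ℂ, F') ω (fun u => G (Z.localTriv i u)) v :=
    ContMDiffAt.comp v (hG _) h1
  refine h2.congr_of_eventuallyEq ?_
  filter_upwards [(FiberBundle.continuous_proj F Z.Fiber).continuousAt.eventually hφ] with u hu
  exact hu u.snd

end FiberMaps

/-! ### Automorphisms are multiplications by matrices of forms -/

section Automorphisms
variable {m : ℕ} {n : Fin m → ℤ} {s : Fin m → ℕ}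

/-- Homogeneous coordinates of `p` with `k`-th coordinate `1`. -/
def normVec (k : Fin 2) (p : P1) : Fin 2 → ℂ := fun i => ratio i k p

theorem normVec_pt (k : Fin 2) (z : ℂ) : normVec k (pt k z) = affVec k z := by
  ext i; rw [normVec, ratio_pt, affVec_same, div_one]

theorem normVec_change {k l : Fin 2} {p : P1} (hk : p ∈ coordOpen k) :
    normVec l p = ratio k l p • normVec k p := by
  ext i
  simp only [normVec, Pi.smul_apply, smul_eq_mul]
  rw [mul_comm, ratio_mul_ratio _ _ _ _ hk]

/-- The matrix of values of a block matrix of forms. -/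
def evalMat (A : gradedEnd n s) (X : Fin 2 → ℂ) :
    Matrix (Σ i, Fin (s i)) (Σ i, Fin (s i)) ℂ := A.1.map (eval X)

theorem evalMat_mul (A B : gradedEnd n s) (X : Fin 2 → ℂ) :
    evalMat (A * B) X = evalMat A X * evalMat B X := Matrix.map_mul

theorem evalMat_one (X : Fin 2 → ℂ) : evalMat (1 : gradedEnd n s) X = 1 :=
  Matrix.map_one _ (map_zero _) (map_one _)

theorem gradedEnd_ext {A B : gradedEnd n s}
    (h : ∀ z, evalMat A (affVec 0 z) = evalMat B (affVec 0 z)) :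
    A = B := by
  refine Subtype.ext (Matrix.ext fun a b => sub_eq_zero.1 (binForm_eq_zero
    (Submodule.sub_mem _ (A.2 a b) (B.2 a b)) fun z => ?_))
  rw [map_sub, sub_eq_zero]
  exact congrFun (congrFun (h z) a) b

/-- Degrees add up: an entry of degree n_a - n_b times a component of degree n_b has degree n_a. -/
theorem evalMat_smul_mulVec (A : gradedEnd n s) {c : ℂ} (hc : c ≠ 0) (X : Fin 2 → ℂ)
    (w w' : (Σ i, Fin (s i)) → ℂ) (hw : ∀ a, w' a = c ^ n a.1 * w a) (a : Σ i, Fin (s i)) :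
    (evalMat A (c • X)).mulVec w' a = c ^ n a.1 * (evalMat A X).mulVec w a := by
  simp only [Matrix.mulVec, dotProduct, evalMat, Matrix.map_apply, Finset.mul_sum]
  refine Finset.sum_congr rfl fun b _ => ?_
  rw [eval_smul_binForm (A.2 a b), hw, zpow_sub₀ hc]
  have := zpow_ne_zero (n b.1) hc
  field_simp

/-- Multiplication of homogeneous functions by a block matrix, on a fibre. -/
def mulFiber (A : gradedEnd n s) (p : P1) : SplitBundle n s p →ₗ[ℂ] SplitBundle n s p :=
  (frameVec (chartIndex p) p).comp
    ((evalMat A (normVec (chartIndex p) p)).mulVecLin.comp (frameCoord (chartIndex p) p))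

/-- `mulFiber` is defined in the frame that `chartIndex` selects. By homogeneity the same formula is
valid in every frame at p, which is what holomorphy and multiplicativity rest on. -/
theorem frameCoord_mulFiber (A : gradedEnd n s) {k : Fin 2} {p : P1} (hk : p ∈ coordOpen k)
    (v : SplitBundle n s p) :
    frameCoord k p (mulFiber A p v) = (evalMat A (normVec k p)).mulVec (frameCoord k p v) := by
  have hc := mem_coordOpen_chartIndex p
  ext a
  rw [frameCoord_change hc, mulFiber, LinearMap.comp_apply, frameCoord_frameVec hc,
    LinearMap.comp_apply, Matrix.mulVecLin_apply, normVec_change (l := k) hc]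
  exact (evalMat_smul_mulVec A (div_ne_zero hc hk) _ _ _ (fun b => frameCoord_change hc v b) a).symm

theorem homogVal_mulFiber (A : gradedEnd n s) (X : Fin 2 → ℂ) (hX : X ≠ 0)
    (v : SplitBundle n s (Projectivization.mk ℂ X hX)) :
    homogVal n s (mulFiber A _ v) X = (evalMat A X).mulVec (homogVal n s v X) := by
  obtain ⟨k, hk⟩ := Function.ne_iff.1 hX
  have hk' : X k ≠ 0 := hk
  have hp := (mk_mem_coordOpen k X hX).2 hk'
  have h1 : X = X k • normVec k (Projectivization.mk ℂ X hX) := by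
    ext i
    simp only [normVec, Pi.smul_apply, smul_eq_mul, ratio_mk, mul_div_cancel₀ _ hk']
  ext a
  rw [homogVal_mk X hX k hk', frameCoord_mulFiber A hp]
  rw [← evalMat_smul_mulVec A hk' _ _ (homogVal n s v X) (fun b => homogVal_mk X hX k hk' v b) a,
    ← h1]

theorem mulFiber_mul (A B : gradedEnd n s) (p : P1) (v : SplitBundle n s p) :
    mulFiber (A * B) p v = mulFiber A p (mulFiber B p v) := by
  have hp := mem_coordOpen_chartIndex p
  refine frameCoord_injective hp ?_
  rw [frameCoord_mulFiber _ hp, frameCoord_mulFiber _ hp, frameCoord_mulFiber _ hp, evalMat_mul,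
    Matrix.mulVec_mulVec]

theorem mulFiber_one (p : P1) (v : SplitBundle n s p) : mulFiber 1 p v = v := by
  have hp := mem_coordOpen_chartIndex p
  refine frameCoord_injective hp ?_
  rw [frameCoord_mulFiber _ hp, evalMat_one, Matrix.one_mulVec]

theorem contMDiffOn_eval_normVec (k : Fin 2) (P : MvPolynomial (Fin 2) ℂ) :
    ContMDiffOn 𝓘(ℂ) 𝓘(ℂ) ω (fun p => eval (normVec k p) P) (coordOpen k) := by
  induction P using MvPolynomial.induction_on with
  | C c => simpa using contMDiffOn_const
  | add P Q hP hQ =>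
    simp only [map_add]
    exact hP.add hQ
  | mul_X P i hP =>
    simp only [map_mul, eval_X]
    exact hP.mul (contMDiffOn_ratio i k)

theorem contMDiff_mulFiber (A : gradedEnd n s) :
    ContMDiff (𝓘(ℂ).prod 𝓘(ℂ, (Σ i, Fin (s i)) → ℂ)) (𝓘(ℂ).prod 𝓘(ℂ, (Σ i, Fin (s i)) → ℂ)) ω
      fun v : TotalSpace ((Σ i, Fin (s i)) → ℂ) (SplitBundle n s) =>
        TotalSpace.mk' ((Σ i, Fin (s i)) → ℂ) v.proj (mulFiber A v.proj v.snd) := by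
  refine contMDiff_fiberMap (splitCore n s) (splitCore n s) (fun p => mulFiber A p) fun x => ?_
  set k := chartIndex x
  have hk : x ∈ coordOpen k := mem_coordOpen_chartIndex x
  refine ⟨k, k, hk, hk, fun q => (evalMat A (normVec k q.1)).mulVec q.2, fun w => ?_, ?_⟩
  · rw [contMDiffAt_pi_space]
    intro a
    simp only [Matrix.mulVec, dotProduct]
    refine ContMDiffAt.sum fun b _ => ?_
    have h1 : ContMDiffAt 𝓘(ℂ) 𝓘(ℂ) ω (fun p => eval (normVec k p) (A.1 a b)) x :=
      (contMDiffOn_eval_normVec k _).contMDiffAt ((isOpen_coordOpen k).mem_nhds hk)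
    have h2 := contMDiffAt_pi_space.1 (contMDiffAt_snd (I := 𝓘(ℂ))
      (J := 𝓘(ℂ, (Σ i, Fin (s i)) → ℂ)) (n := ω) (p := (x, w))) b
    have h3 : ContMDiffAt (𝓘(ℂ).prod 𝓘(ℂ, (Σ i, Fin (s i)) → ℂ)) 𝓘(ℂ) ω
        (fun q : P1 × ((Σ i, Fin (s i)) → ℂ) => eval (normVec k q.1) (A.1 a b)) (x, w) :=
      ContMDiffAt.comp (x, w) (g := fun p => eval (normVec k p) (A.1 a b)) h1 contMDiffAt_fst
    exact ContMDiffAt.mul h3 h2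
  · filter_upwards [(isOpen_coordOpen k).mem_nhds hk] with p hp v
    exact frameCoord_mulFiber A hp v

/-- Multiplication by a block matrix, as an automorphism of `⊕ O(n_i)^{s_i}`. -/
def mulAut (hn : StrictAnti n) (A : structGroup n s hn) :
    BundleAut ((Σ i, Fin (s i)) → ℂ) (SplitBundle n s) where
  equiv p := LinearEquiv.ofLinearMap (mulFiber A.1 p) (mulFiber (A⁻¹).1 p)
    (LinearMap.ext fun v => by
      rw [LinearMap.comp_apply, ← mulFiber_mul]
      have h : A.1 * (A⁻¹).1 = 1 := congrArg Subtype.val (mul_inv_cancel A)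
      rw [h, mulFiber_one]; rfl)
    (LinearMap.ext fun v => by
      rw [LinearMap.comp_apply, ← mulFiber_mul]
      have h : (A⁻¹).1 * A.1 = 1 := congrArg Subtype.val (inv_mul_cancel A)
      rw [h, mulFiber_one]; rfl)
  hol := contMDiff_mulFiber A.1
  hol_symm := contMDiff_mulFiber (A⁻¹).1

theorem mulAut_apply (hn : StrictAnti n) (A : structGroup n s hn) (p : P1)
    (v : SplitBundle n s p) : (mulAut hn A).equiv p v = mulFiber A.1 p v := rfl

theorem isHolSection_frameVec (k : Fin 2) (w : (Σ i, Fin (s i)) → ℂ) :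
    IsHolSection ((Σ i, Fin (s i)) → ℂ) (fun p => (frameVec k p w : SplitBundle n s p))
      (coordOpen k) := by
  refine (isHolSection_iff (isOpen_coordOpen k) subset_rfl).2 fun a => ?_
  simp only [frameCoord_frameVec (pt_mem k _)]
  exact differentiableOn_const _

/-- The matrix of an automorphism in the frame over `X_k ≠ 0`. -/
def autMat (f : BundleAut ((Σ i, Fin (s i)) → ℂ) (SplitBundle n s)) (k : Fin 2) (z : ℂ) :
    Matrix (Σ i, Fin (s i)) (Σ i, Fin (s i)) ℂ := fun a b =>
  frameCoord k (pt k z) (f.equiv _ (frameVec k (pt k z) (Pi.single b 1))) a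

theorem autMat_mulVec (f : BundleAut ((Σ i, Fin (s i)) → ℂ) (SplitBundle n s)) (k : Fin 2) (z : ℂ)
    (v : SplitBundle n s (pt k z)) :
    frameCoord k (pt k z) (f.equiv _ v) = (autMat f k z).mulVec (frameCoord k (pt k z) v) := by
  let L : ((Σ i, Fin (s i)) → ℂ) →ₗ[ℂ] ((Σ i, Fin (s i)) → ℂ) :=
    (frameCoord k (pt k z)).comp ((f.equiv (pt k z)).toLinearMap.comp (frameVec k (pt k z)))
  have h1 : autMat f k z = LinearMap.toMatrix' L := by
    ext a b
    rw [LinearMap.toMatrix'_apply]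
    rfl
  rw [h1, LinearMap.toMatrix'_mulVec]
  simp only [L, LinearMap.comp_apply, frameVec_frameCoord (pt_mem k z), LinearEquiv.coe_coe]

theorem differentiable_autMat (f : BundleAut ((Σ i, Fin (s i)) → ℂ) (SplitBundle n s)) (k : Fin 2)
    (a b : Σ i, Fin (s i)) : Differentiable ℂ fun z => autMat f k z a b := by
  have h := (isHolSection_iff (isOpen_coordOpen k) subset_rfl).1
    (f.isHolSection (isHolSection_frameVec k (Pi.single b 1))) a
  have hu : pt k ⁻¹' coordOpen k = Set.univ := Set.eq_univ_of_forall fun z => pt_mem k z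
  rw [hu, differentiableOn_univ] at h
  exact h

/-- The entry is a section of Hom(O(n_b), O(n_a)) = O(n_a - n_b): the change of frames enters once
at the target and inversely at the source. -/
theorem autMat_one_inv (f : BundleAut ((Σ i, Fin (s i)) → ℂ) (SplitBundle n s)) {z : ℂ}
    (hz : z ≠ 0) (a b : Σ i, Fin (s i)) :
    autMat f 1 z⁻¹ a b = z ^ (-(n a.1 - n b.1)) * autMat f 0 z a b := by
  have h1 : (frameVec 1 (pt 0 z) (Pi.single b 1) : SplitBundle n s (pt 0 z))
      = z ^ n b.1 • frameVec 0 (pt 0 z) (Pi.single b 1) := by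
    refine frameCoord_injective (pt_mem 0 z) ?_
    rw [map_smul, frameCoord_frameVec (pt_mem 0 z)]
    ext c
    rw [frameCoord_change (pt_zero_mem_one.2 hz), frameCoord_frameVec (pt_zero_mem_one.2 hz),
      ratio_pt, affVec_zero_zero, affVec_zero_one, div_one, Pi.smul_apply, smul_eq_mul]
    by_cases h : c = b
    · rw [h]
    · rw [Pi.single_eq_of_ne h, mul_zero, mul_zero]
  have h2 := frameCoord_one_inv (fun p => f.equiv p (frameVec 1 p (Pi.single b 1))) hz a
  rw [autMat, h2, h1, map_smul, map_smul, Pi.smul_apply, smul_eq_mul, ← mul_assoc,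
    ← zpow_add₀ hz, autMat]
  congr 2; ring

/-- By `autMat_one_inv` and Liouville the entries are polynomials in z of degree at most n_a - n_b;
homogenising them gives A. -/
theorem exists_gradedEnd (f : BundleAut ((Σ i, Fin (s i)) → ℂ) (SplitBundle n s)) :
    ∃ A : gradedEnd n s, ∀ p v, f.equiv p v = mulFiber A p v := by
  choose c hc using fun a b => exists_eq_sum_pow_of_entire (differentiable_autMat f 0 a b)
    (differentiable_autMat f 1 a b) (n a.1 - n b.1) (fun z hz => autMat_one_inv f hz a b)
  let A : gradedEnd n s := ⟨fun a b => ∑ k ∈ Finset.range (n a.1 - n b.1 + 1).toNat,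
      c a b k • binMono (n a.1 - n b.1) k, fun a b => Submodule.sum_mem _ fun k hk =>
        Submodule.smul_mem _ _ (binMono_mem (Finset.mem_range.1 hk))⟩
  have h0 (z : ℂ) : evalMat A (affVec 0 z) = autMat f 0 z := by
    ext a b
    rw [hc]
    change eval (affVec 0 z) (∑ k ∈ Finset.range (n a.1 - n b.1 + 1).toNat,
      c a b k • binMono (n a.1 - n b.1) k) = _
    simp only [map_sum, smul_eval, eval_binMono]
  have h00 (z : ℂ) (v) : f.equiv (pt 0 z) v = mulFiber A (pt 0 z) v := by
    refine frameCoord_injective (pt_mem 0 z) ?_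
    rw [autMat_mulVec, frameCoord_mulFiber A (pt_mem 0 z), normVec_pt, h0]
  refine ⟨A, fun p v => ?_⟩
  by_cases hp : p ∈ coordOpen 0
  · have h1 := h00 (affChart 0 p)
    rw [pt_affChart hp] at h1
    exact h1 v
  · obtain rfl := eq_pt_one_zero hp
    refine frameCoord_injective (pt_mem 1 0) ?_
    rw [autMat_mulVec, frameCoord_mulFiber A (pt_mem 1 0), normVec_pt]
    -- Only the point at infinity is left. Both sides are continuous in the coordinate ζ there and
    -- agree for ζ ≠ 0.
    suffices h : ∀ a b, (fun ζ => autMat f 1 ζ a b) = fun ζ => evalMat A (affVec 1 ζ) a b by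
      congr 1
      ext a b
      exact congrFun (h a b) 0
    intro a b
    refine Continuous.ext_on (dense_compl_singleton (0 : ℂ))
      (differentiable_autMat f 1 a b).continuous ?_ ?_
    · refine (MvPolynomial.continuous_eval (A.1 a b)).comp ?_
      unfold affVec
      fun_prop
    · intro ζ hζ
      have hζ' : ζ ≠ 0 := hζ
      have h1 := h00 ζ⁻¹ (frameVec 1 (pt 0 ζ⁻¹) (Pi.single b 1))
      rw [← pt_inv (inv_ne_zero hζ'), inv_inv] at h1
      have h2 := congrFun (congrArg (frameCoord 1 (pt 1 ζ)) h1) a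
      rw [frameCoord_mulFiber A (pt_mem 1 ζ), normVec_pt, frameCoord_frameVec (pt_mem 1 ζ)] at h2
      simpa [autMat] using h2

/-- The matrix of the inverse automorphism is an inverse matrix, and `diagBlock` is multiplicative,
so the diagonal blocks are invertible. -/
theorem exists_mulAut_eq (hn : StrictAnti n)
    (f : BundleAut ((Σ i, Fin (s i)) → ℂ) (SplitBundle n s)) : ∃ A, mulAut hn A = f := by
  obtain ⟨A, hA⟩ := exists_gradedEnd f
  obtain ⟨B, hB⟩ := exists_gradedEnd f.symm
  have hAB : A * B = 1 := gradedEnd_ext fun z => by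
    refine Matrix.ext_of_mulVec_single fun b => ?_
    have h1 : mulFiber (A * B) (pt 0 z) (frameVec 0 (pt 0 z) (Pi.single b 1))
        = frameVec 0 (pt 0 z) (Pi.single b 1) := by
      rw [mulFiber_mul, ← hA, ← hB]
      exact (f.equiv _).apply_symm_apply _
    have h2 := congrArg (frameCoord 0 (pt 0 z)) h1
    rw [frameCoord_mulFiber _ (pt_mem 0 z), frameCoord_frameVec (pt_mem 0 z), normVec_pt] at h2
    rw [h2, evalMat_one, Matrix.one_mulVec]
  refine ⟨⟨A, fun i => ?_⟩, ?_⟩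
  · have h := congrArg (diagBlock · i) hAB
    simp only [diagBlock_mul hn, diagBlock_one] at h
    exact IsUnit.of_mul_eq_one _ h
  · ext p v
    exact (hA p v).symm

theorem mulAut_injective (hn : StrictAnti n) : Function.Injective (mulAut (s := s) hn) := by
  intro A B h
  refine Subtype.ext (gradedEnd_ext fun z => Matrix.ext_of_mulVec_single fun b => ?_)
  have h1 : mulFiber A.1 (pt 0 z) (frameVec 0 (pt 0 z) (Pi.single b 1))
      = mulFiber B.1 (pt 0 z) (frameVec 0 (pt 0 z) (Pi.single b 1)) := by
    rw [← mulAut_apply, ← mulAut_apply, h]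
  have h2 := congrArg (frameCoord 0 (pt 0 z)) h1
  rwa [frameCoord_mulFiber _ (pt_mem 0 z), frameCoord_mulFiber _ (pt_mem 0 z),
    frameCoord_frameVec (pt_mem 0 z), normVec_pt] at h2

variable (s) in
/-- The isomorphism of the group of block matrices with `Aut(⊕ O(n_i)^{s_i})`. -/
def autEquiv (hn : StrictAnti n) :
    structGroup n s hn ≃* BundleAut ((Σ i, Fin (s i)) → ℂ) (SplitBundle n s) :=
  MulEquiv.mk (Equiv.ofBijective (mulAut hn) ⟨mulAut_injective hn, exists_mulAut_eq hn⟩)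
    fun A B => HolIso.ext (funext fun p => LinearEquiv.ext fun v => mulFiber_mul A.1 B.1 p v)

theorem autEquiv_apply (hn : StrictAnti n) (A : structGroup n s hn) (p : P1)
    (v : SplitBundle n s p) : (autEquiv s hn A).equiv p v = mulFiber A.1 p v := rfl

end Automorphisms

/-! ### Circle integrals and Laurent tails -/

section CircleIntegrals
open Complex

/-- There is no residue at infinity: the integral does not depend on the radius R, and E = O(R^(-2))
makes it O(1/R). -/
theorem circleIntegral_eq_zero_of_vanishing_at_infinity {E κ : ℂ → ℂ}
    (hE : ∀ z ≠ 0, DifferentiableAt ℂ E z) (hκ : ContinuousAt κ 0)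
    (h : ∀ᶠ ζ in 𝓝[≠] (0 : ℂ), E ζ⁻¹ = ζ ^ 2 * κ ζ) : ∮ z in C(0, 1), E z = 0 := by
  have h1 : ∀ᶠ ζ in 𝓝[≠] (0 : ℂ), ‖κ ζ‖ < ‖κ 0‖ + 1 :=
    (hκ.norm.eventually_lt_const (lt_add_one _)).filter_mono nhdsWithin_le_nhds
  obtain ⟨δ, hδ, hb⟩ := Metric.eventually_nhds_iff.1 (eventually_nhdsWithin_iff.1 (h.and h1))
  set C := ‖κ 0‖ + 1
  have key : ∀ R : ℝ, max 1 (δ⁻¹ + 1) ≤ R → ‖∮ z in C(0, 1), E z‖ ≤ 2 * Real.pi * C * R⁻¹ := by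
    intro R hR
    have hR1 : 1 ≤ R := (le_max_left _ _).trans hR
    have hR0 : 0 < R := by linarith
    rw [← circleIntegral_eq_of_differentiable_on_annulus_off_countable one_pos hR1
      Set.countable_empty (c := 0) (f := E)
      (fun z hz => (hE z fun h0 => hz.2 (by simp [h0])).continuousAt.continuousWithinAt)
      (fun z hz => hE z fun h0 => hz.1.2 (by simp [h0]))]
    refine (circleIntegral.norm_integral_le_of_norm_le_const (C := R⁻¹ ^ 2 * C) hR0.le
      fun z hz => ?_).trans (le_of_eq (by field_simp))
    have hzR : ‖z‖ = R := by simpa using hz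
    have hz0 : z ≠ 0 := fun h0 => by rw [h0, norm_zero] at hzR; exact hR0.ne hzR
    have hlt : dist z⁻¹ 0 < δ := by
      rw [dist_zero_right, norm_inv, hzR]
      refine (inv_lt_comm₀ hR0 hδ).2 ?_
      linarith [(le_max_right _ _).trans hR]
    obtain ⟨h2, h3⟩ := hb hlt (inv_ne_zero hz0)
    rw [inv_inv] at h2
    rw [h2, norm_mul, norm_pow, norm_inv, hzR]
    gcongr
  have hlim : Filter.Tendsto (fun R : ℝ => 2 * Real.pi * C * R⁻¹) Filter.atTop (𝓝 0) := by
    simpa using tendsto_inv_atTop_zero.const_mul (2 * Real.pi * C)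
  exact norm_le_zero_iff.1 (ge_of_tendsto hlim
    (Filter.eventually_atTop.2 ⟨_, key⟩))

theorem circleIntegral_zpow (j : ℤ) :
    ∮ z in C(0, 1), z ^ j = if j = -1 then 2 * Real.pi * I else 0 := by
  split_ifs with h
  · subst h
    have := circleIntegral.integral_sub_center_inv 0 (one_ne_zero (α := ℝ))
    simpa using this
  · have := circleIntegral.integral_sub_zpow_of_ne h 0 0 1
    simpa using this

theorem circleIntegrable_of_differentiableAt {E : ℂ → ℂ} (hE : ∀ z ≠ 0, DifferentiableAt ℂ E z) :
    CircleIntegrable E 0 1 := by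
  refine ContinuousOn.circleIntegrable zero_le_one fun z hz => ?_
  refine (hE z fun h0 => ?_).continuousAt.continuousWithinAt
  rw [h0] at hz
  simp at hz

/-- Nonnegative exponents belong to F₀ and exponents at most n to z^n G(1/z). The exponents strictly
between, -1 down to n + 1, are as many as the monomials of degree -2-n, and there are none for n ≥
0. -/
theorem exists_laurent_split_zpow {F : ℂ → ℂ}
    (hF : DifferentiableOn ℂ F {z | 1 / 2 < ‖z‖ ∧ ‖z‖ < 2}) (n : ℤ) :
    ∃ (F₀ G : ℂ → ℂ) (h : ℕ → ℂ), DifferentiableOn ℂ F₀ (Metric.ball 0 2) ∧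
      DifferentiableOn ℂ G (Metric.ball 0 2) ∧ ∀ z, 1 / 2 < ‖z‖ → ‖z‖ < 2 →
        F z = F₀ z + ∑ b ∈ Finset.range (-2 - n + 1).toNat, h b * z ^ (-(b : ℤ) - 1)
          + z ^ n * G z⁻¹ := by
  obtain ⟨F₀, F₁, h₀, h₁, hFz⟩ := exists_laurent_split hF
  obtain ⟨c, G, hG, hGz⟩ := exists_taylor_split (Metric.ball_mem_nhds 0 two_pos) (-n).toNat h₁
  rcases lt_or_ge n 0 with hn | hn
  · obtain ⟨K, hK⟩ : ∃ K : ℕ, (-n).toNat = K + 1 := ⟨(-n).toNat - 1, by omega⟩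
    have hK' : (-2 - n + 1).toNat = K := by omega
    -- The constant term of the part in 1/z moves to F₀, so the coefficient of z^(-b-1) has index b
    -- + 1.
    refine ⟨fun z => F₀ z + c 0, G, fun b => c (b + 1), h₀.add_const _, hG, fun z hz1 hz2 => ?_⟩
    have hz : z ≠ 0 := norm_pos_iff.1 (by linarith)
    rw [hFz z hz1 hz2, hGz, hK, hK', Finset.sum_range_succ']
    have h1 : z⁻¹ ^ (K + 1) = z ^ n := by
      rw [← zpow_natCast, inv_zpow', ← hK]; congr 1; omega
    have h2 : ∑ b ∈ Finset.range K, c (b + 1) * z⁻¹ ^ (b + 1)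
        = ∑ b ∈ Finset.range K, c (b + 1) * z ^ (-(b : ℤ) - 1) :=
      Finset.sum_congr rfl fun b _ => by
        rw [← zpow_natCast, inv_zpow']; congr 2; push_cast; ring
    rw [h1, h2]
    ring
  · have hK : (-n).toNat = 0 := by omega
    have hK' : (-2 - n + 1).toNat = 0 := by omega
    refine ⟨F₀, fun ζ => ζ ^ n.toNat * G ζ, 0, h₀,
      (differentiableOn_id.pow _).mul hG, fun z hz1 hz2 => ?_⟩
    have hz : z ≠ 0 := norm_pos_iff.1 (by linarith)
    have h1 : z ^ n * z⁻¹ ^ n.toNat = 1 := by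
      rw [← zpow_natCast, inv_zpow', ← zpow_add₀ hz, Int.toNat_of_nonneg hn, add_neg_cancel,
        zpow_zero]
    rw [hFz z hz1 hz2, hGz, hK, hK']
    simp only [Finset.range_zero, Finset.sum_empty, pow_zero, one_mul, zero_add, add_zero,
      ← mul_assoc, h1]

end CircleIntegrals

/-! ### Classes of cocycles -/

section H1Basics
variable {X : Type} [TopologicalSpace X] [ChartedSpace ℂ X]
variable {F : Type} [NormedAddCommGroup F] [NormedSpace ℂ F]
  {E : X → Type} [TopologicalSpace (TotalSpace F E)] [∀ x, AddCommGroup (E x)]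
  [∀ x, Module ℂ (E x)] [∀ x, TopologicalSpace (E x)] [FiberBundle F E] [VectorBundle ℂ F E]

theorem H1.mk_eq_mk {c d : X → X → ∀ x, E x} {hc : c ∈ cocycles F E} {hd : d ∈ cocycles F E} :
    H1.mk F c hc = H1.mk F d hd ↔ c - d ∈ coboundaries F E :=
  Submodule.Quotient.eq _

theorem H1.exists_mk (h : H1 F E) : ∃ c hc, h = H1.mk F c hc := by
  induction h using Submodule.Quotient.induction_on with
  | H c => exact ⟨c.1, c.2, rfl⟩

end H1Basics

/-! ### The residue pairing -/

section Residues
variable {m : ℕ} {n : Fin m → ℤ} {s : Fin m → ℕ}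
open Complex

local notation "𝔽" => ((Σ i, Fin (s i)) → ℂ)

theorem serreResidue_eq (f : ∀ p, SplitBundle n s p) (x : Σ i, Fin (s i))
    (P : binForm (-2 - n x.1)) :
    serreResidue n s f x P = (2 * Real.pi * I)⁻¹ *
      ∮ z in C(0, 1), frameCoord 0 (pt 0 z) (f (pt 0 z)) x * eval (affVec 0 z) P.1 := by
  simp only [serreResidue, ← homogVal_pt]
  rfl

theorem differentiableAt_frameCoord_zero {f : ∀ p, SplitBundle n s p}
    (hf : IsHolSection 𝔽 f (coordOpen 0 ∩ coordOpen 1)) (x : Σ i, Fin (s i)) {z : ℂ} (hz : z ≠ 0) :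
    DifferentiableAt ℂ (fun z => frameCoord 0 (pt 0 z) (f (pt 0 z)) x) z := by
  have hU := (isOpen_coordOpen 0).inter (isOpen_coordOpen 1)
  exact ((isHolSection_iff hU Set.inter_subset_left).1 hf x).differentiableAt
    ((hU.preimage (continuous_pt 0)).mem_nhds ⟨pt_mem 0 z, pt_zero_mem_one.2 hz⟩)

theorem differentiable_eval_affVec (P : MvPolynomial (Fin 2) ℂ) (k : Fin 2) :
    Differentiable ℂ fun z => eval (affVec k z) P := by
  induction P using MvPolynomial.induction_on with
  | C c => simp
  | add P Q hP hQ =>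
    simp only [map_add]
    exact hP.add hQ
  | mul_X P i hP =>
    simp only [map_mul, eval_X]
    refine hP.mul ?_
    fin_cases k <;> fin_cases i <;> simp [affVec]

theorem serreResidue_sub {f g : ∀ p, SplitBundle n s p}
    (hf : IsHolSection 𝔽 f (coordOpen 0 ∩ coordOpen 1))
    (hg : IsHolSection 𝔽 g (coordOpen 0 ∩ coordOpen 1)) (x : Σ i, Fin (s i))
    (P : binForm (-2 - n x.1)) :
    serreResidue n s (f - g) x P = serreResidue n s f x P - serreResidue n s g x P := by
  have h {f : ∀ p, SplitBundle n s p} (hf : IsHolSection 𝔽 f (coordOpen 0 ∩ coordOpen 1)) :=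
    circleIntegrable_of_differentiableAt fun z hz =>
      (differentiableAt_frameCoord_zero hf x hz).mul (differentiable_eval_affVec P.1 0 z)
  rw [serreResidue_eq, serreResidue_eq, serreResidue_eq, ← mul_sub]
  congr 1
  refine Eq.trans ?_ (circleIntegral.integral_sub (h hf) (h hg))
  congr 1
  funext z
  simp only [Pi.sub_apply, map_sub, sub_mul]

/-- A section over `U₀ ∩ U₁` whose cocycle is a coboundary has no residues. -/
theorem serreResidue_eq_zero {f : ∀ p, SplitBundle n s p}
    (hf : IsHolSection 𝔽 f (coordOpen 0 ∩ coordOpen 1))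
    (hc : standardCocycle n s f ∈ coboundaries 𝔽 (SplitBundle n s)) (x : Σ i, Fin (s i))
    (P : binForm (-2 - n x.1)) : serreResidue n s f x P = 0 := by
  obtain ⟨U, b, hU, hb, hbc⟩ := hc
  have hci (z : ℂ) : chartIndex (pt 0 z) = 0 := chartIndex_eq_zero.2 (pt_mem 0 z)
  -- Points with chart index 0 have zero cocycle between them, so their local sections b agree on
  -- overlaps and glue to an entire function.
  let g : ℂ → ℂ := fun z => frameCoord 0 (pt 0 z) (b (pt 0 z) (pt 0 z)) x
  have hV (k : Fin 2) (y : P1) := (hU y).1.inter (isOpen_coordOpen k)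
  have hbd (k : Fin 2) (y : P1) := (isHolSection_iff (hV k y) Set.inter_subset_right).1
    ((hb y).mono Set.inter_subset_left) x
  have hg (z₀ : ℂ) : DifferentiableAt ℂ g z₀ := by
    have hmem : z₀ ∈ pt 0 ⁻¹' (U (pt 0 z₀) ∩ coordOpen 0) := ⟨(hU _).2, pt_mem 0 z₀⟩
    have hnh := ((hV 0 (pt 0 z₀)).preimage (continuous_pt 0)).mem_nhds hmem
    refine ((hbd 0 (pt 0 z₀)).differentiableAt hnh).congr_of_eventuallyEq ?_
    filter_upwards [hnh] with z hz
    have h1 := hbc (pt 0 z) (pt 0 z₀) (pt 0 z) ⟨(hU _).2, hz.1⟩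
    simp only [standardCocycle, hci] at h1
    have h2 : b (pt 0 z) (pt 0 z) = b (pt 0 z₀) (pt 0 z) := by
      simpa using (sub_eq_zero.1 h1.symm).symm
    simp only [g, h2]
  let q : P1 := pt 1 0
  have hq : chartIndex q = 1 := chartIndex_eq_one.2 fun h => pt_one_mem_zero.1 h rfl
  -- Near infinity f + g coincides with b q, hence extends over q. Times P it becomes a section of
  -- O(-2), of order z^(-2) at infinity, so E has integral zero; g P has integral zero because it is
  -- entire. Their difference is the residue of f.
  let E : ℂ → ℂ := fun z => (frameCoord 0 (pt 0 z) (f (pt 0 z)) x + g z) * eval (affVec 0 z) P.1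
  have hfd (z : ℂ) (hz : z ≠ 0) := differentiableAt_frameCoord_zero hf x hz
  have hP := differentiable_eval_affVec P.1
  have hE (z : ℂ) (hz : z ≠ 0) : DifferentiableAt ℂ E z := ((hfd z hz).add (hg z)).mul (hP 0 z)
  have hgP : ∮ z in C(0, 1), g z * eval (affVec 0 z) P.1 = 0 :=
    Complex.circleIntegral_eq_zero_of_differentiable_on_off_countable zero_le_one
      Set.countable_empty (fun z _ => ((hg z).mul (hP 0 z)).continuousAt.continuousWithinAt)
      fun z _ => (hg z).mul (hP 0 z)
  have hE0 : ∮ z in C(0, 1), E z = 0 := by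
    have hnh := ((hV 1 q).preimage (continuous_pt 1)).mem_nhds
      (show (0 : ℂ) ∈ _ from ⟨(hU q).2, pt_mem 1 0⟩)
    refine circleIntegral_eq_zero_of_vanishing_at_infinity hE
      (κ := fun ζ => frameCoord 1 (pt 1 ζ) (b q (pt 1 ζ)) x * eval (affVec 1 ζ) P.1)
      (((hbd 1 q).differentiableAt hnh).mul (hP 1 0)).continuousAt ?_
    rw [eventually_nhdsWithin_iff]
    filter_upwards [hnh] with ζ hζ hζ0
    have hζ0 : ζ ≠ 0 := hζ0
    have hz0 := inv_ne_zero hζ0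
    have e1 : pt 0 ζ⁻¹ = pt 1 ζ := by rw [← pt_inv hz0, inv_inv]
    have h1 := hbc (pt 0 ζ⁻¹) q (pt 0 ζ⁻¹) ⟨(hU _).2, by rw [e1]; exact hζ.1⟩
    simp only [standardCocycle, hci, hq] at h1
    have h2 : f (pt 0 ζ⁻¹) + b (pt 0 ζ⁻¹) (pt 0 ζ⁻¹) = b q (pt 0 ζ⁻¹) := by
      rw [← sub_eq_zero]
      simpa [sub_eq_zero, eq_sub_iff_add_eq] using h1
    have h3 := frameCoord_one_inv (b q) hz0 x
    rw [inv_inv] at h3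
    have h4 : affVec 0 ζ⁻¹ = ζ⁻¹ • affVec 1 ζ := by
      ext j
      fin_cases j
      · simp [affVec_zero_zero, affVec_one_zero, hζ0]
      · simp [affVec_zero_one, affVec_one_one]
    simp only [E, g]
    rw [← Pi.add_apply, ← map_add, h2, h3, h4, eval_smul_binForm P.2]
    have h5 : ζ⁻¹ ^ (-2 - n x.1) = ζ ^ 2 * ζ⁻¹ ^ (-n x.1) := by
      rw [sub_eq_add_neg, zpow_add₀ hz0]
      congr 1
      rw [inv_zpow', neg_neg]
      rfl
    rw [h5]
    ring
  rw [serreResidue_eq]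
  have h1 : ∮ z in C(0, 1), frameCoord 0 (pt 0 z) (f (pt 0 z)) x * eval (affVec 0 z) P.1
      = (∮ z in C(0, 1), E z) - ∮ z in C(0, 1), g z * eval (affVec 0 z) P.1 := by
    have hgi : CircleIntegrable (fun z => g z * eval (affVec 0 z) P.1) 0 1 :=
      circleIntegrable_of_differentiableAt fun z _ => (hg z).mul (hP 0 z)
    rw [← circleIntegral.integral_sub (circleIntegrable_of_differentiableAt hE) hgi]
    congr 1
    funext z
    simp only [E]
    ring
  rw [h1, hE0, hgP, sub_zero, mul_zero]

/-- The monomial `X₀^(d-k) X₁^k` as an element of `ℂ[X₀,X₁]_d`. -/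
def binMonoForm (d : ℤ) (k : ℕ) : binForm d :=
  if h : k < (d + 1).toNat then ⟨binMono d k, binMono_mem h⟩ else 0

/-- Laurent polynomials with values in `⊕ O(n_i)^{s_i}`, given by their residues. -/
def laurentSection (Φ : DualForms n s) (p : P1) : SplitBundle n s p :=
  frameVec 0 p fun a => ∑ b ∈ Finset.range (-2 - n a.1 + 1).toNat,
    Φ a.1 a.2 (binMonoForm (-2 - n a.1) b) * affChart 0 p ^ (-(b : ℤ) - 1)

theorem frameCoord_laurentSection (Φ : DualForms n s) (z : ℂ) (a : Σ i, Fin (s i)) :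
    frameCoord 0 (pt 0 z) (laurentSection Φ (pt 0 z)) a
      = ∑ b ∈ Finset.range (-2 - n a.1 + 1).toNat,
        Φ a.1 a.2 (binMonoForm (-2 - n a.1) b) * z ^ (-(b : ℤ) - 1) := by
  rw [laurentSection, frameCoord_frameVec (pt_mem 0 z), affChart_pt]

theorem isHolSection_laurentSection (Φ : DualForms n s) :
    IsHolSection 𝔽 (laurentSection Φ) (coordOpen 0 ∩ coordOpen 1) := by
  refine (isHolSection_iff ((isOpen_coordOpen 0).inter (isOpen_coordOpen 1))
    Set.inter_subset_left).2 fun a => ?_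
  simp only [frameCoord_laurentSection]
  refine DifferentiableOn.fun_sum fun b _ => DifferentiableOn.const_mul (fun z hz => ?_) _
  exact (differentiableAt_zpow.2 (Or.inl (pt_zero_mem_one.1 hz.2))).differentiableWithinAt

/-- The term z^(-b-1) pairs to 1 with the monomial z^b and to 0 with every other power, so the
chosen Laurent coefficients are the values of Φ on the monomials. -/
theorem serreResidue_laurentSection (Φ : DualForms n s) (x : Σ i, Fin (s i))
    (P : binForm (-2 - n x.1)) : serreResidue n s (laurentSection Φ) x P = Φ x.1 x.2 P := by
  have hP : P = ∑ k ∈ Finset.range (-2 - n x.1 + 1).toNat,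
      coeff (binExp (-2 - n x.1) k) P.1 • binMonoForm (-2 - n x.1) k := by
    refine Subtype.ext ?_
    rw [AddSubmonoidClass.coe_finsetSum]
    conv_lhs => rw [binForm_eq_sum P.2]
    refine Finset.sum_congr rfl fun k hk => ?_
    rw [binMonoForm, dif_pos (Finset.mem_range.1 hk)]
    rfl
  rw [serreResidue_eq]
  have h1 : Set.EqOn (fun z => frameCoord 0 (pt 0 z) (laurentSection Φ (pt 0 z)) x
        * eval (affVec 0 z) P.1)
      (fun z => ∑ b ∈ Finset.range (-2 - n x.1 + 1).toNat,
        ∑ k ∈ Finset.range (-2 - n x.1 + 1).toNat,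
        (Φ x.1 x.2 (binMonoForm (-2 - n x.1) b) * coeff (binExp (-2 - n x.1) k) P.1) *
          z ^ ((k : ℤ) - b - 1))
      (Metric.sphere 0 1) := fun z hz => by
    have hz0 : z ≠ 0 := fun h0 => by simp [h0] at hz
    simp only
    rw [frameCoord_laurentSection, eval_binForm P.2, Finset.sum_mul_sum]
    refine Finset.sum_congr rfl fun b _ => Finset.sum_congr rfl fun k _ => ?_
    have : z ^ ((k : ℤ) - b - 1) = z ^ (-(b : ℤ) - 1) * z ^ k := by
      rw [← zpow_natCast, ← zpow_add₀ hz0]; congr 1; ring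
    rw [this]; ring
  have hci (b k : ℕ) : CircleIntegrable (fun z : ℂ =>
      (Φ x.1 x.2 (binMonoForm (-2 - n x.1) b) * coeff (binExp (-2 - n x.1) k) P.1) *
          z ^ ((k : ℤ) - b - 1)) 0 1 :=
    circleIntegrable_of_differentiableAt fun z hz =>
      (differentiableAt_zpow.2 (Or.inl hz)).const_mul _
  rw [circleIntegral.integral_congr zero_le_one h1,
    circleIntegral.integral_fun_sum fun b _ => by
      simpa only [Finset.sum_fn] using CircleIntegrable.sum _ fun k _ => hci b k]
  have h2 (b : ℕ) (hb : b ∈ Finset.range (-2 - n x.1 + 1).toNat) :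
      (∮ z in C(0, 1), ∑ k ∈ Finset.range (-2 - n x.1 + 1).toNat,
        (Φ x.1 x.2 (binMonoForm (-2 - n x.1) b) * coeff (binExp (-2 - n x.1) k) P.1) *
          z ^ ((k : ℤ) - b - 1))
      = (2 * Real.pi * I) *
          (coeff (binExp (-2 - n x.1) b) P.1 * Φ x.1 x.2 (binMonoForm (-2 - n x.1) b)) := by
    rw [circleIntegral.integral_fun_sum fun k _ => hci b k, Finset.sum_eq_single b]
    · rw [circleIntegral.integral_const_mul, circleIntegral_zpow, if_pos (by ring)]
      ring
    · intro k _ hk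
      rw [circleIntegral.integral_const_mul, circleIntegral_zpow,
        if_neg (fun h => hk (by omega)), mul_zero]
    · exact fun h => absurd hb h
  rw [Finset.sum_congr rfl h2, ← Finset.mul_sum, inv_mul_cancel_left₀ Complex.two_pi_I_ne_zero]
  conv_rhs => rw [hP, map_sum]
  exact Finset.sum_congr rfl fun k _ => by rw [map_smul, smul_eq_mul]

end Residues

/-! ### Laurent representatives of classes and Serre duality -/

section SerreDuality
variable {m : ℕ} {n : Fin m → ℤ} {s : Fin m → ℕ}

local notation "𝔽" => ((Σ i, Fin (s i)) → ℂ)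

/-- Holomorphic splittings of a cocycle over the two discs `|X₁| < 2|X₀|` and `|X₀| < 2|X₁|`. -/
theorem exists_split_on_disc {c : P1 → P1 → ∀ p, SplitBundle n s p} {U : P1 → Set P1}
    (hU : IsNhdCover U) (hc : ∀ x y, IsHolSection 𝔽 (c x y) (U x ∩ U y))
    (hcc : ∀ x y z, ∀ p ∈ U x ∩ U y ∩ U z, c x z p = c x y p + c y z p) (k : Fin 2)
    (a : Σ i, Fin (s i)) : ∃ b : P1 → ℂ → ℂ,
      (∀ x, DifferentiableOn ℂ (b x) (pt k ⁻¹' U x ∩ Metric.ball 0 2)) ∧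
      ∀ x y, ∀ z, pt k z ∈ U x → pt k z ∈ U y →
        frameCoord k (pt k z) (c x y (pt k z)) a = b y z - b x z := by
  obtain ⟨b, hb, hbc⟩ := exists_split_of_cocycle (fun x => pt k ⁻¹' U x)
    (fun x => (hU x).1.preimage (continuous_pt k)) (fun z => ⟨pt k z, (hU _).2⟩)
    (fun x y z => frameCoord k (pt k z) (c x y (pt k z)) a)
    (fun x y => by
      have h := (isHolSection_iff (((hU x).1.inter (hU y).1).inter (isOpen_coordOpen k))
        Set.inter_subset_right).1 ((hc x y).mono Set.inter_subset_left) a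
      refine h.mono fun z hz => ⟨hz, pt_mem k z⟩)
    (fun x y w z hz => by
      rw [← Pi.add_apply, ← map_add, ← hcc x y w _ hz]) two_pos
  exact ⟨b, hb, fun x y z hx hy => hbc x y z ⟨hx, hy⟩⟩

theorem inv_mem_ball {z : ℂ} (hz : 1 / 2 < ‖z‖) : z⁻¹ ∈ Metric.ball (0 : ℂ) 2 := by
  rw [mem_ball_zero_iff, norm_inv]
  exact inv_lt_of_inv_lt₀ two_pos (by simpa using hz)

theorem ne_zero_of_half_lt {z : ℂ} (hz : 1 / 2 < ‖z‖) : z ≠ 0 :=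
  norm_pos_iff.1 (lt_trans (by norm_num) hz)

theorem differentiableAt_zpow_mul_comp_inv {g : ℂ → ℂ} {z : ℂ} (n : ℤ) (hz : z ≠ 0)
    (hg : DifferentiableAt ℂ g z⁻¹) : DifferentiableAt ℂ (fun w => w ^ n * g w⁻¹) z :=
  (differentiableAt_zpow.2 (Or.inl hz)).mul (hg.comp z (differentiableAt_inv hz))

/-- Splittings that differ by a Laurent polynomial. -/
theorem exists_split_laurent {c : P1 → P1 → ∀ p, SplitBundle n s p} {U : P1 → Set P1}
    (hU : IsNhdCover U) (hc : ∀ x y, IsHolSection 𝔽 (c x y) (U x ∩ U y))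
    (hcc : ∀ x y z, ∀ p ∈ U x ∩ U y ∩ U z, c x z p = c x y p + c y z p)
    (a : Σ i, Fin (s i)) : ∃ (b : Fin 2 → P1 → ℂ → ℂ) (h : ℕ → ℂ),
      (∀ k x, DifferentiableOn ℂ (b k x) (pt k ⁻¹' U x ∩ Metric.ball 0 2)) ∧
      (∀ k x y z, pt k z ∈ U x → pt k z ∈ U y →
        frameCoord k (pt k z) (c x y (pt k z)) a = b k y z - b k x z) ∧
      ∀ x z, pt 0 z ∈ U x → 1 / 2 < ‖z‖ → ‖z‖ < 2 → b 0 x z = z ^ n a.1 * b 1 x z⁻¹ +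
        ∑ b ∈ Finset.range (-2 - n a.1 + 1).toNat, h b * z ^ (-(b : ℤ) - 1) := by
  choose b hb hbc using fun k => exists_split_on_disc hU hc hcc k a
  have hU' (k : Fin 2) (x : P1) := (hU x).1.preimage (continuous_pt k)
  -- Both splittings have the same differences in x, so their discrepancy is independent of x and
  -- the index `pt 0 z` is only a convenient choice.
  let F : ℂ → ℂ := fun z => b 0 (pt 0 z) z - z ^ n a.1 * b 1 (pt 0 z) z⁻¹
  have hF (x : P1) (z : ℂ) (hx : pt 0 z ∈ U x) (hz : z ≠ 0) :
      F z = b 0 x z - z ^ n a.1 * b 1 x z⁻¹ := by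
    have h0 := hbc 0 x (pt 0 z) z hx (hU _).2
    have h1 := hbc 1 x (pt 0 z) z⁻¹ (by rwa [pt_inv hz]) (by rw [pt_inv hz]; exact (hU _).2)
    rw [frameCoord_one_inv _ hz, h0, zpow_neg, inv_mul_eq_iff_eq_mul₀ (zpow_ne_zero _ hz)] at h1
    simp only [F]
    linear_combination h1
  have hFd : DifferentiableOn ℂ F {z | 1 / 2 < ‖z‖ ∧ ‖z‖ < 2} := by
    intro z hz
    have hz0 := ne_zero_of_half_lt hz.1
    refine DifferentiableAt.differentiableWithinAt ?_
    have hd0 := (hb 0 (pt 0 z)).differentiableAt (((hU' 0 _).inter Metric.isOpen_ball).mem_nhds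
      ⟨(hU (pt 0 z)).2, mem_ball_zero_iff.2 hz.2⟩)
    have hd1 := (hb 1 (pt 0 z)).differentiableAt (((hU' 1 _).inter Metric.isOpen_ball).mem_nhds
      (show z⁻¹ ∈ _ from ⟨by
        rw [Set.mem_preimage, pt_inv hz0]; exact (hU _).2, inv_mem_ball hz.1⟩))
    refine (hd0.sub (differentiableAt_zpow_mul_comp_inv (n a.1) hz0 hd1)).congr_of_eventuallyEq ?_
    filter_upwards [(hU' 0 (pt 0 z)).mem_nhds (hU (pt 0 z)).2, isOpen_ne.mem_nhds hz0] with w hw hw0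
      using hF _ w hw hw0
  obtain ⟨F₀, G, h, hF₀, hG, hFG⟩ := exists_laurent_split_zpow hFd (n a.1)
  -- Functions independent of x can be moved into a splitting without affecting its differences;
  -- this removes F₀ and z^n G(1/z) from F.
  let e : Fin 2 → ℂ → ℂ := ![F₀, fun ζ => -G ζ]
  have he (k : Fin 2) : DifferentiableOn ℂ (e k) (Metric.ball 0 2) := by
    fin_cases k
    · exact hF₀
    · exact hG.neg
  refine ⟨fun k x z => b k x z - e k z, h,
    fun k x => (hb k x).sub ((he k).mono Set.inter_subset_right), fun k x y z hx hy => ?_,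
    fun x z hx hz1 hz2 => ?_⟩
  · rw [hbc k x y z hx hy]; ring
  · have h1 := hF x z hx (ne_zero_of_half_lt hz1)
    rw [hFG z hz1 hz2] at h1
    simp only [e, Matrix.cons_val_zero, Matrix.cons_val_one]
    linear_combination -h1

theorem isOpen_affChart_lt (k : Fin 2) :
    IsOpen (coordOpen k ∩ affChart k ⁻¹' Metric.ball (0 : ℂ) 2) :=
  (affChart k).isOpen_inter_preimage Metric.isOpen_ball

/-- Every cocycle is cohomologous to a Laurent polynomial on `U₀ ∩ U₁`. -/
theorem exists_laurentSection {c : P1 → P1 → ∀ p, SplitBundle n s p}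
    (hc : c ∈ cocycles 𝔽 (SplitBundle n s)) :
    ∃ Φ : DualForms n s, c - standardCocycle n s (laurentSection Φ)
      ∈ coboundaries 𝔽 (SplitBundle n s) := by
  obtain ⟨U, hU, hc, hcc⟩ := hc
  choose b h hb hbc hbh using fun a => exists_split_laurent hU hc hcc a
  have hU' (k : Fin 2) (x : P1) := (hU x).1.preimage (continuous_pt k)
  -- Coefficient functionals weighted by h, so that the k-th monomial has value `h ⟨i, a⟩ k`.
  let Φ : DualForms n s := fun i a =>
    ∑ k ∈ Finset.range (-2 - n i + 1).toNat,
      h ⟨i, a⟩ k • (lcoeff ℂ (binExp (-2 - n i) k)).comp (binForm (-2 - n i)).subtype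
  have hΦ (a : Σ i, Fin (s i)) (k : ℕ) (hk : k ∈ Finset.range (-2 - n a.1 + 1).toNat) :
      Φ a.1 a.2 (binMonoForm (-2 - n a.1) k) = h a k := by
    simp only [Φ, LinearMap.sum_apply]
    rw [Finset.sum_eq_single k]
    · rw [binMonoForm, dif_pos (Finset.mem_range.1 hk)]
      simp [binMono, lcoeff]
    · intro l _ hl
      rw [binMonoForm, dif_pos (Finset.mem_range.1 hk)]
      have : binExp (-2 - n a.1) k ≠ binExp (-2 - n a.1) l := fun h => hl (by
        rw [← binExp_one (-2 - n a.1) l, ← h, binExp_one])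
      simp [binMono, lcoeff, coeff_monomial, this]
    · exact fun h => absurd hk h
  let q : (Σ i, Fin (s i)) → ℂ → ℂ := fun a z =>
    ∑ k ∈ Finset.range (-2 - n a.1 + 1).toNat, h a k * z ^ (-(k : ℤ) - 1)
  have hq (z : ℂ) (a : Σ i, Fin (s i)) :
      frameCoord 0 (pt 0 z) (laurentSection Φ (pt 0 z)) a = q a z := by
    rw [frameCoord_laurentSection]
    exact Finset.sum_congr rfl fun k hk => by rw [hΦ a k hk]
  have hqd (a : Σ i, Fin (s i)) (z : ℂ) (hz : z ≠ 0) : DifferentiableAt ℂ (q a) z :=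
    DifferentiableAt.fun_sum fun k _ =>
      (differentiableAt_zpow.2 (Or.inl hz)).const_mul _
  -- coordinates of the splitting over `X₀ ≠ 0`
  let C : P1 → ℂ → (Σ i, Fin (s i)) → ℂ := fun x z a =>
    if ‖z‖ < 2 then b a 0 x z else z ^ n a.1 * b a 1 x z⁻¹ + q a z
  -- The two branches of C agree for 1/2 < |z| < 2, so C is holomorphic across |z| = 2.
  have hC (x : P1) (z : ℂ) (hx : pt 0 z ∈ U x) (hz : 1 / 2 < ‖z‖) (a : Σ i, Fin (s i)) :
      C x z a = z ^ n a.1 * b a 1 x z⁻¹ + q a z := by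
    simp only [C]
    split_ifs with h2
    · exact hbh a x z hx hz h2
    · rfl
  have hCd (x : P1) (z : ℂ) (hx : pt 0 z ∈ U x) (a : Σ i, Fin (s i)) :
      DifferentiableAt ℂ (fun w => C x w a) z := by
    by_cases hz : ‖z‖ < 2
    · have hnh := ((hU' 0 x).inter Metric.isOpen_ball).mem_nhds
        (show z ∈ _ from ⟨hx, mem_ball_zero_iff.2 hz⟩)
      refine ((hb a 0 x).differentiableAt hnh).congr_of_eventuallyEq ?_
      filter_upwards [hnh] with w hw
      simp only [C, if_pos (mem_ball_zero_iff.1 hw.2)]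
    · have hz1 : 1 / 2 < ‖z‖ := by linarith
      have hz0 := ne_zero_of_half_lt hz1
      have hd1 := (hb a 1 x).differentiableAt (((hU' 1 _).inter Metric.isOpen_ball).mem_nhds
        (show z⁻¹ ∈ _ from ⟨by rwa [Set.mem_preimage, pt_inv hz0], inv_mem_ball hz1⟩))
      refine ((differentiableAt_zpow_mul_comp_inv (n a.1) hz0 hd1).add
        (hqd a z hz0)).congr_of_eventuallyEq ?_
      filter_upwards [(hU' 0 x).mem_nhds hx,
        (isOpen_lt continuous_const continuous_norm).mem_nhds hz1] with w hw hw1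
        using hC x w hw hw1 a
  have hcC (x y : P1) (z : ℂ) (hx : pt 0 z ∈ U x) (hy : pt 0 z ∈ U y) (a : Σ i, Fin (s i)) :
      frameCoord 0 (pt 0 z) (c x y (pt 0 z)) a = C y z a - C x z a := by
    by_cases hz : ‖z‖ < 2
    · simp only [C, if_pos hz]
      exact hbc a 0 x y z hx hy
    · have hz1 : 1 / 2 < ‖z‖ := by linarith
      have hz0 := ne_zero_of_half_lt hz1
      have h1 := hbc a 1 x y z⁻¹ (by rwa [pt_inv hz0]) (by rwa [pt_inv hz0])
      rw [frameCoord_one_inv _ hz0, zpow_neg, inv_mul_eq_iff_eq_mul₀ (zpow_ne_zero _ hz0)] at h1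
      rw [h1, hC x z hx hz1, hC y z hy hz1]
      ring
  let B : P1 → ∀ p, SplitBundle n s p := fun x p =>
    if chartIndex x = 0 then frameVec 0 p (C x (affChart 0 p))
    else frameVec 1 p fun a => b a 1 x (affChart 1 p)
  -- The only point of chart index 1 is infinity. Its splitting is holomorphic only on the disc |ζ|
  -- < 2, and its neighbourhood is shrunk accordingly.
  let V : P1 → Set P1 := fun x => if chartIndex x = 0 then U x ∩ coordOpen 0
    else U x ∩ (coordOpen 1 ∩ affChart 1 ⁻¹' Metric.ball (0 : ℂ) 2)
  have hVU (x p : P1) (hp : p ∈ V x) : p ∈ U x := by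
    simp only [V] at hp
    split_ifs at hp <;> exact hp.1
  have hV0 (x : P1) (hx : chartIndex x = 0) : V x = U x ∩ coordOpen 0 := if_pos hx
  have hV1 (x : P1) (hx : chartIndex x ≠ 0) :
    V x = U x ∩ (coordOpen 1 ∩ affChart 1 ⁻¹' Metric.ball (0 : ℂ) 2) := if_neg hx
  -- Compared with C the section at infinity lacks q; this defect is exactly the standard cocycle
  -- subtracted from c.
  have hB1 (x : P1) (hx : chartIndex x ≠ 0) (z : ℂ) (hz : pt 0 z ∈ V x) (a : Σ i, Fin (s i)) :
      frameCoord 0 (pt 0 z) (B x (pt 0 z)) a = C x z a - q a z := by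
    rw [hV1 x hx] at hz
    have hz0 : z ≠ 0 := pt_zero_mem_one.1 hz.2.1
    have h1 : affChart 1 (pt 0 z) = z⁻¹ := by rw [← pt_inv hz0, affChart_pt]
    have h2 : ‖z⁻¹‖ < 2 := by
      have := hz.2.2
      rwa [Set.mem_preimage, h1, mem_ball_zero_iff] at this
    have h3 : 1 / 2 < ‖z‖ := by
      rw [norm_inv] at h2
      rw [one_div]
      exact inv_lt_of_inv_lt₀ (norm_pos_iff.2 hz0) h2
    rw [hC x z hz.1 h3]
    simp only [B, if_neg hx]
    rw [frameCoord_change hz.2.1, frameCoord_frameVec hz.2.1, h1, ratio_pt, affVec_zero_zero,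
      affVec_zero_one, div_one]
    ring
  have hB0 (x : P1) (hx : chartIndex x = 0) (z : ℂ) (a : Σ i, Fin (s i)) :
      frameCoord 0 (pt 0 z) (B x (pt 0 z)) a = C x z a := by
    simp only [B, if_pos hx]
    rw [frameCoord_frameVec (pt_mem 0 z), affChart_pt]
  refine ⟨Φ, V, B, fun x => ?_, fun x => ?_, fun x y p hp => ?_⟩
  · by_cases hx : chartIndex x = 0
    · rw [hV0 x hx]
      exact ⟨(hU x).1.inter (isOpen_coordOpen 0), (hU x).2, chartIndex_eq_zero.1 hx⟩
    · rw [hV1 x hx]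
      refine ⟨(hU x).1.inter (isOpen_affChart_lt 1), (hU x).2, ?_⟩
      have hx' : x ∉ coordOpen 0 := fun h => hx (chartIndex_eq_zero.2 h)
      refine ⟨mem_coordOpen_one_of_notMem hx', ?_⟩
      rw [Set.mem_preimage, eq_pt_one_zero hx', affChart_pt]
      exact Metric.mem_ball_self two_pos
  · by_cases hx : chartIndex x = 0
    · rw [hV0 x hx]
      refine (isHolSection_iff ((hU x).1.inter (isOpen_coordOpen 0)) Set.inter_subset_right).2
        fun a z hz => ?_
      simp only [hB0 x hx]
      exact (hCd x z hz.1 a).differentiableWithinAt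
    · rw [hV1 x hx]
      refine (isHolSection_iff ((hU x).1.inter (isOpen_affChart_lt 1))
        (Set.inter_subset_right.trans Set.inter_subset_left)).2 fun a => ?_
      simp only [B, if_neg hx, frameCoord_frameVec (pt_mem 1 _), affChart_pt]
      refine (hb a 1 x).mono fun ζ hζ => ⟨hζ.1, ?_⟩
      have := hζ.2.2
      rwa [Set.mem_preimage, affChart_pt] at this
  · by_cases hp0 : p ∈ coordOpen 0
    · obtain ⟨z, rfl⟩ : ∃ z, p = pt 0 z := ⟨_, (pt_affChart hp0).symm⟩
      refine frameCoord_injective (pt_mem 0 z) (funext fun a => ?_)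
      have h1 := hcC x y z (hVU x _ hp.1) (hVU y _ hp.2) a
      simp only [Pi.sub_apply, map_sub]
      rw [h1]
      have hne (w : P1) (hw : chartIndex w ≠ 0) : chartIndex w = 1 := by
        revert hw; generalize chartIndex w = k; fin_cases k <;> simp
      by_cases hx : chartIndex x = 0 <;> by_cases hy : chartIndex y = 0
      · rw [hB0 x hx, hB0 y hy]
        simp [standardCocycle, hx, hy]
      · rw [hB0 x hx, hB1 y hy z hp.2]
        simp only [standardCocycle, hx, hne y hy, and_self, if_true, hq]
        ring
      · rw [hB1 x hx z hp.1, hB0 y hy]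
        simp [standardCocycle, hne x hx, hy, hq]
        ring
      · rw [hB1 x hx z hp.1, hB1 y hy z hp.2]
        simp [standardCocycle, hne x hx, hne y hy]
    · have hne (w : P1) (hw : p ∈ V w) : chartIndex w ≠ 0 := fun h => by
        rw [hV0 w h] at hw; exact hp0 hw.2
      have hx := hne x hp.1
      have hy := hne y hp.2
      have hxU := hVU x _ hp.1
      have hyU := hVU y _ hp.2
      obtain rfl := eq_pt_one_zero hp0
      refine frameCoord_injective (pt_mem 1 0) (funext fun a => ?_)
      have h1 := hbc a 1 x y 0 hxU hyU
      simp only [Pi.sub_apply, map_sub, B, if_neg hx, if_neg hy, frameCoord_frameVec (pt_mem 1 _),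
        affChart_pt, h1]
      simp [standardCocycle, hx, hy]

variable (n s) in
/-- The class of a Laurent polynomial, as a linear map. -/
def laurentClass : DualForms n s →ₗ[ℂ] H1 𝔽 (SplitBundle n s) where
  toFun Φ := standardClass n s (isHolSection_laurentSection Φ)
  map_add' Φ Ψ := by
    refine (H1.mk_eq_mk (hd := Submodule.add_mem _
      (standardCocycle_mem n s (isHolSection_laurentSection Φ))
      (standardCocycle_mem n s (isHolSection_laurentSection Ψ)))).2 ?_
    have h : laurentSection (Φ + Ψ) = laurentSection Φ + laurentSection Ψ := by
      funext p
      rw [Pi.add_apply, laurentSection, laurentSection, laurentSection, ← map_add]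
      congr 1
      funext a
      rw [Pi.add_apply, ← Finset.sum_add_distrib]
      exact Finset.sum_congr rfl fun b _ => add_mul _ _ _
    have h2 : standardCocycle n s (laurentSection (Φ + Ψ))
        = standardCocycle n s (laurentSection Φ) + standardCocycle n s (laurentSection Ψ) := by
      funext x y p
      simp only [Pi.add_apply, standardCocycle, h]
      split_ifs
      · rfl
      · exact neg_add _ _
      · exact (add_zero _).symm
    rw [h2, sub_self]
    exact zero_mem _
  map_smul' r Φ := by
    refine (H1.mk_eq_mk (hd := Submodule.smul_mem _ r
      (standardCocycle_mem n s (isHolSection_laurentSection Φ)))).2 ?_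
    have h : laurentSection (r • Φ) = r • laurentSection Φ := by
      funext p
      rw [Pi.smul_apply, laurentSection, laurentSection, ← map_smul]
      congr 1
      funext a
      rw [Pi.smul_apply, Finset.smul_sum]
      exact Finset.sum_congr rfl fun b _ => mul_assoc _ _ _
    have h2 : standardCocycle n s (laurentSection (r • Φ))
        = r • standardCocycle n s (laurentSection Φ) := by
      funext x y p
      simp only [Pi.smul_apply, standardCocycle, h]
      split_ifs
      · rfl
      · exact (smul_neg _ _).symm
      · exact (smul_zero _).symm
    rw [h2]
    exact (sub_self (r • standardCocycle n s (laurentSection Φ))) ▸ zero_mem _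

/-- Residues depend only on the class, by `serreResidue_eq_zero` for f - g. -/
theorem serreResidue_eq_of_standardClass_eq {f g : ∀ p, SplitBundle n s p}
    (hf : IsHolSection 𝔽 f (coordOpen 0 ∩ coordOpen 1))
    (hg : IsHolSection 𝔽 g (coordOpen 0 ∩ coordOpen 1))
    (h : standardClass n s hf = standardClass n s hg) (x : Σ i, Fin (s i))
    (P : binForm (-2 - n x.1)) : serreResidue n s f x P = serreResidue n s g x P := by
  rw [← sub_eq_zero, ← serreResidue_sub hf hg]
  refine serreResidue_eq_zero (ContMDiffOn.sub_section hf hg) ?_ x P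
  have h1 := H1.mk_eq_mk.1 h
  convert h1 using 1
  funext x y p
  simp only [Pi.sub_apply, standardCocycle]
  split_ifs
  · rfl
  · abel
  · exact (sub_zero _).symm

theorem laurentClass_surjective : Function.Surjective (laurentClass n s) := fun h => by
  obtain ⟨c, hc, rfl⟩ := H1.exists_mk h
  obtain ⟨Φ, hΦ⟩ := exists_laurentSection hc
  exact ⟨Φ, (H1.mk_eq_mk.2 hΦ).symm⟩

theorem laurentClass_injective : Function.Injective (laurentClass n s) := fun Φ Ψ h => by
  funext i a
  refine LinearMap.ext fun P => ?_
  rw [← serreResidue_laurentSection Φ ⟨i, a⟩ P, ← serreResidue_laurentSection Ψ ⟨i, a⟩ P]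
  exact serreResidue_eq_of_standardClass_eq (isHolSection_laurentSection Φ)
    (isHolSection_laurentSection Ψ) h _ _

variable (n s) in
/-- Serre duality for `⊕ O(n_i)^{s_i}`. -/
def serreDuality : H1 𝔽 (SplitBundle n s) ≃ₗ[ℂ] DualForms n s :=
  (LinearEquiv.ofBijective (laurentClass n s)
    ⟨laurentClass_injective, laurentClass_surjective⟩).symm

/-- S is defined as the inverse of `laurentClass`. An arbitrary f has the class of some Laurent
section, for which the formula is known, and residues depend only on the class. -/
theorem serreDuality_standardClass {f : ∀ p, SplitBundle n s p}
    (hf : IsHolSection 𝔽 f (coordOpen 0 ∩ coordOpen 1)) (i : Fin m) (a : Fin (s i))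
    (P : binForm (-2 - n i)) :
    serreDuality n s (standardClass n s hf) i a P = serreResidue n s f ⟨i, a⟩ P := by
  obtain ⟨Φ, hΦ⟩ := laurentClass_surjective (standardClass n s hf)
  have h1 : serreDuality n s (standardClass n s hf) = Φ := by
    rw [serreDuality, LinearEquiv.symm_apply_eq]
    exact hΦ.symm
  rw [h1, ← serreResidue_laurentSection Φ ⟨i, a⟩ P]
  exact serreResidue_eq_of_standardClass_eq (isHolSection_laurentSection Φ) hf hΦ _ _

theorem exists_standardClass (h : H1 𝔽 (SplitBundle n s)) :
    ∃ (f : ∀ p, SplitBundle n s p) (hf : IsHolSection 𝔽 f (coordOpen 0 ∩ coordOpen 1)),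
      h = standardClass n s hf := by
  obtain ⟨Φ, rfl⟩ := laurentClass_surjective h
  exact ⟨_, isHolSection_laurentSection Φ, rfl⟩

theorem smul_standardClass (g : BundleAut 𝔽 (SplitBundle n s)) {f : ∀ p, SplitBundle n s p}
    (hf : IsHolSection 𝔽 f (coordOpen 0 ∩ coordOpen 1)) :
    g • standardClass n s hf = standardClass n s (g.isHolSection hf) := by
  have h : g.cochainMap (standardCocycle n s f)
      = standardCocycle n s (fun p => g.equiv p (f p)) := by
    funext x y p
    simp only [HolIso.cochainMap, LinearMap.coe_mk, AddHom.coe_mk, standardCocycle]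
    split_ifs
    · rfl
    · exact map_neg _ _
    · exact map_zero _
  refine (H1.mk_eq_mk (hc := g.map_cocycles _ (standardCocycle_mem n s hf))).2 ?_
  rw [h, sub_self]
  exact zero_mem _

/-- On a representative f the matrix multiplies f under the integral; each entry can be attached to
P instead, which is the transposed multiplication. -/
theorem serreDuality_smul (hn : StrictAnti n) (A : structGroup n s hn)
    (h : H1 𝔽 (SplitBundle n s)) (i : Fin m) :
    serreDuality n s (autEquiv s hn A • h) i
      = ∑ j, transposeMul A.1 i j (serreDuality n s h j) := by
  obtain ⟨f, hf, rfl⟩ := exists_standardClass h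
  funext a
  refine LinearMap.ext fun P => ?_
  rw [smul_standardClass, serreDuality_standardClass, Finset.sum_apply, LinearMap.sum_apply]
  simp only [transposeMul_apply, serreDuality_standardClass, serreResidue_eq]
  have hci (b : Σ i, Fin (s i)) : CircleIntegrable (fun z => frameCoord 0 (pt 0 z) (f (pt 0 z)) b *
      eval (affVec 0 z) (mulEntry A.1 ⟨i, a⟩ b P).1) 0 1 :=
    circleIntegrable_of_differentiableAt fun z hz =>
      (differentiableAt_frameCoord_zero hf b hz).mul (differentiable_eval_affVec _ 0 z)
  have hsum := (circleIntegral.integral_fun_sum (s := Finset.univ) fun b _ => hci b).symm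
  rw [Fintype.sum_sigma] at hsum
  simp only [← Finset.mul_sum]
  refine congrArg _ (Eq.trans ?_ hsum.symm)
  refine congrArg (fun g => circleIntegral g 0 1) (funext fun z => ?_)
  rw [autEquiv_apply, frameCoord_mulFiber _ (pt_mem 0 z), normVec_pt]
  simp only [Matrix.mulVec, dotProduct, Finset.sum_mul, evalMat, Matrix.map_apply]
  refine Finset.sum_congr rfl fun b _ => ?_
  have h1 : ((mulEntry A.1 ⟨i, a⟩ b P : binForm (-2 - n b.1)) : MvPolynomial (Fin 2) ℂ)
      = A.1.1 ⟨i, a⟩ b * P.1 := rfl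
  rw [h1, map_mul]
  ring

end SerreDuality

/-! ### Isomorphisms of affine bundles and their invariants -/

section AffineBundles
variable {X : Type} [TopologicalSpace X] [ChartedSpace ℂ X] {r : ℕ}

namespace AffBundle
variable (A B : AffBundle X r)

theorem contMDiffAt_triv (e : A.atlas) {a : A.Total} (ha : A.proj a ∈ e.1.baseSet) :
    ContMDiffAt 𝓘(ℂ, ℂ × (Fin r → ℂ)) (𝓘(ℂ).prod 𝓘(ℂ, Fin r → ℂ)) ω e.1 a :=
  (A.maximal.prop.hol e.1 e.2).1.contMDiffAt (e.1.open_source.mem_nhds (e.1.mem_source.2 ha))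

theorem contMDiffAt_triv_symm (e : A.atlas) {x : X} (hx : x ∈ e.1.baseSet) (v : Fin r → ℂ) :
    ContMDiffAt (𝓘(ℂ).prod 𝓘(ℂ, Fin r → ℂ)) 𝓘(ℂ, ℂ × (Fin r → ℂ)) ω
      e.1.toOpenPartialHomeomorph.symm (x, v) :=
  (A.maximal.prop.hol e.1 e.2).2.contMDiffAt (e.1.open_target.mem_nhds (e.1.mem_target.2 hx))

theorem triv_symm (e : A.atlas) {x : X} (hx : x ∈ e.1.baseSet) (v : Fin r → ℂ) :
    (e.1 (e.1.toOpenPartialHomeomorph.symm (x, v))).2 = v :=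
  A.transition_self hx v

theorem eq_of_triv_eq (e : A.atlas) {a b : A.Total} (ha : A.proj a ∈ e.1.baseSet)
    (hab : A.proj a = A.proj b) (h : (e.1 a).2 = (e.1 b).2) : a = b := by
  rw [← A.symm_triv ha rfl, h, A.symm_triv ha hab.symm]

/-- The coordinates of a translation of the fibre at `x` in a local trivialisation. -/
def linCoord (e : A.atlas) {x : X} (hx : x ∈ e.1.baseSet) : A.Lin x ≃ₗ[ℂ] (Fin r → ℂ) where
  toFun := A.linPart (A.trivAt x) e x
  map_add' := (A.linPart (A.trivAt x) e x).map_add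
  map_smul' := (A.linPart (A.trivAt x) e x).map_smul
  invFun := A.linPart e (A.trivAt x) x
  left_inv v := by
    have h := A.linCore.coordChange_comp (A.trivAt x) e (A.trivAt x) x
      ⟨⟨A.mem_trivAt x, hx⟩, A.mem_trivAt x⟩ v
    exact h.trans (A.linCore.coordChange_self _ _ (A.mem_trivAt x) _)
  right_inv v := by
    have h := A.linCore.coordChange_comp e (A.trivAt x) e x ⟨⟨hx, A.mem_trivAt x⟩, hx⟩ v
    exact h.trans (A.linCore.coordChange_self _ _ hx _)

theorem linCoord_diff (e : A.atlas) {x : X} (hx : x ∈ e.1.baseSet) {a b : A.Total}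
    (ha : A.proj a = x) (hb : A.proj b = x) :
    A.linCoord e hx (A.diff x b a) = (e.1 b).2 - (e.1 a).2 := by
  change A.linPart (A.trivAt x) e x (_ - _) = _
  rw [A.linPart_apply _ _ ⟨A.mem_trivAt x, hx⟩, A.transition_apply (A.mem_trivAt x) ha,
    A.transition_apply (A.mem_trivAt x) hb]

theorem diff_add_diff (x : X) (a b c : A.Total) :
    A.diff x c b + A.diff x b a = A.diff x c a := sub_add_sub_cancel _ _ _

theorem eq_of_diff_eq {a b c : A.Total} (hab : A.proj a = A.proj b)
    (h : A.diff (A.proj a) a c = A.diff (A.proj a) b c) : a = b :=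
  A.eq_of_triv_eq (A.trivAt _) (A.mem_trivAt _) hab (sub_left_injective h)

theorem diff_triv_symm (e : A.atlas) {x : X} (hx : x ∈ e.1.baseSet) (v w : Fin r → ℂ) :
    A.diff x (e.1.toOpenPartialHomeomorph.symm (x, v)) (e.1.toOpenPartialHomeomorph.symm (x, w))
      = (A.linCoord e hx).symm (v - w) := by
  rw [LinearEquiv.eq_symm_apply, A.linCoord_diff e hx (A.proj_symm hx _) (A.proj_symm hx _),
    A.triv_symm e hx, A.triv_symm e hx]

/-- A holomorphic family of translations given by differences of holomorphic points. -/
theorem contMDiffAt_diff {M : Type*} [TopologicalSpace M] {H E : Type*} [NormedAddCommGroup E]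
    [NormedSpace ℂ E] [TopologicalSpace H] {I : ModelWithCorners ℂ E H} [ChartedSpace H M]
    {f : M → X} {a b : M → A.Total} {y : M} (hf : ContMDiffAt I 𝓘(ℂ) ω f y)
    (ha : ContMDiffAt I 𝓘(ℂ, ℂ × (Fin r → ℂ)) ω a y)
    (hb : ContMDiffAt I 𝓘(ℂ, ℂ × (Fin r → ℂ)) ω b y)
    (hfa : ∀ᶠ z in 𝓝 y, A.proj (a z) = f z) (hfb : ∀ᶠ z in 𝓝 y, A.proj (b z) = f z) :
    ContMDiffAt I (𝓘(ℂ).prod 𝓘(ℂ, Fin r → ℂ)) ω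
      (fun z => TotalSpace.mk' (Fin r → ℂ) (E := A.Lin) (f z) (A.diff (f z) (b z) (a z))) y := by
  rw [contMDiffAt_totalSpace]
  refine ⟨hf, ?_⟩
  let e := A.trivAt (f y)
  have hy : f y ∈ e.1.baseSet := A.mem_trivAt _
  have h1 := contMDiffAt_snd.comp y ((A.contMDiffAt_triv e
    (by rw [hfb.self_of_nhds]; exact hy)).comp y hb)
  have h2 := contMDiffAt_snd.comp y ((A.contMDiffAt_triv e
    (by rw [hfa.self_of_nhds]; exact hy)).comp y ha)
  refine (h1.sub h2).congr_of_eventuallyEq ?_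
  filter_upwards [hfa, hfb, hf.continuousAt.preimage_mem_nhds (e.1.open_baseSet.mem_nhds hy)]
    with z hza hzb hz
  exact A.linCoord_diff e hz hza hzb

/-- The invariant of `A` is the class of the differences of any local holomorphic sections. -/
theorem hClass_eq_mk {U : X → Set X} (hU : IsNhdCover U) {σ : X → X → A.Total}
    (hσ : ∀ x, ContMDiffOn 𝓘(ℂ) 𝓘(ℂ, ℂ × (Fin r → ℂ)) ω (σ x) (U x))
    (hp : ∀ x, ∀ p ∈ U x, A.proj (σ x p) = p) {c : X → X → ∀ p, A.Lin p}
    (hc : c ∈ cocycles (Fin r → ℂ) A.Lin)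
    (h : ∀ x y, ∀ p ∈ U x ∩ U y, c x y p = A.diff p (σ y p) (σ x p)) :
    A.hClass = H1.mk _ c hc := by
  -- The translations from σ x to `localSection x` form the 0-cochain that bounds the difference of
  -- the two cocycles.
  refine H1.mk_eq_mk.2 ⟨fun x => U x ∩ (A.trivAt x).1.baseSet,
    fun x p => A.diff p (A.localSection x p) (σ x p),
    hU.inter fun x => ⟨(A.trivAt x).1.open_baseSet, A.mem_trivAt x⟩, fun x p hpx => ?_,
    fun x y p hpxy => ?_⟩
  · have hn := (hU x).1.mem_nhds hpx.1
    have hn' := (A.trivAt x).1.open_baseSet.mem_nhds hpx.2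
    refine (A.contMDiffAt_diff contMDiffAt_id ((hσ x).contMDiffAt hn)
      ((A.contMDiffAt_triv_symm (A.trivAt x) hpx.2 0).comp p
        (contMDiffAt_id.prodMk contMDiffAt_const)) ?_ ?_).contMDiffWithinAt
    · filter_upwards [hn] with q hq using hp x q hq
    · filter_upwards [hn'] with q hq using A.proj_symm hq 0
  · simp only [Pi.sub_apply, h x y p ⟨hpxy.1.1, hpxy.2.1⟩, diffCocycle, diff]
    abel

variable {A B}

/-- Fibre maps compatible with differences are holomorphic. -/
theorem contMDiff_of_map_diff {γ : A.Total → B.Total}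
    (hγ : ContMDiff 𝓘(ℂ, ℂ × (Fin r → ℂ)) 𝓘(ℂ, ℂ × (Fin r → ℂ)) ω γ)
    (hp : ∀ a, B.proj (γ a) = A.proj a) (φ : ∀ x, A.Lin x → B.Lin x)
    (hφ : ∀ a b, A.proj a = A.proj b →
      φ (A.proj a) (A.diff (A.proj a) b a) = B.diff (A.proj a) (γ b) (γ a)) :
    ContMDiff (𝓘(ℂ).prod 𝓘(ℂ, Fin r → ℂ)) (𝓘(ℂ).prod 𝓘(ℂ, Fin r → ℂ)) ω
      fun v : TotalSpace (Fin r → ℂ) A.Lin =>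
        TotalSpace.mk' (Fin r → ℂ) v.proj (φ v.proj v.snd) := by
  refine contMDiff_fiberMap A.linCore B.linCore φ fun x => ?_
  let e := A.trivAt x
  let e' := B.trivAt x
  have hx : x ∈ e.1.baseSet := A.mem_trivAt x
  have hx' : x ∈ e'.1.baseSet := B.mem_trivAt x
  have key (q : X × (Fin r → ℂ) → X × (Fin r → ℂ)) (w : Fin r → ℂ) (hqx : (q (x, w)).1 = x)
      (hq : ContMDiffAt (𝓘(ℂ).prod 𝓘(ℂ, Fin r → ℂ)) (𝓘(ℂ).prod 𝓘(ℂ, Fin r → ℂ)) ω q (x, w)) :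
      ContMDiffAt (𝓘(ℂ).prod 𝓘(ℂ, Fin r → ℂ)) 𝓘(ℂ, Fin r → ℂ) ω
        (fun u => (e'.1 (γ (e.1.toOpenPartialHomeomorph.symm (q u)))).2) (x, w) := by
    have h1 : ContMDiffAt (𝓘(ℂ).prod 𝓘(ℂ, Fin r → ℂ)) 𝓘(ℂ, ℂ × (Fin r → ℂ)) ω
        e.1.toOpenPartialHomeomorph.symm (q (x, w)) :=
      A.contMDiffAt_triv_symm e (by rw [hqx]; exact hx) (q (x, w)).2
    refine contMDiffAt_snd.comp (x, w) ((B.contMDiffAt_triv e' ?_).comp (x, w)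
      ((hγ _).comp (x, w) (h1.comp (x, w) hq)))
    have h2 : A.proj (e.1.toOpenPartialHomeomorph.symm (q (x, w))) = (q (x, w)).1 :=
      A.proj_symm (by rw [hqx]; exact hx) (q (x, w)).2
    simp only [hp]
    rw [h2, hqx]; exact hx'
  -- A translation with coordinate w moves the point with coordinate 0 to the one with coordinate w;
  -- its image is the difference of their images under γ.
  refine ⟨e, e', hx, hx', fun u => (e'.1 (γ (e.1.toOpenPartialHomeomorph.symm u))).2 -
    (e'.1 (γ (e.1.toOpenPartialHomeomorph.symm (u.1, 0)))).2, fun w => ?_, ?_⟩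
  · exact (key id w rfl contMDiffAt_id).sub
      (key (fun u => (u.1, 0)) w rfl (contMDiffAt_fst.prodMk contMDiffAt_const))
  · filter_upwards [e.1.open_baseSet.mem_nhds hx, e'.1.open_baseSet.mem_nhds hx'] with p hpe hpe' v
    have h0 := A.proj_symm hpe (0 : Fin r → ℂ)
    have h1 := A.proj_symm hpe (A.linCoord e hpe v)
    have hv := hφ (e.1.toOpenPartialHomeomorph.symm (p, 0))
      (e.1.toOpenPartialHomeomorph.symm (p, A.linCoord e hpe v)) (h0.trans h1.symm)
    rw [h0, A.diff_triv_symm e hpe, sub_zero, LinearEquiv.symm_apply_apply] at hv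
    refine Eq.trans (congrArg (B.linCoord e' hpe') hv) ?_
    exact B.linCoord_diff e' hpe' ((hp _).trans h0) ((hp _).trans h1)

end AffBundle

open AffBundle

theorem exists_linear_of_affIsomorphic {A B : AffBundle X r} {γ : A.Total → B.Total}
    (hp : ∀ a, B.proj (γ a) = A.proj a)
    (h : ∀ e ∈ A.atlas, ∀ e' ∈ B.atlas, ∀ x ∈ e.baseSet ∩ e'.baseSet,
      ∃ f : (Fin r → ℂ) ≃ᵃ[ℂ] (Fin r → ℂ),
        ∀ v, (e' (γ (e.toOpenPartialHomeomorph.symm (x, v)))).2 = f v) (x : X) :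
    ∃ φ : A.Lin x ≃ₗ[ℂ] B.Lin x, ∀ a b, A.proj a = x → A.proj b = x →
      φ (A.diff x b a) = B.diff x (γ b) (γ a) := by
  obtain ⟨f, hf⟩ := h _ (A.trivAt x).2 _ (B.trivAt x).2 x ⟨A.mem_trivAt x, B.mem_trivAt x⟩
  refine ⟨(A.linCoord _ (A.mem_trivAt x)).trans
    (f.linear.trans (B.linCoord _ (B.mem_trivAt x)).symm), fun a b ha hb => ?_⟩
  have hf' (a : A.Total) (ha : A.proj a = x) :
      f ((A.trivAt x).1 a).2 = ((B.trivAt x).1 (γ a)).2 := by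
    rw [← hf, A.symm_triv (A.mem_trivAt x) ha]
  rw [LinearEquiv.trans_apply, LinearEquiv.trans_apply, LinearEquiv.symm_apply_eq,
    A.linCoord_diff _ _ ha hb, B.linCoord_diff _ _ ((hp _).trans ha) ((hp _).trans hb),
    ← hf' a ha, ← hf' b hb]
  exact f.toAffineMap.linearMap_vsub _ _

/-- An isomorphism of affine bundles carries the invariant to the invariant. -/
theorem AffIsomorphic.exists_holIso {A B : AffBundle X r} (h : AffIsomorphic A B) :
    ∃ θ : HolIso (Fin r → ℂ) A.Lin (Fin r → ℂ) B.Lin, θ.H1map A.hClass = B.hClass := by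
  obtain ⟨γ, hp, h⟩ := h
  choose φ hφ using exists_linear_of_affIsomorphic hp h
  have hp' (b : B.Total) : A.proj (γ.symm b) = B.proj b := by
    rw [← hp, Diffeomorph.apply_symm_apply]
  let θ : HolIso (Fin r → ℂ) A.Lin (Fin r → ℂ) B.Lin :=
    { equiv := φ
      hol := contMDiff_of_map_diff γ.contMDiff hp (fun x => φ x)
        fun a b hab => hφ _ a b rfl hab.symm
      hol_symm := contMDiff_of_map_diff γ.symm.contMDiff hp' (fun x => (φ x).symm)
        fun a b hab => by
          rw [LinearEquiv.symm_apply_eq, hφ _ _ _ (hp' a) ((hp' b).trans hab.symm),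
            Diffeomorph.apply_symm_apply, Diffeomorph.apply_symm_apply] }
  refine ⟨θ, (B.hClass_eq_mk (U := fun x => (A.trivAt x).1.baseSet)
    (fun x => ⟨(A.trivAt x).1.open_baseSet, A.mem_trivAt x⟩)
    (σ := fun x p => γ (A.localSection x p)) (fun x => ?_) (fun x p hpx => ?_)
    (θ.map_cocycles _ A.diffCocycle_mem) (fun x y p hpxy => ?_)).symm⟩
  · refine γ.contMDiff.comp_contMDiffOn fun p hpx => ?_
    exact ((A.contMDiffAt_triv_symm (A.trivAt x) hpx 0).comp p
        (contMDiffAt_id.prodMk contMDiffAt_const)).contMDiffWithinAt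
  · exact (hp _).trans (A.proj_symm hpx 0)
  · exact hφ p _ _ (A.proj_symm hpxy.1 0) (A.proj_symm hpxy.2 0)

/-- The affine map determined by a map of linearisations and a splitting of the difference of the
invariants. -/
theorem exists_affineMap {A B : AffBundle X r} (θ : HolIso (Fin r → ℂ) A.Lin (Fin r → ℂ) B.Lin)
    {U : X → Set X} (hU : IsNhdCover U) (hUA : ∀ x, U x ⊆ (A.trivAt x).1.baseSet)
    (hUB : ∀ x, U x ⊆ (B.trivAt x).1.baseSet) {b : X → ∀ p, B.Lin p}
    (hb : ∀ x, IsHolSection (Fin r → ℂ) (b x) (U x))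
    (h : ∀ x y, ∀ p ∈ U x ∩ U y,
      θ.equiv p (A.diffCocycle x y p) - B.diffCocycle x y p = b y p - b x p) :
    ∃ γ : A.Total → B.Total, ContMDiff 𝓘(ℂ, ℂ × (Fin r → ℂ)) 𝓘(ℂ, ℂ × (Fin r → ℂ)) ω γ ∧
      (∀ a, B.proj (γ a) = A.proj a) ∧ ∀ p, ∀ a, A.proj a = p → ∀ x, p ∈ U x →
        B.diff p (γ a) (B.localSection x p)
          = b x p + θ.equiv p (A.diff p a (A.localSection x p)) := by
  -- The value at a is prescribed through the index point `A.proj a`. By `h` the same description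
  -- holds through any x whose neighbourhood contains `A.proj a` (this is `key`), so x can be kept
  -- fixed when proving holomorphy.
  let γ : A.Total → B.Total := fun a => (B.trivAt (A.proj a)).1.toOpenPartialHomeomorph.symm
    (A.proj a, B.linCoord _ (B.mem_trivAt (A.proj a)) (b (A.proj a) (A.proj a)
      + θ.equiv _ (A.diff _ a (A.localSection (A.proj a) (A.proj a)))))
  have hp (a : A.Total) : B.proj (γ a) = A.proj a := B.proj_symm (B.mem_trivAt _) _
  have key (p : X) (a : A.Total) (ha : A.proj a = p) (x : X) (hx : p ∈ U x) :
      B.diff p (γ a) (B.localSection x p)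
        = b x p + θ.equiv p (A.diff p a (A.localSection x p)) := by
    subst ha
    have h1 : B.diff (A.proj a) (γ a) (B.localSection (A.proj a) (A.proj a))
        = b (A.proj a) (A.proj a)
          + θ.equiv _ (A.diff _ a (A.localSection (A.proj a) (A.proj a))) := by
      refine (B.diff_triv_symm (B.trivAt (A.proj a)) (B.mem_trivAt _) _ 0).trans ?_
      rw [sub_zero, LinearEquiv.symm_apply_apply]
    have h2 := h x (A.proj a) (A.proj a) ⟨hx, (hU _).2⟩
    rw [← B.diff_add_diff _ _ (B.localSection (A.proj a) (A.proj a)),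
      ← A.diff_add_diff _ _ (A.localSection (A.proj a) (A.proj a)) a, map_add, h1]
    simp only [diffCocycle] at h2
    rw [sub_eq_sub_iff_add_eq_add] at h2
    rw [add_right_comm, ← h2]
    abel
  refine ⟨γ, fun a => ?_, hp, key⟩
  let x := A.proj a
  let e := B.trivAt x
  have hUx := (hU x).1.mem_nhds (hU x).2
  have hproj : ContMDiffAt 𝓘(ℂ, ℂ × (Fin r → ℂ)) 𝓘(ℂ) ω A.proj a := A.proj_hol a
  have hev : ∀ᶠ c in 𝓝 a, A.proj c ∈ U x := hproj.continuousAt.preimage_mem_nhds hUx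
  have h1 : ContMDiffAt 𝓘(ℂ, ℂ × (Fin r → ℂ)) (𝓘(ℂ).prod 𝓘(ℂ, Fin r → ℂ)) ω
      (fun c => TotalSpace.mk' (Fin r → ℂ) (E := A.Lin) (A.proj c)
        (A.diff (A.proj c) c (A.localSection x (A.proj c)))) a := by
    refine A.contMDiffAt_diff hproj ((A.contMDiffAt_triv_symm (A.trivAt x)
      (A.mem_trivAt x) 0).comp a (hproj.prodMk contMDiffAt_const)) contMDiffAt_id ?_
      (.of_forall fun _ => rfl)
    filter_upwards [hev] with c hc using A.proj_symm (hUA x hc) 0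
  have h2 := (contMDiffAt_totalSpace.1 ((θ.hol _).comp a h1)).2
  have h3 := (contMDiffAt_totalSpace.1 ((((hb x).contMDiffAt hUx)).comp a hproj)).2
  have h4 := (B.contMDiffAt_triv_symm e (B.mem_trivAt x) _).comp a (hproj.prodMk (h3.add h2))
  refine h4.congr_of_eventuallyEq ?_
  filter_upwards [hev] with c hc
  have hc' := hUB x hc
  have h5 := congrArg (B.linCoord e hc') (key _ c rfl x hc)
  rw [B.linCoord_diff e hc' (a := B.localSection x (A.proj c)) (B.proj_symm hc' 0) (hp c),
    map_add] at h5
  have h6 : (e.1 (B.localSection x (A.proj c))).2 = 0 := B.triv_symm e hc' 0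
  rw [h6, sub_zero] at h5
  rw [← B.symm_triv hc' (hp c), h5]
  rfl

/-- Affine bundles whose invariants correspond under an isomorphism of linearisations are
isomorphic. -/
theorem affIsomorphic_of_H1map_eq {A B : AffBundle X r}
    (θ : HolIso (Fin r → ℂ) A.Lin (Fin r → ℂ) B.Lin) (h : θ.H1map A.hClass = B.hClass) :
    AffIsomorphic A B := by
  obtain ⟨V, b, hV, hb, h⟩ := (H1.mk_eq_mk (hc := θ.map_cocycles _ A.diffCocycle_mem)).1 h
  let U : X → Set X := fun x => V x ∩ ((A.trivAt x).1.baseSet ∩ (B.trivAt x).1.baseSet)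
  have hU : IsNhdCover U := hV.inter (IsNhdCover.inter
    (fun x => ⟨(A.trivAt x).1.open_baseSet, A.mem_trivAt x⟩)
    (fun x => ⟨(B.trivAt x).1.open_baseSet, B.mem_trivAt x⟩))
  have hbU (x : X) : IsHolSection (Fin r → ℂ) (b x) (U x) := (hb x).mono Set.inter_subset_left
  have h1 (x y : X) (p : X) (hp : p ∈ U x ∩ U y) :
      θ.equiv p (A.diffCocycle x y p) - B.diffCocycle x y p = b y p - b x p :=
    h x y p ⟨hp.1.1, hp.2.1⟩
  obtain ⟨γ, hγ, hp, hd⟩ := exists_affineMap θ hU (fun x p hp => hp.2.1) (fun x p hp => hp.2.2)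
    hbU h1
  -- Solving b + θ(a - σ_A) for a - σ_A shows that the inverse belongs to θ⁻¹ and the cochain -θ⁻¹
  -- b.
  obtain ⟨δ, hδ, hp', hd'⟩ := exists_affineMap θ.symm hU (fun x p hp => hp.2.2)
    (fun x p hp => hp.2.1) (b := fun x p => -(θ.equiv p).symm (b x p))
    (fun x => ContMDiffOn.neg_section (θ.symm.isHolSection (hbU x))) fun x y p hp => by
      have h2 := congrArg (θ.equiv p).symm (h1 x y p hp)
      rw [map_sub, map_sub, LinearEquiv.symm_apply_apply] at h2
      change (θ.equiv p).symm _ - _ = _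
      rw [← neg_sub, h2]
      abel
  have hδγ (a : A.Total) : δ (γ a) = a := by
    have h3 := hd' _ (γ a) (hp a) _ (hU _).2
    rw [hd _ a rfl _ (hU _).2] at h3
    change _ = -(θ.equiv _).symm _ + (θ.equiv _).symm _ at h3
    rw [map_add, LinearEquiv.symm_apply_apply, neg_add_cancel_left] at h3
    have h4 : A.proj (δ (γ a)) = A.proj a := (hp' _).trans (hp a)
    rw [← h4] at h3
    exact A.eq_of_diff_eq h4 h3
  have hγδ (c : B.Total) : γ (δ c) = c := by
    have h3 := hd _ (δ c) (hp' c) _ (hU _).2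
    rw [hd' _ c rfl _ (hU _).2] at h3
    change _ = _ + θ.equiv _ (-(θ.equiv _).symm _ + (θ.equiv _).symm _) at h3
    rw [map_add, map_neg, LinearEquiv.apply_symm_apply, LinearEquiv.apply_symm_apply,
      add_neg_cancel_left] at h3
    have h4 : B.proj (γ (δ c)) = B.proj c := (hp _).trans (hp' c)
    rw [← h4] at h3
    exact B.eq_of_diff_eq h4 h3
  refine ⟨⟨⟨γ, δ, hδγ, hγδ⟩, hγ, hδ⟩, hp, fun e he e' he' x hx => ?_⟩
  let a₀ := e.toOpenPartialHomeomorph.symm (x, 0)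
  have ha₀ : A.proj a₀ = x := A.proj_symm hx.1 0
  -- In trivialisations γ is θ followed by the translation by the image of the point with coordinate
  -- 0.
  refine ⟨(((A.linCoord ⟨e, he⟩ hx.1).symm.trans ((θ.equiv x).trans
    (B.linCoord ⟨e', he'⟩ hx.2))).toAffineEquiv).trans
      (AffineEquiv.constVAdd ℂ (Fin r → ℂ) (e' (γ a₀)).2), fun v => ?_⟩
  let a := e.toOpenPartialHomeomorph.symm (x, v)
  have ha : A.proj a = x := A.proj_symm hx.1 v
  have h3 : B.diff x (γ a) (γ a₀) = θ.equiv x (A.diff x a a₀) := by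
    have h4 := hd x a ha x (hU x).2
    have h5 := hd x a₀ ha₀ x (hU x).2
    rw [← B.diff_add_diff _ _ (γ a₀), h5,
      ← A.diff_add_diff x (A.localSection x x) a₀ a, map_add] at h4
    exact add_right_cancel (h4.trans (add_left_comm _ _ _))
  have h6 := congrArg (B.linCoord ⟨e', he'⟩ hx.2) h3
  rw [B.linCoord_diff _ hx.2 ((hp _).trans ha₀) ((hp _).trans ha),
    A.diff_triv_symm ⟨e, he⟩ hx.1, sub_zero, sub_eq_iff_eq_add'] at h6
  exact h6

end AffineBundles

/-! ### The maximal affine atlas generated by compatible trivialisations -/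

section MaximalAtlas
variable {X : Type} [TopologicalSpace X] {r : ℕ} {Z : Type} [TopologicalSpace Z] {q : Z → X}

theorem transition_trans (e e' e'' : Trivialization (Fin r → ℂ) q) {x : X} (hx : x ∈ e.baseSet)
    (hx' : x ∈ e'.baseSet) (v : Fin r → ℂ) :
    transition e' e'' x (transition e e' x v) = transition e e'' x v := by
  have h1 : q (e.toOpenPartialHomeomorph.symm (x, v)) = x :=
    e.proj_symm_apply (e.mem_target.2 hx)
  have h2 : e.toOpenPartialHomeomorph.symm (x, v) ∈ e'.source := by
    rw [e'.mem_source, h1]; exact hx'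
  have h3 : (x, (e' (e.toOpenPartialHomeomorph.symm (x, v))).2)
      = e' (e.toOpenPartialHomeomorph.symm (x, v)) :=
    Prod.ext (h1.symm.trans (e'.coe_fst h2).symm) rfl
  unfold transition
  rw [h3]
  exact congrArg (fun z => (e'' z).2) (e'.toOpenPartialHomeomorph.left_inv h2)

variable [ChartedSpace ℂ X] [ChartedSpace (ℂ × (Fin r → ℂ)) Z]

/-- The trivialisations compatible with a family of trivialisations. -/
def affAtlas {ι : Type} (T : ι → Trivialization (Fin r → ℂ) q) :
    Set (Trivialization (Fin r → ℂ) q) :=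
  {e | IsHolTriv e ∧ ∀ k, AffCompatible e (T k) ∧ AffCompatible (T k) e}

theorem mem_affAtlas {ι : Type} {T : ι → Trivialization (Fin r → ℂ) q}
    (hT : ∀ k, IsHolTriv (T k)) (hc : ∀ i j, AffCompatible (T i) (T j)) (k : ι) :
    T k ∈ affAtlas T :=
  ⟨hT k, fun j => ⟨hc k j, hc j k⟩⟩

/-- Two members are compatible at a point through some `T k` that covers it. Conversely, in an
affine atlas containing every `T k`, each member is compatible with them in both directions. -/
theorem maximal_affAtlas {ι : Type} {T : ι → Trivialization (Fin r → ℂ) q}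
    (hT : ∀ k, IsHolTriv (T k)) (hc : ∀ i j, AffCompatible (T i) (T j))
    (hcov : ∀ x, ∃ k, x ∈ (T k).baseSet) : Maximal IsAffAtlas (affAtlas T) := by
  refine ⟨⟨fun e he => he.1, fun x => ?_, fun e he e' he' x hx => ?_⟩, fun S hS hTS e he => ?_⟩
  · obtain ⟨k, hk⟩ := hcov x
    exact ⟨T k, mem_affAtlas hT hc k, hk⟩
  · obtain ⟨k, hk⟩ := hcov x
    obtain ⟨f, hf⟩ := (he.2 k).1 x ⟨hx.1, hk⟩
    obtain ⟨g, hg⟩ := (he'.2 k).2 x ⟨hk, hx.2⟩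
    refine ⟨f.trans g, funext fun v => ?_⟩
    rw [← transition_trans e (T k) e' hx.1 hk, hf, hg]
    rfl
  · exact ⟨hS.hol e he, fun k => ⟨hS.compatible e he _ (hTS (mem_affAtlas hT hc k)),
      hS.compatible _ (hTS (mem_affAtlas hT hc k)) e he⟩⟩

end MaximalAtlas

/-! ### The affine bundle glued from a cocycle of the standard cover -/

section Gluing
variable {m : ℕ} {n : Fin m → ℤ} {s : Fin m → ℕ} {r : ℕ}

local notation "𝔽" => ((Σ i, Fin (s i)) → ℂ)

/-- The frame over `X_k ≠ 0`, as a linear isomorphism. -/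
def frameEquiv {k : Fin 2} {p : P1} (hp : p ∈ coordOpen k) : SplitBundle n s p ≃ₗ[ℂ] 𝔽 :=
  { frameCoord k p with
    invFun := frameVec k p
    left_inv := frameVec_frameCoord hp
    right_inv := frameCoord_frameVec hp }

/-- The 0-cochain `(0, f)` of the standard cover. -/
def zeroCochain (f : ∀ p, SplitBundle n s p) (i : Fin 2) (p : P1) : SplitBundle n s p :=
  if i = 0 then 0 else f p

/-- The cocycle is the set-theoretic coboundary of (0, f), whose second member need not be
holomorphic on all of U₁. Writing transition maps with this cochain makes their cocycle identities
automatic; on overlaps only 0, f or -f enters. -/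
theorem standardCocycle_eq_sub (f : ∀ p, SplitBundle n s p) (x y p : P1) :
    standardCocycle n s f x y p
      = zeroCochain f (chartIndex y) p - zeroCochain f (chartIndex x) p := by
  unfold standardCocycle
  generalize chartIndex x = i
  generalize chartIndex y = j
  fin_cases i <;> fin_cases j <;> simp [zeroCochain]

/-- The change of coordinates from `X_i ≠ 0` to `X_j ≠ 0` in the affine bundle given by `f`. -/
def affChange (ρ : 𝔽 ≃L[ℂ] (Fin r → ℂ)) (f : ∀ p, SplitBundle n s p) (i j : Fin 2) (p : P1)
    (v : Fin r → ℂ) : Fin r → ℂ :=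
  ρ (frameCoord j p (frameVec i p (ρ.symm v) + (zeroCochain f i p - zeroCochain f j p)))

theorem affChange_self (ρ : 𝔽 ≃L[ℂ] (Fin r → ℂ)) (f : ∀ p, SplitBundle n s p) {i : Fin 2} {p : P1}
    (hp : p ∈ coordOpen i) (v : Fin r → ℂ) : affChange ρ f i i p v = v := by
  rw [affChange, sub_self, add_zero, frameCoord_frameVec hp, ρ.apply_symm_apply]

theorem affChange_comp (ρ : 𝔽 ≃L[ℂ] (Fin r → ℂ)) (f : ∀ p, SplitBundle n s p) {i j : Fin 2}
    (k : Fin 2) {p : P1} (hj : p ∈ coordOpen j) (v : Fin r → ℂ) :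
    affChange ρ f j k p (affChange ρ f i j p v) = affChange ρ f i k p v := by
  simp only [affChange, ρ.symm_apply_apply, frameVec_frameCoord hj, add_assoc, sub_add_sub_cancel]

theorem contMDiffOn_frameCoord_zeroCochain {f : ∀ p, SplitBundle n s p}
    (hf : IsHolSection 𝔽 f (coordOpen 0 ∩ coordOpen 1)) (i j : Fin 2) :
    ContMDiffOn 𝓘(ℂ) 𝓘(ℂ, 𝔽) ω
      (fun p => frameCoord j p (zeroCochain f i p - zeroCochain f j p))
      (coordOpen i ∩ coordOpen j) := by
  have key (j : Fin 2) (g : ∀ p, SplitBundle n s p)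
      (hg : IsHolSection 𝔽 g (coordOpen 0 ∩ coordOpen 1)) :
      ContMDiffOn 𝓘(ℂ) 𝓘(ℂ, 𝔽) ω (fun p => frameCoord j p (g p)) (coordOpen 0 ∩ coordOpen 1) :=
    (((splitCore n s).localTriv j).contMDiffOn_section_iff
      ((isOpen_coordOpen 0).inter (isOpen_coordOpen 1)) (by
        fin_cases j
        · exact Set.inter_subset_left
        · exact Set.inter_subset_right)).1 hg
  fin_cases i <;> fin_cases j
  · exact (contMDiffOn_const (c := 0)).congr fun p _ => by simp
  · refine (key 1 (-f) (ContMDiffOn.neg_section hf)).congr fun p _ => ?_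
    simp [zeroCochain]
  · change ContMDiffOn _ _ _ _ (coordOpen 1 ∩ coordOpen 0)
    rw [Set.inter_comm]
    refine (key 0 f hf).congr fun p _ => ?_
    simp [zeroCochain]
  · exact (contMDiffOn_const (c := 0)).congr fun p _ => by simp

theorem contMDiffOn_affChange (ρ : 𝔽 ≃L[ℂ] (Fin r → ℂ)) {f : ∀ p, SplitBundle n s p}
    (hf : IsHolSection 𝔽 f (coordOpen 0 ∩ coordOpen 1)) (i j : Fin 2) :
    ContMDiffOn (𝓘(ℂ).prod 𝓘(ℂ, Fin r → ℂ)) 𝓘(ℂ, Fin r → ℂ) ω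
      (fun u : P1 × (Fin r → ℂ) => affChange ρ f i j u.1 u.2)
      ((coordOpen i ∩ coordOpen j) ×ˢ Set.univ) := by
  have hfst : ContMDiffOn (𝓘(ℂ).prod 𝓘(ℂ, Fin r → ℂ)) 𝓘(ℂ) ω
      (Prod.fst : P1 × (Fin r → ℂ) → P1) ((coordOpen i ∩ coordOpen j) ×ˢ Set.univ) :=
    contMDiffOn_fst
  have h1 := (contMDiffOn_diag n s i j).comp hfst fun u hu => hu.1
  have h2 : ContMDiffOn (𝓘(ℂ).prod 𝓘(ℂ, Fin r → ℂ)) 𝓘(ℂ, 𝔽) ω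
      (fun u : P1 × (Fin r → ℂ) => ρ.symm u.2) ((coordOpen i ∩ coordOpen j) ×ˢ Set.univ) :=
    ρ.symm.contDiff.contMDiff.comp_contMDiffOn contMDiffOn_snd
  have h3 := (contMDiffOn_frameCoord_zeroCochain hf i j).comp hfst fun u hu => hu.1
  refine (ρ.contDiff.contMDiff.comp_contMDiffOn ((h1.clm_apply h2).add h3)).congr fun u hu => ?_
  rw [affChange, map_add]
  refine congrArg ρ (congrArg (· + _) (funext fun a => ?_))
  rw [frameCoord_change hu.1.1, frameCoord_frameVec hu.1.1]
  rfl

/-- The affine bundle given by a cocycle `f`, as a fibre bundle. -/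
def affCore (ρ : 𝔽 ≃L[ℂ] (Fin r → ℂ)) {f : ∀ p, SplitBundle n s p}
    (hf : IsHolSection 𝔽 f (coordOpen 0 ∩ coordOpen 1)) :
    FiberBundleCore (Fin 2) P1 (Fin r → ℂ) where
  baseSet := coordOpen
  isOpen_baseSet := isOpen_coordOpen
  indexAt := chartIndex
  mem_baseSet_at := mem_coordOpen_chartIndex
  coordChange := affChange ρ f
  coordChange_self _ _ hp v := affChange_self ρ f hp v
  continuousOn_coordChange i j := (contMDiffOn_affChange ρ hf i j).continuousOn
  coordChange_comp _ _ _ _ hp v := affChange_comp ρ f _ hp.1.2 v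

variable (ρ : ((Σ i, Fin (s i)) → ℂ) ≃L[ℂ] (Fin r → ℂ)) {f : ∀ p, SplitBundle n s p}
  (hf : IsHolSection ((Σ i, Fin (s i)) → ℂ) f (coordOpen 0 ∩ coordOpen 1))

/-- The chart of the affine bundle over `X_k ≠ 0`. -/
def affBundleChart (k : Fin 2) :
    OpenPartialHomeomorph (affCore ρ hf).TotalSpace (ℂ × (Fin r → ℂ)) :=
  ((affCore ρ hf).localTriv k).toOpenPartialHomeomorph.trans
    ((affChart k).prod (OpenPartialHomeomorph.refl _))

theorem affBundleChart_source (k : Fin 2) :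
    (affBundleChart ρ hf k).source = ((affCore ρ hf).localTriv k).source := by
  rw [affBundleChart, OpenPartialHomeomorph.trans_source, Set.inter_eq_left]
  intro a ha
  have h := ((affCore ρ hf).localTriv k).mem_source.1 ha
  refine ⟨?_, trivial⟩
  change (((affCore ρ hf).localTriv k) a).1 ∈ coordOpen k
  rw [((affCore ρ hf).localTriv k).coe_fst ha]
  exact h

theorem affBundleChart_target (k : Fin 2) : (affBundleChart ρ hf k).target = Set.univ := by
  rw [affBundleChart, OpenPartialHomeomorph.trans_target, Set.eq_univ_iff_forall]
  rintro ⟨z, v⟩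
  exact ⟨⟨trivial, trivial⟩, ((affCore ρ hf).localTriv k).mem_target.2 (pt_mem k z)⟩

instance : ChartedSpace (ℂ × (Fin r → ℂ)) (affCore ρ hf).TotalSpace where
  atlas := Set.range (affBundleChart ρ hf)
  chartAt a := affBundleChart ρ hf (chartIndex a.proj)
  mem_chart_source a := by
    rw [affBundleChart_source]
    exact ((affCore ρ hf).localTriv _).mem_source.2 (mem_coordOpen_chartIndex a.proj)
  chart_mem_atlas _ := Set.mem_range_self _

theorem contMDiff_pt_prod (k : Fin 2) :
    ContMDiff 𝓘(ℂ, ℂ × (Fin r → ℂ)) (𝓘(ℂ).prod 𝓘(ℂ, Fin r → ℂ)) ω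
      fun u : ℂ × (Fin r → ℂ) => (pt k u.1, u.2) :=
  ((contMDiff_pt k).comp contDiff_fst.contMDiff).prodMk contDiff_snd.contMDiff

theorem contMDiffOn_affChange_pt (ρ : 𝔽 ≃L[ℂ] (Fin r → ℂ)) {f : ∀ p, SplitBundle n s p}
    (hf : IsHolSection 𝔽 f (coordOpen 0 ∩ coordOpen 1)) (k l : Fin 2) :
    ContMDiffOn 𝓘(ℂ, ℂ × (Fin r → ℂ)) 𝓘(ℂ, Fin r → ℂ) ω
      (fun u : ℂ × (Fin r → ℂ) => affChange ρ f k l (pt k u.1) u.2)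
      {u : ℂ × (Fin r → ℂ) | pt k u.1 ∈ coordOpen l} := by
  have h1 := (contMDiff_pt_prod (r := r) k).contMDiffOn 
    (s := {u : ℂ × (Fin r → ℂ) | pt k u.1 ∈ coordOpen l})
  have h2 := contMDiffOn_affChange ρ hf k l
  have h3 : Set.MapsTo (fun u : ℂ × (Fin r → ℂ) => (pt k u.1, u.2)) {u | pt k u.1 ∈ coordOpen l}
    ((coordOpen k ∩ coordOpen l) ×ˢ Set.univ) := fun u hu => ⟨⟨pt_mem k _, hu⟩, trivial⟩
  have h4 := h2.comp h1 h3
  exact h4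

theorem localTriv_symm_affCore (k l : Fin 2) (p : P1) (v : Fin r → ℂ) :
    (affCore ρ hf).localTriv l (((affCore ρ hf).localTriv k).toOpenPartialHomeomorph.symm (p, v))
      = (p, affChange ρ f k l p v) :=
  Prod.ext rfl (affChange_comp ρ f l (mem_coordOpen_chartIndex p) v)

instance : IsManifold 𝓘(ℂ, ℂ × (Fin r → ℂ)) ω (affCore ρ hf).TotalSpace := by
  refine isManifold_of_contDiffOn _ _ _ ?_
  rintro _ _ ⟨k, rfl⟩ ⟨l, rfl⟩
  simp only [modelWithCornersSelf_coe, modelWithCornersSelf_coe_symm, Function.comp_id,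
    Function.id_comp, Set.preimage_id, Set.range_id, Set.inter_univ]
  have hval (u : ℂ × (Fin r → ℂ)) : affBundleChart ρ hf l ((affBundleChart ρ hf k).symm u)
      = (affChart l (pt k u.1), affChange ρ f k l (pt k u.1) u.2) := by
    have h := localTriv_symm_affCore ρ hf k l (pt k u.1) u.2
    exact congrArg (fun w : P1 × (Fin r → ℂ) => (affChart l w.1, w.2)) h
  have hsrc : ∀ u ∈ ((affBundleChart ρ hf k).symm.trans (affBundleChart ρ hf l)).source,
      pt k u.1 ∈ coordOpen l := by
    intro u hu
    have h2 := hu.2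
    rw [Set.mem_preimage, affBundleChart_source] at h2
    exact ((affCore ρ hf).localTriv l).mem_source.1 h2
  rw [← contMDiffOn_iff_contDiffOn]
  refine ContMDiffOn.congr (f := fun u : ℂ × (Fin r → ℂ) =>
    (affChart l (pt k u.1), affChange ρ f k l (pt k u.1) u.2)) ?_ fun u _ => hval u
  refine ContMDiffOn.prodMk_space ?_ ?_
  · exact (contMDiffOn_affChart l).comp
      ((contMDiff_pt k).comp contDiff_fst.contMDiff).contMDiffOn hsrc
  · exact (contMDiffOn_affChange_pt ρ hf k l).mono hsrc

theorem isHolTriv_affCore (k : Fin 2) : IsHolTriv ((affCore ρ hf).localTriv k) := by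
  have hmem : affBundleChart ρ hf k ∈ IsManifold.maximalAtlas 𝓘(ℂ, ℂ × (Fin r → ℂ)) ω
      (affCore ρ hf).TotalSpace := IsManifold.subset_maximalAtlas (Set.mem_range_self k)
  constructor
  · have h1 := contMDiffOn_of_mem_maximalAtlas hmem
    rw [affBundleChart_source] at h1
    refine ((contMDiff_pt_prod k).comp_contMDiffOn h1).congr fun a ha => ?_
    have h2 := ((affCore ρ hf).localTriv k).coe_fst ha
    have h3 := ((affCore ρ hf).localTriv k).mem_source.1 ha
    refine Prod.ext ?_ rfl
    change _ = pt k (affChart k (((affCore ρ hf).localTriv k) a).1)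
    rw [h2, pt_affChart h3]
  · have h1 := contMDiffOn_symm_of_mem_maximalAtlas hmem
    rw [affBundleChart_target] at h1
    have h2 : ContMDiffOn (𝓘(ℂ).prod 𝓘(ℂ, Fin r → ℂ)) 𝓘(ℂ, ℂ × (Fin r → ℂ)) ω
        (fun u : P1 × (Fin r → ℂ) => (affChart k u.1, u.2))
        ((affCore ρ hf).localTriv k).target := by
      refine ContMDiffOn.prodMk_space ((contMDiffOn_affChart k).comp contMDiffOn_fst ?_)
        contMDiffOn_snd
      exact fun u hu => ((affCore ρ hf).localTriv k).mem_target.1 hu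
    refine (h1.comp h2 fun _ _ => trivial).congr fun u hu => ?_
    have h3 : pt k (affChart k u.1) = u.1 :=
      pt_affChart (((affCore ρ hf).localTriv k).mem_target.1 hu)
    change _ = ((affCore ρ hf).localTriv k).toOpenPartialHomeomorph.symm
      (pt k (affChart k u.1), u.2)
    rw [h3]

theorem affCompatible_affCore (k l : Fin 2) :
    AffCompatible ((affCore ρ hf).localTriv k) ((affCore ρ hf).localTriv l) := by
  intro p hp
  have hk : p ∈ coordOpen k := hp.1
  have hl : p ∈ coordOpen l := hp.2
  refine ⟨(ρ.symm.toLinearEquiv.trans ((frameEquiv (n := n) hk).symm.trans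
    ((frameEquiv (n := n) hl).trans ρ.toLinearEquiv))).toAffineEquiv.trans
      (AffineEquiv.constVAdd ℂ (Fin r → ℂ)
      (ρ (frameCoord l p (zeroCochain f k p - zeroCochain f l p)))), funext fun v => ?_⟩
  refine (congrArg Prod.snd (localTriv_symm_affCore ρ hf k l p v)).trans ?_
  rw [affChange, map_add, map_add, add_comm]
  rfl

/-- The affine bundle given by a cocycle `f`. -/
def gluedBundle : AffBundle P1 r where
  Total := (affCore ρ hf).TotalSpace
  proj := (affCore ρ hf).proj
  proj_hol a := by
    have h := (isHolTriv_affCore ρ hf (chartIndex a.proj)).1.contMDiffAt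
      (((affCore ρ hf).localTriv _).open_source.mem_nhds
        (((affCore ρ hf).localTriv _).mem_source.2 (mem_coordOpen_chartIndex a.proj)))
    exact contMDiffAt_fst.comp a h
  atlas := affAtlas (affCore ρ hf).localTriv
  maximal := maximal_affAtlas (isHolTriv_affCore ρ hf) (affCompatible_affCore ρ hf)
    fun x => ⟨chartIndex x, mem_coordOpen_chartIndex x⟩

/-- The trivialisations of the glued bundle over the standard cover. -/
def gluedTriv (k : Fin 2) : (gluedBundle ρ hf).atlas :=
  ⟨(affCore ρ hf).localTriv k,
    mem_affAtlas (isHolTriv_affCore ρ hf) (affCompatible_affCore ρ hf) k⟩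

theorem gluedBundle_linCoord_symm {k l : Fin 2} {p : P1} (hk : p ∈ coordOpen k)
    (hl : p ∈ coordOpen l) (v : Fin r → ℂ) :
    (gluedBundle ρ hf).linCoord (gluedTriv ρ hf l) hl
      (((gluedBundle ρ hf).linCoord (gluedTriv ρ hf k) hk).symm v)
      = ρ (frameCoord l p (frameVec k p (ρ.symm v) : SplitBundle n s p)) := by
  have h1 := (gluedBundle ρ hf).diff_triv_symm (gluedTriv ρ hf k) hk v 0
  rw [sub_zero] at h1
  rw [← h1]
  refine ((gluedBundle ρ hf).linCoord_diff (gluedTriv ρ hf l) hl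
    ((gluedBundle ρ hf).proj_symm (e := (gluedTriv ρ hf k).1) hk 0)
    ((gluedBundle ρ hf).proj_symm (e := (gluedTriv ρ hf k).1) hk v)).trans ?_
  refine (congrArg₂ (fun a b : P1 × (Fin r → ℂ) => a.2 - b.2)
    (localTriv_symm_affCore ρ hf k l p v) (localTriv_symm_affCore ρ hf k l p 0)).trans ?_
  simp only [affChange, map_add, map_zero, zero_add, add_sub_cancel_right]

/-- The linearisation of the glued bundle, fibrewise. -/
def gluedLinEquiv (p : P1) : SplitBundle n s p ≃ₗ[ℂ] (gluedBundle ρ hf).Lin p :=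
  (frameEquiv (mem_coordOpen_chartIndex p)).trans (ρ.toLinearEquiv.trans
    ((gluedBundle ρ hf).linCoord (gluedTriv ρ hf (chartIndex p)) (mem_coordOpen_chartIndex p)).symm)

/-- The translation by f cancels in differences, so the linear transition maps are those of the
split bundle up to ρ. The identification therefore has the same form in every frame, and is
holomorphic. -/
theorem linCoord_gluedLinEquiv {k : Fin 2} {p : P1} (hk : p ∈ coordOpen k)
    (w : SplitBundle n s p) :
    (gluedBundle ρ hf).linCoord (gluedTriv ρ hf k) hk (gluedLinEquiv ρ hf p w)
      = ρ (frameCoord k p w) := by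
  refine (gluedBundle_linCoord_symm ρ hf (mem_coordOpen_chartIndex p) hk _).trans ?_
  refine congrArg (fun w => ρ (frameCoord k p w)) ?_
  refine Eq.trans (congrArg (frameVec _ p) (ρ.symm_apply_apply _)) ?_
  exact frameVec_frameCoord (mem_coordOpen_chartIndex p) w

/-- The linearisation of the glued bundle. -/
def gluedLin : HolIso 𝔽 (SplitBundle n s) (Fin r → ℂ) (gluedBundle ρ hf).Lin where
  equiv := gluedLinEquiv ρ hf
  hol := by
    refine contMDiff_fiberMap (splitCore n s) (gluedBundle ρ hf).linCore
      (fun p => gluedLinEquiv ρ hf p) fun x => ?_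
    have hk := mem_coordOpen_chartIndex x
    refine ⟨chartIndex x, gluedTriv ρ hf (chartIndex x), hk, hk, fun u => ρ u.2,
      fun w => (ρ.contDiff.contMDiff _).comp _ contMDiffAt_snd, ?_⟩
    filter_upwards [(isOpen_coordOpen _).mem_nhds hk] with p hp v
    exact linCoord_gluedLinEquiv ρ hf hp v
  hol_symm := by
    refine contMDiff_fiberMap (gluedBundle ρ hf).linCore (splitCore n s)
      (fun p => (gluedLinEquiv ρ hf p).symm) fun x => ?_
    have hk := mem_coordOpen_chartIndex x
    refine ⟨gluedTriv ρ hf (chartIndex x), chartIndex x, hk, hk, fun u => ρ.symm u.2,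
      fun w => (ρ.symm.contDiff.contMDiff _).comp _ contMDiffAt_snd, ?_⟩
    filter_upwards [(isOpen_coordOpen _).mem_nhds hk] with p hp v
    have h := linCoord_gluedLinEquiv ρ hf hp ((gluedLinEquiv ρ hf p).symm v)
    rw [LinearEquiv.apply_symm_apply] at h
    exact (ρ.symm_apply_eq.2 h).symm

/-- The zero sections of the two trivialisations serve as local sections; the sign in `affChange` is
such that their difference is f itself. -/
theorem H1map_gluedLin :
    (gluedLin ρ hf).H1map (standardClass n s hf) = (gluedBundle ρ hf).hClass := by
  refine ((gluedBundle ρ hf).hClass_eq_mk (U := fun x => coordOpen (chartIndex x))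
    (fun x => ⟨isOpen_coordOpen _, mem_coordOpen_chartIndex x⟩)
    (σ := fun x p =>
      (gluedTriv ρ hf (chartIndex x)).1.toOpenPartialHomeomorph.symm (p, (0 : Fin r → ℂ)))
    (fun x p hp => ?_) (fun x p hp => ?_)
    ((gluedLin ρ hf).map_cocycles _ (standardCocycle_mem n s hf)) (fun x y p hp => ?_)).symm
  · exact (((gluedBundle ρ hf).contMDiffAt_triv_symm (gluedTriv ρ hf (chartIndex x)) hp 0).comp p
        (contMDiffAt_id.prodMk contMDiffAt_const)).contMDiffWithinAt
  · exact (gluedBundle ρ hf).proj_symm (e := (gluedTriv ρ hf (chartIndex x)).1) hp 0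
  · change gluedLinEquiv ρ hf p (standardCocycle n s f x y p) = _
    have hx : p ∈ coordOpen (chartIndex x) := hp.1
    have hy : p ∈ coordOpen (chartIndex y) := hp.2
    refine ((gluedBundle ρ hf).linCoord (gluedTriv ρ hf (chartIndex y)) hy).injective ?_
    rw [linCoord_gluedLinEquiv]
    refine Eq.trans ?_ ((gluedBundle ρ hf).linCoord_diff (gluedTriv ρ hf (chartIndex y)) hy
      ((gluedBundle ρ hf).proj_symm (e := (gluedTriv ρ hf (chartIndex x)).1) hx 0)
      ((gluedBundle ρ hf).proj_symm (e := (gluedTriv ρ hf (chartIndex y)).1) hy 0)).symm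
    refine Eq.trans ?_ (congrArg₂ (fun a b : P1 × (Fin r → ℂ) => a.2 - b.2)
      (localTriv_symm_affCore ρ hf _ (chartIndex y) p 0)
      (localTriv_symm_affCore ρ hf _ (chartIndex y) p 0)).symm
    simp only [affChange, map_zero, zero_add]
    rw [standardCocycle_eq_sub, ← map_sub, ← map_sub, sub_sub_sub_cancel_right]

end Gluing

/-! ### Isomorphism classes and orbits of invariants -/

section Classification
variable {X : Type} [TopologicalSpace X] [ChartedSpace ℂ X] {r : ℕ}
variable {F : Type} [NormedAddCommGroup F] [NormedSpace ℂ F]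
  {E : X → Type} [TopologicalSpace (TotalSpace F E)] [∀ x, AddCommGroup (E x)]
  [∀ x, Module ℂ (E x)] [∀ x, TopologicalSpace (E x)] [FiberBundle F E] [VectorBundle ℂ F E]

theorem HolIso.H1map_trans {F₁ F₂ F₃ : Type} [NormedAddCommGroup F₁] [NormedSpace ℂ F₁]
    [NormedAddCommGroup F₂] [NormedSpace ℂ F₂] [NormedAddCommGroup F₃] [NormedSpace ℂ F₃]
    {E₁ E₂ E₃ : X → Type} [TopologicalSpace (TotalSpace F₁ E₁)] [∀ x, AddCommGroup (E₁ x)]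
    [∀ x, Module ℂ (E₁ x)] [∀ x, TopologicalSpace (E₁ x)] [FiberBundle F₁ E₁]
    [VectorBundle ℂ F₁ E₁] [TopologicalSpace (TotalSpace F₂ E₂)] [∀ x, AddCommGroup (E₂ x)]
    [∀ x, Module ℂ (E₂ x)] [∀ x, TopologicalSpace (E₂ x)] [FiberBundle F₂ E₂]
    [VectorBundle ℂ F₂ E₂] [TopologicalSpace (TotalSpace F₃ E₃)] [∀ x, AddCommGroup (E₃ x)]
    [∀ x, Module ℂ (E₃ x)] [∀ x, TopologicalSpace (E₃ x)] [FiberBundle F₃ E₃]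
    [VectorBundle ℂ F₃ E₃] (f : HolIso F₁ E₁ F₂ E₂) (g : HolIso F₂ E₂ F₃ E₃) (h : H1 F₁ E₁) :
    (f.trans g).H1map h = g.H1map (f.H1map h) := by
  induction h using Submodule.Quotient.induction_on with
  | H c => rfl

theorem HolIso.H1map_symm_apply {F₁ F₂ : Type} [NormedAddCommGroup F₁] [NormedSpace ℂ F₁]
    [NormedAddCommGroup F₂] [NormedSpace ℂ F₂]
    {E₁ E₂ : X → Type} [TopologicalSpace (TotalSpace F₁ E₁)] [∀ x, AddCommGroup (E₁ x)]
    [∀ x, Module ℂ (E₁ x)] [∀ x, TopologicalSpace (E₁ x)] [FiberBundle F₁ E₁]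
    [VectorBundle ℂ F₁ E₁] [TopologicalSpace (TotalSpace F₂ E₂)] [∀ x, AddCommGroup (E₂ x)]
    [∀ x, Module ℂ (E₂ x)] [∀ x, TopologicalSpace (E₂ x)] [FiberBundle F₂ E₂]
    [VectorBundle ℂ F₂ E₂] (f : HolIso F₁ E₁ F₂ E₂) (h : H1 F₁ E₁) :
    f.symm.H1map (f.H1map h) = h := by
  obtain ⟨c, hc, rfl⟩ := H1.exists_mk h
  refine congrArg (Submodule.Quotient.mk (p := (coboundaries F₁ E₁).submoduleOf _))
    (Subtype.ext ?_)
  funext x y p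
  exact (f.equiv p).symm_apply_apply _

variable (F E) in
/-- The space of orbits of `Aut(E)` on `H¹(X, E)`. -/
abbrev H1Orbits : Type := Quotient (MulAction.orbitRel (BundleAut F E) (H1 F E))

/-- With θ the linear part of the isomorphism, g⁻¹ θ f is an automorphism of E that carries one
class to the other. -/
theorem orbit_eq_of_affIsomorphic {A B : AffBundle X r} (h : AffIsomorphic A B)
    (f : HolIso F E (Fin r → ℂ) A.Lin) (g : HolIso F E (Fin r → ℂ) B.Lin) :
    (Quotient.mk _ (f.symm.H1map A.hClass) : H1Orbits F E)
      = Quotient.mk _ (g.symm.H1map B.hClass) := by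
  obtain ⟨θ, hθ⟩ := h.exists_holIso
  refine (Quotient.sound (show MulAction.orbitRel _ _ _ _ from
    ⟨(f.trans (θ.trans g.symm) : BundleAut F E), ?_⟩)).symm
  change (f.trans (θ.trans g.symm)).H1map _ = _
  have h1 : f.H1map (f.symm.H1map A.hClass) = A.hClass := f.symm.H1map_symm_apply _
  rw [HolIso.H1map_trans, HolIso.H1map_trans, h1, hθ]

theorem affIsomorphic_of_orbit_eq {A B : AffBundle X r}
    (f : HolIso F E (Fin r → ℂ) A.Lin) (g : HolIso F E (Fin r → ℂ) B.Lin)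
    (h : (Quotient.mk _ (f.symm.H1map A.hClass) : H1Orbits F E)
      = Quotient.mk _ (g.symm.H1map B.hClass)) : AffIsomorphic A B := by
  obtain ⟨φ, hφ⟩ : ∃ φ : BundleAut F E, φ • f.symm.H1map A.hClass = g.symm.H1map B.hClass :=
    Quotient.exact h.symm
  refine affIsomorphic_of_H1map_eq (f.symm.trans (φ.trans g)) ?_
  rw [HolIso.H1map_trans, HolIso.H1map_trans]
  exact (congrArg g.H1map hφ).trans (g.symm.H1map_symm_apply _)

variable (r F E) in
/-- The orbit of the invariant of an affine bundle. -/
def affInvariant : AffClasses F E r → H1Orbits F E :=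
  Quotient.lift (fun A => Quotient.mk _ (A.2.some.symm.H1map A.1.hClass))
    fun _ _ h => orbit_eq_of_affIsomorphic h _ _

/-- The case of the identity of A in `orbit_eq_of_affIsomorphic`: the chosen identification with E
does not affect the orbit. -/
theorem affInvariant_mk (A : AffBundleWithLin F E r) (f : HolIso F E (Fin r → ℂ) A.1.Lin) :
    affInvariant r F E (Quotient.mk _ A) = Quotient.mk _ (f.symm.H1map A.1.hClass) :=
  orbit_eq_of_affIsomorphic (.refl A.1) _ f

theorem affInvariant_injective : Function.Injective (affInvariant r F E) := by
  intro a b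
  induction a, b using Quotient.inductionOn₂ with
  | h A B => exact fun h => Quotient.sound (affIsomorphic_of_orbit_eq _ _ h)

end Classification

/-! ### The moduli space and its homeomorphism with V/G -/

section Moduli
variable {m : ℕ} (n : Fin m → ℤ) (s : Fin m → ℕ)

/-- Every class is represented on the standard cover, which is all that gluing requires; ρ merely
renumbers the r coordinates. -/
theorem affInvariant_surjective : Function.Surjective
    (affInvariant (∑ i, s i) ((Σ i, Fin (s i)) → ℂ) (SplitBundle n s)) := by
  intro a
  induction a using Quotient.inductionOn with
  | h h =>
    obtain ⟨f, hf, rfl⟩ := exists_standardClass h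
    let ρ : ((Σ i, Fin (s i)) → ℂ) ≃L[ℂ] (Fin (∑ i, s i) → ℂ) :=
      (LinearEquiv.funCongrLeft ℂ ℂ finSigmaFinEquiv.symm).toContinuousLinearEquiv
    refine ⟨Quotient.mk _ ⟨gluedBundle ρ hf, ⟨gluedLin ρ hf⟩⟩, ?_⟩
    rw [affInvariant_mk _ (gluedLin ρ hf), ← H1map_gluedLin, HolIso.H1map_symm_apply]

/-- Affine bundles with linearisation `⊕ O(n_i)^{s_i}` are classified by their invariants. -/
def affClassesEquiv : AffClasses ((Σ i, Fin (s i)) → ℂ) (SplitBundle n s) (∑ i, s i) ≃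
    H1Orbits ((Σ i, Fin (s i)) → ℂ) (SplitBundle n s) :=
  Equiv.ofBijective _ ⟨affInvariant_injective, affInvariant_surjective n s⟩

instance : IsModuleTopology ℂ (H1 ((Σ i, Fin (s i)) → ℂ) (SplitBundle n s)) := ⟨rfl⟩

instance : IsModuleTopology ℂ (DualForms n s) := ⟨rfl⟩

/-- The homeomorphism of orbit spaces induced by Serre duality. -/
def orbitsHomeomorph (hn : StrictAnti n) :
    H1Orbits ((Σ i, Fin (s i)) → ℂ) (SplitBundle n s) ≃ₜ
      Quotient (MulAction.orbitRel (structGroup n s hn) (DualForms n s)) where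
  toFun := Quotient.map (serreDuality n s) (by
    rintro _ b ⟨g, rfl⟩
    obtain ⟨A, rfl⟩ := (autEquiv s hn).surjective g
    exact ⟨A, (funext fun i => serreDuality_smul hn A b i).symm⟩)
  invFun := Quotient.map (serreDuality n s).symm (by
    rintro _ b ⟨A, rfl⟩
    refine ⟨autEquiv s hn A, ?_⟩
    refine (serreDuality n s).eq_symm_apply.2 (funext fun i => ?_)
    rw [serreDuality_smul, LinearEquiv.apply_symm_apply]
    rfl)
  left_inv a := by
    induction a using Quotient.inductionOn with
    | h h => exact congrArg (Quotient.mk _) ((serreDuality n s).symm_apply_apply h)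
  right_inv a := by
    induction a using Quotient.inductionOn with
    | h h => exact congrArg (Quotient.mk _) ((serreDuality n s).apply_symm_apply h)
  continuous_toFun := by
    -- Both spaces carry the module topology, for which linear maps are continuous; the same holds
    -- for the inverse.
    have := IsModuleTopology.toContinuousAdd ℂ (DualForms n s)
    have := IsModuleTopology.toContinuousSMul ℂ (DualForms n s)
    exact Continuous.quotient_map'
      (IsModuleTopology.continuous_of_linearMap (serreDuality n s).toLinearMap) _
  continuous_invFun := by
    have := IsModuleTopology.toContinuousAdd ℂ (H1 ((Σ i, Fin (s i)) → ℂ) (SplitBundle n s))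
    have := IsModuleTopology.toContinuousSMul ℂ (H1 ((Σ i, Fin (s i)) → ℂ) (SplitBundle n s))
    exact Continuous.quotient_map'
      (IsModuleTopology.continuous_of_linearMap (serreDuality n s).symm.toLinearMap) _

end Moduli

end AffP1
end

theorem mainTheorem6 {m : ℕ} (n : Fin m → ℤ) (hn : StrictAnti n) (s : Fin m → ℕ) :
    IsAffineAlgebraicGroup n s hn ∧
    ∃ (ψ : structGroup n s hn ≃* BundleAut ((Σ i, Fin (s i)) → ℂ) (SplitBundle n s))
      (S : H1 ((Σ i, Fin (s i)) → ℂ) (SplitBundle n s) ≃ₗ[ℂ] DualForms n s)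
      (κ : AffClasses ((Σ i, Fin (s i)) → ℂ) (SplitBundle n s) (∑ i, s i) ≃
        Quotient (MulAction.orbitRel (BundleAut ((Σ i, Fin (s i)) → ℂ) (SplitBundle n s))
          (H1 ((Σ i, Fin (s i)) → ℂ) (SplitBundle n s))))
      (Θ : Quotient (MulAction.orbitRel (BundleAut ((Σ i, Fin (s i)) → ℂ) (SplitBundle n s))
          (H1 ((Σ i, Fin (s i)) → ℂ) (SplitBundle n s))) ≃ₜ
        Quotient (MulAction.orbitRel (structGroup n s hn) (DualForms n s))),
      -- `ψ A` is multiplication of homogeneous functions by the matrix `A`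
      (∀ (A : structGroup n s hn) (X : Fin 2 → ℂ) (hX : X ≠ 0)
        (v : SplitBundle n s (Projectivization.mk ℂ X hX)),
        homogVal n s ((ψ A).equiv _ v) X =
          (A.1.1.map (MvPolynomial.eval X)).mulVec (homogVal n s v X)) ∧
      -- `S` is Serre duality, given by residues
      (∀ (f : ∀ p, SplitBundle n s p)
        (hf : IsHolSection ((Σ i, Fin (s i)) → ℂ) f (coordOpen 0 ∩ coordOpen 1))
        (i : Fin m) (a : Fin (s i)) (P : binForm (-2 - n i)),
        S (standardClass n s hf) i a P = serreResidue n s f ⟨i, a⟩ P) ∧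
      -- the action of `Aut` on `H¹` is the action of `G` by transposed multiplication maps
      (∀ (A : structGroup n s hn) (h : H1 ((Σ i, Fin (s i)) → ℂ) (SplitBundle n s))
        (i : Fin m), S (ψ A • h) i = ∑ j, transposeMul A.1 i j (S h j)) ∧
      -- `κ` classifies an affine bundle by its cohomology invariant
      (∀ (A : AffBundleWithLin ((Σ i, Fin (s i)) → ℂ) (SplitBundle n s) (∑ i, s i))
        (f : HolIso ((Σ i, Fin (s i)) → ℂ) (SplitBundle n s) (Fin (∑ i, s i) → ℂ) A.1.Lin),
        κ (Quotient.mk _ A) = Quotient.mk _ (f.symm.H1map A.1.hClass)) ∧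
      -- the homeomorphism of quotients is induced by `S`
      (∀ h : H1 ((Σ i, Fin (s i)) → ℂ) (SplitBundle n s),
        Θ (Quotient.mk _ h) = Quotient.mk _ (S h)) := by
  exact ⟨isAffineAlgebraicGroup hn, autEquiv s hn, serreDuality n s, affClassesEquiv n s,
    orbitsHomeomorph n s hn, fun A X hX v => homogVal_mulFiber A.1 X hX v,
    fun f hf i a P => serreDuality_standardClass hf i a P, serreDuality_smul hn,
    fun A f => affInvariant_mk A f, fun _ => rfl⟩
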